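/- Let $\mathfrak g$ be a finite-dimensional real Lie algebra with basis $e_a$ and $[e_a,e_b]=f_{ab}^c e_c$. Let $W\mathfrak g=S\mathfrak g^*\otimes\wedge\mathfrak g^*$ be the Weil algebra, with generators $t^a\in S^1\mathfrak g^*$ of degree $2$ and $\theta^a\in\wedge^1\mathfrak g^*$ of degree $1$ (both the dual basis), the diagonal coadjoint action of $\mathfrak g$, and the differential given by the derivation of degree one with $d\theta^a=t^a-\tfrac12 f^a_{bc}\theta^b\theta^c$ and $dt^a=-f^a_{bc}\theta^bt^c$. Let $S^+\mathfrak g=\bigoplus_{k\ge1}S^k\mathfrak g$ with $S^k\mathfrak g$ in degree $1-2k$, let $\mathcal L(S^+\mathfrak g)$ be the graded free Lie algebra on $S^+\mathfrak g$, and let $D\mathfrak g=\mathfrak g\ltimes\mathcal L(S^+\mathfrak g)$, where $\mathfrak g$ has degree $0$ and acts by the adjoint action. Thus $D\mathfrak g$ has generators $l(x)$ ($x\in\mathfrak g$) and $\mathcal I(u)$ ($u\in S^+\mathfrak g$), linear in $x$ and $u$, and relations $[l(x),l(y)]=l([x,y])$, $[l(x),\mathcal I(u)]=\mathcal I(\mathrm{ad}_x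 u)$. Its differential is the derivation of degree one with $dl(x)=0$, $d\mathcal I(x)=l(x)$ and $d\mathcal I(x^k)=\tfrac12\sum_{s=1}^{k-1}[\mathcal I(x^s),\mathcal I(x^{k-s})]$ for $x\in\mathfrak g$, $k\ge2$. Let $W\mathfrak g\otimes\mathcal U(\mathcal L(S^+\mathfrak g))\subset W\mathfrak g\otimes\mathcal U(D\mathfrak g)$ denote the graded tensor products with the enveloping algebras, completed with respect to the degree in the second factor, with differential $d=d_{W\mathfrak g}+d_{D\mathfrak g}$. The first one is a (completed) Hopf algebra over $W\mathfrak g$ with the coproduct induced by that of $\mathcal U(\mathcal L(S^+\mathfrak g))$. Put $$l(\theta)=\sum_a\theta^a\otimes l(e_a),\qquad i(t)=\sum_{k\ge1}\ \sum_{a_1,\dots,a_k}t^{a_1}\cdots t^{a_k}\otimes\mathcal I(e_{a_1}\cdots e_{a_k}).$$ **Theorem.** There exists a $\mathfrak g$-invariant group-like element $\Phi\in W\mathfrak g\otimes\mathcal U(\mathcal L(S^+\mathfrak g))\subset W\mathfrak g\otimes\mathcal U(D\mathfrak g)$ of degree zero such that $$\Phi^{-1}d\Phi=-i(t)+l(\theta).$$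 Moreover, $\Phi$ generalizes the Kalkman element: let $\mathfrak g\varepsilon$ be the abelian graded Lie algebra with elements $I(x)$, $x\in\mathfrak g$, of degree $-1$. Under the projection $\mathcal U(\mathcal L(S^+\mathfrak g))\to\mathcal U(\mathfrak g\varepsilon)=\wedge\mathfrak g$ with $\mathcal I(x)\mapsto I(x)$ for $x\in\mathfrak g$ and $\mathcal I(u)\mapsto0$ for $u\in S^k\mathfrak g$, $k\ge2$, the element $\Phi$ is mapped to $\exp(-I(\theta))$, where $I(\theta)=\sum_a\theta^a\otimes I(e_a)$. -/

import Mathlib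

open scoped TensorProduct

namespace DgTwist
noncomputable section
set_option linter.unusedSectionVars false

/-! ### Superalgebras and their tensor products -/

/-- A superalgebra over `ℝ`, presented by its parity involution `σ`:
`σ a = (-1) ^ |a| • a` for homogeneous `a`. -/
class SuperAlg (A : Type*) [Ring A] [Algebra ℝ A] where
  σ : A →ₐ[ℝ] A
  σ_σ : ∀ a, σ (σ a) = a

theorem zmod_two_cases (i : ZMod 2) : i = 0 ∨ i = 1 := by
  revert i; decide

section super
variable (A B : Type*) [Ring A] [Algebra ℝ A] [SuperAlg A] [Ring B] [Algebra ℝ B] [SuperAlg B]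

/-- The even (`i = 0`) and the odd (`i = 1`) part of a superalgebra. -/
def parity (i : ZMod 2) : Submodule ℝ A where
  carrier := {a | SuperAlg.σ a = if i = 0 then a else -a}
  add_mem' := fun {a b} ha hb => by
    simp only [Set.mem_ofPred_eq] at *
    rw [map_add, ha, hb]
    split_ifs
    · rfl
    · abel
  zero_mem' := by simp
  smul_mem' := fun c a ha => by
    simp only [Set.mem_ofPred_eq] at *
    rw [map_smul, ha]
    split_ifs <;> simp

variable {A} in
theorem mem_parity {i : ZMod 2} {a : A} :
    a ∈ parity A i ↔ SuperAlg.σ a = if i = 0 then a else -a := Iff.rfl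

instance : SetLike.GradedMonoid (parity A) where
  one_mem := by simp [mem_parity]
  mul_mem := fun i j a b ha hb => by
    rw [mem_parity] at *
    rw [map_mul, ha, hb]
    have h2 : (1 : ZMod 2) + 1 = 0 := by decide
    obtain rfl | rfl := zmod_two_cases i <;> obtain rfl | rfl := zmod_two_cases j <;> simp [h2]

/-- The projection of a superalgebra to its even or odd part. -/
def parityProj (i : ZMod 2) : A →ₗ[ℝ] parity A i :=
  LinearMap.codRestrict _
    ((2⁻¹ : ℝ) • (LinearMap.id + (if i = 0 then (1 : ℝ) else -1) • (SuperAlg.σ (A := A)).toLinearMap))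
    (fun a => by
      rw [mem_parity]
      split_ifs <;> simp [SuperAlg.σ_σ, add_comm])

theorem parityProj_of_mem (i : ZMod 2) (a : parity A i) (j : ZMod 2) :
    parityProj A j a = if h : j = i then h ▸ a else 0 := by
  obtain ⟨a, ha⟩ := a
  rw [mem_parity] at ha
  apply Subtype.ext
  obtain rfl | rfl := zmod_two_cases i <;> obtain rfl | rfl := zmod_two_cases j <;>
    simp at ha <;> simp [parityProj, ha] <;> module

instance : GradedAlgebra (parity A) where
  toDecomposition := DirectSum.Decomposition.ofLinearMap _
    (∑ i, (DirectSum.lof ℝ (ZMod 2) (fun i => parity A i) i) ∘ₗ parityProj A i)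
    (by
      ext a
      have : (∑ i : ZMod 2, (parityProj A i a : A)) = a := by
        rw [show (Finset.univ : Finset (ZMod 2)) = {0, 1} from rfl, Finset.sum_pair (by decide)]
        simp only [parityProj, LinearMap.codRestrict_apply]
        simp only [if_true, if_neg (one_ne_zero : (1 : ZMod 2) ≠ 0), LinearMap.smul_apply,
          LinearMap.add_apply, LinearMap.id_apply, AlgHom.toLinearMap_apply]
        module
      simpa [LinearMap.sum_apply] using this)
    (by
      ext i a : 2
      simp only [LinearMap.comp_apply, LinearMap.sum_apply, DirectSum.coeLinearMap_lof,
        parityProj_of_mem, LinearMap.id_apply]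
      rw [Finset.sum_eq_single i]
      · simp
      · intro j _ hj
        simp [hj]
      · simp)

/-- The tensor product of superalgebras, with `(a ⊗ b)(a' ⊗ b') = (-1)^(|b||a'|) aa' ⊗ bb'`. -/
abbrev STensor : Type _ := parity A ᵍ⊗[ℝ] parity B

variable {A B} in
/-- The pure tensor `a ⊗ b`. -/
def tm (a : A) (b : B) : STensor A B := GradedTensorProduct.tmul ℝ a b

instance : SuperAlg (STensor A B) where
  σ := GradedTensorProduct.lift (parity A) (parity B)
    ((GradedTensorProduct.includeLeft (parity A) (parity B)).comp SuperAlg.σ)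
    ((GradedTensorProduct.includeRight (parity A) (parity B)).comp SuperAlg.σ)
    (fun i j a b => by
      have ha : SuperAlg.σ (a : A) ∈ parity A i := by
        have := a.2
        rw [mem_parity] at *
        rw [SuperAlg.σ_σ, this]; split_ifs <;> simp
      have hb : SuperAlg.σ (b : B) ∈ parity B j := by
        have := b.2
        rw [mem_parity] at *
        rw [SuperAlg.σ_σ, this]; split_ifs <;> simp
      have := GradedTensorProduct.tmul_coe_mul_coe_tmul (R := ℝ) (parity A) (parity B) 1 ⟨_, hb⟩ ⟨_, ha⟩ 1
      simp only [AlgHom.comp_apply, GradedTensorProduct.includeLeft_apply,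
        GradedTensorProduct.includeRight_apply]
      rw [GradedTensorProduct.tmul_one_mul_one_tmul]
      simp only [one_mul, mul_one] at this
      rw [this, smul_smul, Int.units_mul_self, one_smul])
  σ_σ := fun x => by
    induction x using TensorProduct.induction_on with
    | zero => exact (congrArg _ (map_zero _)).trans (map_zero _)
    | add x y hx hy => exact (congrArg _ (map_add _ x y)).trans ((map_add _ _ _).trans (congrArg₂ _ hx hy))
    | tmul a b =>
      change GradedTensorProduct.lift (parity A) (parity B) _ _ _
        (GradedTensorProduct.lift (parity A) (parity B) _ _ _ (GradedTensorProduct.tmul ℝ a b)) = _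
      simp only [GradedTensorProduct.lift_tmul, AlgHom.comp_apply,
        GradedTensorProduct.includeLeft_apply, GradedTensorProduct.includeRight_apply,
        GradedTensorProduct.tmul_one_mul_one_tmul, SuperAlg.σ_σ]
      rfl

theorem σ_tm (a : A) (b : B) : SuperAlg.σ (tm a b) = tm (SuperAlg.σ a) (SuperAlg.σ b) :=
  GradedTensorProduct.tmul_one_mul_one_tmul (R := ℝ) (parity A) (parity B) _ _

variable {A B} in
/-- The tensor product `f ⊗ g` of linear maps (without a sign). -/
def smap {A' B' : Type*} [Ring A'] [Algebra ℝ A'] [SuperAlg A'] [Ring B'] [Algebra ℝ B']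
    [SuperAlg B'] (f : A →ₗ[ℝ] A') (g : B →ₗ[ℝ] B') : STensor A B →ₗ[ℝ] STensor A' B' :=
  (GradedTensorProduct.of ℝ (parity A') (parity B')).toLinearMap ∘ₗ TensorProduct.map f g ∘ₗ
    (GradedTensorProduct.of ℝ (parity A) (parity B)).symm.toLinearMap

end super

section data
variable {g : Type*} [LieRing g] [LieAlgebra ℝ g] {ι : Type*} [Fintype ι] (b : Module.Basis ι ℝ g)

/-- The structure constants: `[e_a, e_a'] = ∑ c, f_{aa'}^c e_c`. -/
def strConst (a a' c : ι) : ℝ := b.repr ⁅b a, b a'⁆ c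

/-! ### The Weil algebra -/

variable (g ι) in
/-- The Weil algebra `Wg = S(g*) ⊗ Λ(g*)`. A basis `e_a` of `g` being chosen, `S(g*)` is the
polynomial ring on the generators `t^a = X a` (of degree two). -/
def Weil : Type _ := MvPolynomial ι ℝ ⊗[ℝ] ExteriorAlgebra ℝ (Module.Dual ℝ g)

instance : Ring (Weil g ι) :=
  inferInstanceAs (Ring (MvPolynomial ι ℝ ⊗[ℝ] ExteriorAlgebra ℝ (Module.Dual ℝ g)))

instance : Algebra ℝ (Weil g ι) :=
  inferInstanceAs (Algebra ℝ (MvPolynomial ι ℝ ⊗[ℝ] ExteriorAlgebra ℝ (Module.Dual ℝ g)))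

instance : Algebra (MvPolynomial ι ℝ) (Weil g ι) :=
  inferInstanceAs
    (Algebra (MvPolynomial ι ℝ) (MvPolynomial ι ℝ ⊗[ℝ] ExteriorAlgebra ℝ (Module.Dual ℝ g)))

instance : IsScalarTower ℝ (MvPolynomial ι ℝ) (Weil g ι) :=
  inferInstanceAs (IsScalarTower ℝ (MvPolynomial ι ℝ)
    (MvPolynomial ι ℝ ⊗[ℝ] ExteriorAlgebra ℝ (Module.Dual ℝ g)))

/-- The pure tensor `s ⊗ l` in `Wg`. -/
def wt (s : MvPolynomial ι ℝ) (l : ExteriorAlgebra ℝ (Module.Dual ℝ g)) : Weil g ι :=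
  s ⊗ₜ[ℝ] l

theorem wt_mul (s s' : MvPolynomial ι ℝ) (l l' : ExteriorAlgebra ℝ (Module.Dual ℝ g)) :
    wt s l * wt s' l' = wt (s * s') (l * l') :=
  Algebra.TensorProduct.tmul_mul_tmul s s' l l'

/-- The inclusion of `Λ g*` in `Wg`. -/
def extToWeil : ExteriorAlgebra ℝ (Module.Dual ℝ g) →ₐ[ℝ] Weil g ι :=
  Algebra.TensorProduct.includeRight (R := ℝ) (A := MvPolynomial ι ℝ)

/-- The generator `t^a` of `Wg`, of degree two. -/
def tgen (a : ι) : Weil g ι := wt (MvPolynomial.X a) 1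

/-- The degree one element of `Wg` defined by `ξ ∈ g* = Λ¹ g*`. -/
def thetaOf : Module.Dual ℝ g →ₗ[ℝ] Weil g ι :=
  extToWeil.toLinearMap ∘ₗ ExteriorAlgebra.ι ℝ

/-- The generator `θ^a` of `Wg`, of degree one: the dual basis in `Λ¹ g* = g*`. -/
def theta (a : ι) : Weil g ι := thetaOf (b.coord a)

/-- The parity of `Wg`: the generators `t^a` are even and the generators `θ^a` are odd. -/
instance : SuperAlg (Weil g ι) where
  σ := (Algebra.TensorProduct.map (AlgHom.id ℝ (MvPolynomial ι ℝ))
    (ExteriorAlgebra.map (-LinearMap.id)) :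
      MvPolynomial ι ℝ ⊗[ℝ] ExteriorAlgebra ℝ (Module.Dual ℝ g) →ₐ[ℝ] _)
  σ_σ := by
    have h : (-LinearMap.id : Module.Dual ℝ g →ₗ[ℝ] _) ∘ₗ (-LinearMap.id) = LinearMap.id := by
      ext; simp
    have h2 : (Algebra.TensorProduct.map (AlgHom.id ℝ (MvPolynomial ι ℝ))
        (ExteriorAlgebra.map (-LinearMap.id : Module.Dual ℝ g →ₗ[ℝ] _))).comp
        (Algebra.TensorProduct.map (AlgHom.id ℝ (MvPolynomial ι ℝ))
        (ExteriorAlgebra.map (-LinearMap.id))) = AlgHom.id ℝ _ := by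
      rw [← Algebra.TensorProduct.map_comp, ExteriorAlgebra.map_comp_map, h,
        ExteriorAlgebra.map_id, AlgHom.id_comp, Algebra.TensorProduct.map_id]
    exact fun x => DFunLike.congr_fun h2 x

variable (g ι) in
/-- The component `(Wg)^n = ⨁_{2 i + j = n} S^i g* ⊗ Λ^j g*` of degree `n`. -/
def weilDeg (n : ℕ) : Submodule ℝ (Weil g ι) :=
  Submodule.span ℝ {w | ∃ i j, 2 * i + j = n ∧ ∃ s : MvPolynomial ι ℝ, s.IsHomogeneous i ∧
    ∃ l ∈ ⋀[ℝ]^j (Module.Dual ℝ g), w = wt s l}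

/-- `d ξ = ∑ ξ(e_a) t^a - 1/2 ∑ ξ([e_a, e_c]) θ^a θ^c` for `ξ ∈ g* = Λ¹ g*`; in particular
`d θ^a = t^a - 1/2 ∑ f_{bc}^a θ^b θ^c`. -/
def weilDTheta : Module.Dual ℝ g →ₗ[ℝ] Weil g ι :=
  (∑ a, (LinearMap.applyₗ (b a)).smulRight (tgen a)) -
    (2⁻¹ : ℝ) • ∑ a, ∑ c, (LinearMap.applyₗ ⁅b a, b c⁆).smulRight (theta b a * theta b c)

/-- The restriction of the Weil differential to `S g*`: the derivation with
`d t^a = - ∑ f_{bc}^a θ^b t^c`. -/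
def weilDS : Derivation ℝ (MvPolynomial ι ℝ) (Weil g ι) :=
  MvPolynomial.mkDerivation ℝ fun a =>
    - ∑ c, ∑ c', strConst b c c' a • (theta b c * tgen c')

theorem thetaOf_mul_self (ξ : Module.Dual ℝ g) : (thetaOf ξ : Weil g ι) * thetaOf ξ = 0 := by
  rw [thetaOf, LinearMap.comp_apply, AlgHom.toLinearMap_apply, ← map_mul,
    ExteriorAlgebra.ι_sq_zero, map_zero]

theorem commute_tgen (a : ι) (w : Weil g ι) : Commute (tgen a) w := by
  induction w using TensorProduct.induction_on with
  | zero => exact Commute.zero_right (tgen a : Weil g ι)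
  | add x y hx hy => exact Commute.add_right (a := (tgen a : Weil g ι)) hx hy
  | tmul s l =>
    change wt _ _ * wt s l = wt s l * wt _ _
    simp only [wt_mul, one_mul, mul_one, mul_comm]

theorem thetaOf_anticomm (ξ η : Module.Dual ℝ g) :
    (thetaOf ξ : Weil g ι) * thetaOf η = - (thetaOf η * thetaOf ξ) := by
  have h := thetaOf_mul_self (ι := ι) (ξ + η)
  simp only [map_add, add_mul, mul_add, thetaOf_mul_self, zero_add, add_zero] at h
  rw [add_comm] at h
  exact eq_neg_of_add_eq_zero_left h

theorem commute_weilDTheta (ξ η : Module.Dual ℝ g) :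
    Commute (thetaOf ξ) (weilDTheta b η) := by
  have key : ∀ α β : Module.Dual ℝ g,
      Commute (thetaOf ξ : Weil g ι) (thetaOf α * thetaOf β) := fun α β => by
    change _ * _ = _ * _
    rw [← mul_assoc, thetaOf_anticomm ξ α, mul_assoc (thetaOf α), thetaOf_anticomm β ξ,
      neg_mul, mul_neg, mul_assoc]
  simp only [weilDTheta, LinearMap.sub_apply, LinearMap.smul_apply, LinearMap.sum_apply,
    LinearMap.smulRight_apply]
  refine Commute.sub_right ?_ (Commute.smul_right ?_ _)
  · exact Commute.sum_right _ _ _ fun a _ => ((commute_tgen a _).symm).smul_right _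
  · exact Commute.sum_right _ _ _ fun a _ => Commute.sum_right _ _ _ fun c _ =>
      (key _ _).smul_right _

/-- The Weil differential on `Λ g*`, in the upper right corner. An odd derivation `D` is the same
thing as an algebra map `a ↦ !![σ a, D a; 0, a]` to triangular matrices. -/
def weilDExt : ExteriorAlgebra ℝ (Module.Dual ℝ g) →ₐ[ℝ] Matrix (Fin 2) (Fin 2) (Weil g ι) :=
  ExteriorAlgebra.lift ℝ ⟨
    { toFun := fun ξ => !![-thetaOf ξ, weilDTheta b ξ; 0, thetaOf ξ]
      map_add' := fun ξ η => by
        ext i j; fin_cases i <;> fin_cases j <;> simp [add_comm]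
      map_smul' := fun c ξ => by
        ext i j; fin_cases i <;> fin_cases j <;> simp }, fun ξ => by
    ext i j
    fin_cases i <;> fin_cases j <;>
      simp [Matrix.mul_apply, thetaOf_mul_self, (commute_weilDTheta b ξ ξ).eq]⟩

/-- The Weil differential: the odd derivation of `Wg = S g* ⊗ Λ g*` with
`d θ^a = t^a - 1/2 ∑ f_{bc}^a θ^b θ^c` and `d t^a = - ∑ f_{bc}^a θ^b t^c`. -/
def weilD : Weil g ι →ₗ[ℝ] Weil g ι :=
  TensorProduct.lift (R := ℝ) (LinearMap.mk₂ ℝ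
    (fun s l => weilDS b s * extToWeil l + s • weilDExt b l 0 1)
    (fun s s' l => by rw [map_add, add_mul, add_smul]; abel)
    (fun c s l => by rw [Derivation.map_smul, smul_mul_assoc, smul_assoc, smul_add])
    (fun s l l' => by rw [map_add, map_add, mul_add, Matrix.add_apply, smul_add]; abel)
    (fun c s l => by
      rw [map_smul, map_smul, mul_smul_comm, Matrix.smul_apply, smul_comm s c, smul_add]))

/-- The coadjoint action of `x ∈ g` on `g*`. -/
def coad (x : g) : Module.Dual ℝ g →ₗ[ℝ] Module.Dual ℝ g := -(LieAlgebra.ad ℝ g x).dualMap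

/-- The action of `x ∈ g` on `Λ g*` by the even derivation that extends the coadjoint action, in the
upper right corner. An even derivation `D` is the same thing as an algebra map
`a ↦ !![a, D a; 0, a]`. -/
def lieExt (x : g) : ExteriorAlgebra ℝ (Module.Dual ℝ g) →ₐ[ℝ]
    Matrix (Fin 2) (Fin 2) (ExteriorAlgebra ℝ (Module.Dual ℝ g)) :=
  ExteriorAlgebra.lift ℝ ⟨
    { toFun := fun ξ => !![ExteriorAlgebra.ι ℝ ξ, ExteriorAlgebra.ι ℝ (coad x ξ);
        0, ExteriorAlgebra.ι ℝ ξ]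
      map_add' := fun ξ η => by
        ext i j; fin_cases i <;> fin_cases j <;> simp
      map_smul' := fun c ξ => by
        ext i j; fin_cases i <;> fin_cases j <;> simp }, fun ξ => by
    ext i j
    fin_cases i <;> fin_cases j <;>
      simp [Matrix.mul_apply, ExteriorAlgebra.ι_add_mul_swap]⟩

/-- The action of `x ∈ g` on `S g*` by the derivation that extends the coadjoint action. -/
def lieSym (x : g) : Derivation ℝ (MvPolynomial ι ℝ) (MvPolynomial ι ℝ) :=
  MvPolynomial.mkDerivation ℝ fun a => ∑ c, coad x (b.coord a) (b c) • MvPolynomial.X c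

/-- The (diagonal coadjoint) action of `x ∈ g` on `Wg`. -/
def weilLie (x : g) : Weil g ι →ₗ[ℝ] Weil g ι :=
  (TensorProduct.map (lieSym b x).toLinearMap LinearMap.id +
    TensorProduct.map LinearMap.id
      (Matrix.entryLinearMap ℝ _ 0 1 ∘ₗ (lieExt x).toLinearMap) :
    MvPolynomial ι ℝ ⊗[ℝ] ExteriorAlgebra ℝ (Module.Dual ℝ g) →ₗ[ℝ] _)

/-! ### The symmetric algebra `S g` -/

/-- The inclusion `g = S¹ g ⊂ S g = ℝ[X a]`, where the variable `X a` stands for `e_a`. -/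
def linPoly : g →ₗ[ℝ] MvPolynomial ι ℝ := ∑ a, (b.coord a).smulRight (MvPolynomial.X a)

/-- The projection `S g → S¹ g = g`. -/
def linPart : MvPolynomial ι ℝ →ₗ[ℝ] g :=
  ∑ a, (MvPolynomial.lcoeff ℝ (Finsupp.single a 1)).smulRight (b a)

/-- The adjoint action of `x ∈ g` on `S g`, by derivations. -/
def adS (x : g) : Derivation ℝ (MvPolynomial ι ℝ) (MvPolynomial ι ℝ) :=
  MvPolynomial.mkDerivation ℝ fun a => linPoly b ⁅x, b a⁆

/-- The operator on `S g` which is multiplication by `c k` on `S^k g`. -/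
def scale (c : ℕ → ℝ) : MvPolynomial ι ℝ →ₗ[ℝ] MvPolynomial ι ℝ :=
  (MvPolynomial.basisMonomials ι ℝ).constr ℝ fun α => c α.degree • MvPolynomial.monomial α 1

/-- The coproduct of `S g`: the algebra map with `x ↦ x ⊗ 1 + 1 ⊗ x` for `x ∈ g`. -/
def deltaS : MvPolynomial ι ℝ →ₐ[ℝ] MvPolynomial ι ℝ ⊗[ℝ] MvPolynomial ι ℝ :=
  MvPolynomial.aeval fun a => MvPolynomial.X a ⊗ₜ 1 + 1 ⊗ₜ MvPolynomial.X a

/-- The linear map `S g → S g ⊗ S g` with `x^k ↦ ∑_{r + s = k} x^r ⊗ x^s` for `x ∈ g`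
(see `kappa_pow`). -/
def kappa : MvPolynomial ι ℝ →ₗ[ℝ] MvPolynomial ι ℝ ⊗[ℝ] MvPolynomial ι ℝ :=
  TensorProduct.map (scale fun k => (k.factorial : ℝ)) (scale fun k => (k.factorial : ℝ)) ∘ₗ
    deltaS.toLinearMap ∘ₗ scale fun k => (k.factorial : ℝ)⁻¹

theorem scale_monomial (c : ℕ → ℝ) (α : ι →₀ ℕ) :
    scale c (MvPolynomial.monomial α 1) = c α.degree • MvPolynomial.monomial α (1 : ℝ) := by
  have := (MvPolynomial.basisMonomials ι ℝ).constr_basis ℝ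
    (fun α => c α.degree • MvPolynomial.monomial α (1 : ℝ)) α
  rw [MvPolynomial.coe_basisMonomials] at this
  exact this

theorem scale_of_homogeneous (c : ℕ → ℝ) {p : MvPolynomial ι ℝ} {n : ℕ} (hp : p.IsHomogeneous n) :
    scale c p = c n • p := by
  conv_lhs => rw [p.as_sum]
  conv_rhs => rw [p.as_sum]
  rw [map_sum, Finset.smul_sum]
  refine Finset.sum_congr rfl fun α hα => ?_
  have h1 : MvPolynomial.monomial α (p.coeff α) = p.coeff α • MvPolynomial.monomial α (1 : ℝ) := by
    rw [MvPolynomial.smul_monomial, smul_eq_mul, mul_one]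
  have h2 : α.degree = n := by
    by_contra h
    exact (MvPolynomial.mem_support_iff.mp hα) (hp.coeff_eq_zero h)
  rw [h1, map_smul, scale_monomial, h2, smul_comm]

theorem linPoly_homogeneous (x : g) : (linPoly b x).IsHomogeneous 1 := by
  rw [linPoly, LinearMap.sum_apply]
  refine MvPolynomial.IsHomogeneous.sum _ _ _ fun a _ => ?_
  rw [LinearMap.smulRight_apply, MvPolynomial.smul_eq_C_mul]
  exact MvPolynomial.isHomogeneous_C_mul_X _ _

theorem adS_monomial_homogeneous (x : g) (α : ι →₀ ℕ) :
    (adS b x (MvPolynomial.monomial α 1)).IsHomogeneous α.degree := by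
  rw [adS, MvPolynomial.mkDerivation_monomial, one_smul]
  refine MvPolynomial.IsHomogeneous.sum _ _ _ fun a ha => ?_
  have hle : Finsupp.single a 1 ≤ α := by
    rw [Finsupp.single_le_iff]
    exact Nat.one_le_iff_ne_zero.mpr (Finsupp.mem_support_iff.mp ha)
  have hdeg : (α - Finsupp.single a 1).degree + 1 = α.degree := by
    conv_rhs => rw [← tsub_add_cancel_of_le hle, map_add]
    simp
  rw [← hdeg]
  exact (MvPolynomial.isHomogeneous_monomial _ rfl).mul (linPoly_homogeneous b _)

theorem adS_scale (x : g) (c : ℕ → ℝ) (p : MvPolynomial ι ℝ) :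
    adS b x (scale c p) = scale c (adS b x p) := by
  have : (adS b x).toLinearMap ∘ₗ scale c = scale c ∘ₗ (adS b x).toLinearMap := by
    refine (MvPolynomial.basisMonomials ι ℝ).ext fun α => ?_
    simp only [MvPolynomial.coe_basisMonomials, LinearMap.comp_apply, scale_monomial, map_smul]
    exact (scale_of_homogeneous c (adS_monomial_homogeneous b x α)).symm
  exact LinearMap.congr_fun this p

/-- The diagonal action of a derivation of `S g` on `S g ⊗ S g`. -/
def diag (D : Derivation ℝ (MvPolynomial ι ℝ) (MvPolynomial ι ℝ)) :
    MvPolynomial ι ℝ ⊗[ℝ] MvPolynomial ι ℝ →ₗ[ℝ] MvPolynomial ι ℝ ⊗[ℝ] MvPolynomial ι ℝ :=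
  TensorProduct.map D.toLinearMap LinearMap.id + TensorProduct.map LinearMap.id D.toLinearMap

theorem diag_tmul (D : Derivation ℝ (MvPolynomial ι ℝ) (MvPolynomial ι ℝ))
    (p q : MvPolynomial ι ℝ) : diag D (p ⊗ₜ q) = D p ⊗ₜ q + p ⊗ₜ D q := rfl

theorem diag_mul (D : Derivation ℝ (MvPolynomial ι ℝ) (MvPolynomial ι ℝ))
    (z w : MvPolynomial ι ℝ ⊗[ℝ] MvPolynomial ι ℝ) :
    diag D (z * w) = z * diag D w + diag D z * w := by
  induction z using TensorProduct.induction_on with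
  | zero => simp
  | add z z' h h' => rw [add_mul, map_add, h, h', map_add]; ring
  | tmul p q =>
    induction w using TensorProduct.induction_on with
    | zero => simp
    | add w w' h h' => rw [mul_add, map_add, h, h', map_add]; ring
    | tmul p' q' =>
      simp only [Algebra.TensorProduct.tmul_mul_tmul, diag_tmul, Derivation.leibniz, smul_eq_mul,
        TensorProduct.add_tmul, TensorProduct.tmul_add, mul_add, add_mul]
      rw [mul_comm p' (D p), mul_comm q' (D q)]
      abel

theorem deltaS_linPoly (x : g) :
    deltaS (linPoly b x) = linPoly b x ⊗ₜ 1 + 1 ⊗ₜ linPoly b x := by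
  simp only [linPoly, LinearMap.sum_apply, LinearMap.smulRight_apply, map_sum, map_smul, deltaS,
    MvPolynomial.aeval_X, TensorProduct.sum_tmul, TensorProduct.tmul_sum, smul_add,
    Finset.sum_add_distrib, TensorProduct.smul_tmul', TensorProduct.tmul_smul]

theorem deltaS_adS (x : g) (p : MvPolynomial ι ℝ) :
    deltaS (adS b x p) = diag (adS b x) (deltaS p) := by
  induction p using MvPolynomial.induction_on with
  | C r =>
    rw [MvPolynomial.derivation_C, map_zero, show (MvPolynomial.C r : MvPolynomial ι ℝ) =
      algebraMap ℝ _ r from rfl, AlgHom.commutes, Algebra.TensorProduct.algebraMap_apply,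
      diag_tmul]
    simp
  | add p q hp hq => simp only [map_add, hp, hq]
  | mul_X p a hp =>
    rw [Derivation.leibniz, map_add, smul_eq_mul, smul_eq_mul, map_mul, map_mul, map_mul, diag_mul,
      hp, adS, MvPolynomial.mkDerivation_X, deltaS_linPoly, ← adS]
    have : diag (adS b x) (deltaS (MvPolynomial.X a)) =
        linPoly b ⁅x, b a⁆ ⊗ₜ 1 + 1 ⊗ₜ linPoly b ⁅x, b a⁆ := by
      rw [deltaS, MvPolynomial.aeval_X, map_add, diag_tmul, diag_tmul, adS,
        MvPolynomial.mkDerivation_X]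
      simp
    rw [this, mul_comm (deltaS (MvPolynomial.X a))]

theorem kappa_adS (x : g) (p : MvPolynomial ι ℝ) :
    kappa (adS b x p) = diag (adS b x) (kappa p) := by
  have key : ∀ (c : ℕ → ℝ) (z : MvPolynomial ι ℝ ⊗[ℝ] MvPolynomial ι ℝ),
      TensorProduct.map (scale c) (scale c) (diag (adS b x) z) =
        diag (adS b x) (TensorProduct.map (scale c) (scale c) z) := fun c z => by
    induction z using TensorProduct.induction_on with
    | zero => simp
    | add z z' h h' => simp only [map_add, h, h']
    | tmul p q => simp only [diag_tmul, map_add, TensorProduct.map_tmul, adS_scale]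
  simp only [kappa, LinearMap.comp_apply, AlgHom.toLinearMap_apply]
  rw [← adS_scale, deltaS_adS, key]

theorem kappa_pow (x : g) (k : ℕ) :
    kappa (linPoly b x ^ k) =
      ∑ r ∈ Finset.HasAntidiagonal.antidiagonal k, (linPoly b x ^ r.1) ⊗ₜ[ℝ] (linPoly b x ^ r.2) := by
  have hp : ∀ m, (linPoly b x ^ m).IsHomogeneous m := fun m => by
    simpa using (linPoly_homogeneous b x).pow m
  have hc : Commute (linPoly b x ⊗ₜ[ℝ] (1 : MvPolynomial ι ℝ)) (1 ⊗ₜ[ℝ] linPoly b x) :=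
    mul_comm _ _
  simp only [kappa, LinearMap.comp_apply, AlgHom.toLinearMap_apply, scale_of_homogeneous _ (hp k),
    map_smul, map_pow, deltaS_linPoly, hc.add_pow']
  rw [map_sum, Finset.smul_sum]
  refine Finset.sum_congr rfl fun r hr => ?_
  rw [Finset.HasAntidiagonal.mem_antidiagonal] at hr
  simp only [Algebra.TensorProduct.tmul_pow, one_pow, Algebra.TensorProduct.tmul_mul_tmul, one_mul,
    mul_one, map_nsmul, TensorProduct.map_tmul, scale_of_homogeneous _ (hp _)]
  rw [TensorProduct.smul_tmul_smul, ← Nat.cast_smul_eq_nsmul ℝ, smul_smul, smul_smul]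
  have h := Nat.choose_mul_factorial_mul_factorial (n := k) (k := r.1) (by omega)
  rw [show k - r.1 = r.2 by omega] at h
  have h' : ((k.choose r.1 : ℕ) : ℝ) * r.1.factorial * r.2.factorial = k.factorial := by
    exact_mod_cast h
  have h0 : (k.factorial : ℝ) ≠ 0 := by positivity
  rw [show (k.factorial : ℝ)⁻¹ * (k.choose r.1) * (r.1.factorial * r.2.factorial) = 1 by
    rw [mul_assoc, ← mul_assoc (k.choose r.1 : ℝ), h', inv_mul_cancel₀ h0], one_smul]

theorem linPart_of_homogeneous {p : MvPolynomial ι ℝ} {n : ℕ} (hp : p.IsHomogeneous n)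
    (hn : n ≠ 1) : linPart b p = 0 := by
  rw [linPart, LinearMap.sum_apply]
  refine Finset.sum_eq_zero fun a _ => ?_
  rw [LinearMap.smulRight_apply, MvPolynomial.lcoeff_apply, hp.coeff_eq_zero (by simpa using hn.symm),
    zero_smul]

theorem linPart_linPoly (x : g) : linPart b (linPoly b x) = x := by
  classical
  conv_rhs => rw [← b.sum_repr x]
  rw [linPart, LinearMap.sum_apply]
  refine Finset.sum_congr rfl fun a _ => ?_
  simp [linPoly, MvPolynomial.coeff_X, Finsupp.single_left_inj]

theorem linPart_adS (x : g) (p : MvPolynomial ι ℝ) :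
    linPart b (adS b x p) = ⁅x, linPart b p⁆ := by
  have : linPart b ∘ₗ (adS b x).toLinearMap = LieAlgebra.ad ℝ g x ∘ₗ linPart b := by
    refine (MvPolynomial.basisMonomials ι ℝ).ext fun α => ?_
    simp only [MvPolynomial.coe_basisMonomials, LinearMap.comp_apply]
    by_cases h : α.degree = 1
    · obtain ⟨a, rfl⟩ := (Finsupp.sum_eq_one_iff α).mp h
      have hX : MvPolynomial.X a = linPoly b (b a) := by
        classical
        simp [linPoly, Finsupp.single_apply]
      change linPart b (adS b x (MvPolynomial.X a)) = ⁅x, linPart b (MvPolynomial.X a)⁆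
      rw [adS, MvPolynomial.mkDerivation_X, hX, linPart_linPoly, linPart_linPoly]
    · rw [linPart_of_homogeneous b (MvPolynomial.isHomogeneous_monomial _ rfl) h, map_zero]
      exact linPart_of_homogeneous b (adS_monomial_homogeneous b x α) h
  exact LinearMap.congr_fun this p

/-! ### The enveloping algebras of `L(S⁺g)` and of `Dg` -/

variable (ι) in
/-- `S⁺g = ⨁_{k ≥ 1} S^k g`, the polynomials without constant term. -/
def SPlus : Submodule ℝ (MvPolynomial ι ℝ) := LinearMap.ker (MvPolynomial.lcoeff ℝ 0)

/-- The projection `S g → S⁺g` along `S⁰ g`. -/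
def toPlus : MvPolynomial ι ℝ →ₗ[ℝ] SPlus ι :=
  LinearMap.codRestrict _
    (LinearMap.id - Algebra.linearMap ℝ (MvPolynomial ι ℝ) ∘ₗ MvPolynomial.lcoeff ℝ 0)
    (fun p => by simp [SPlus, MvPolynomial.algebraMap_eq])

theorem coe_toPlus (p : MvPolynomial ι ℝ) :
    (toPlus p : MvPolynomial ι ℝ) = p - MvPolynomial.C (p.coeff 0) := rfl

theorem toPlus_of_mem (u : SPlus ι) : toPlus (u : MvPolynomial ι ℝ) = u := by
  have h : MvPolynomial.coeff 0 (u : MvPolynomial ι ℝ) = 0 := u.2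
  apply Subtype.ext
  rw [coe_toPlus, h, map_zero, sub_zero]

theorem adS_coeff_zero (x : g) (p : MvPolynomial ι ℝ) : (adS b x p).coeff 0 = 0 := by
  induction p using MvPolynomial.induction_on with
  | C r => rw [MvPolynomial.derivation_C, MvPolynomial.coeff_zero]
  | add p q hp hq => rw [map_add, MvPolynomial.coeff_add, hp, hq, add_zero]
  | mul_X p a hp =>
    have h := (linPoly_homogeneous b ⁅x, b a⁆).coeff_eq_zero (d := 0) (by simp)
    rw [← MvPolynomial.constantCoeff_eq] at *
    rw [Derivation.leibniz, map_add, smul_eq_mul, smul_eq_mul, map_mul, map_mul, hp, adS,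
      MvPolynomial.mkDerivation_X, h, mul_zero, mul_zero, add_zero]

/-- The adjoint action of `x ∈ g` on `S⁺g`. -/
def adPlus (x : g) : SPlus ι →ₗ[ℝ] SPlus ι :=
  LinearMap.codRestrict _ ((adS b x).toLinearMap ∘ₗ (SPlus ι).subtype)
    (fun u => adS_coeff_zero b x u)

theorem coe_adPlus (x : g) (u : SPlus ι) :
    (adPlus b x u : MvPolynomial ι ℝ) = adS b x u := rfl

variable (ι) in
/-- The enveloping algebra `U(L(S⁺g))` of the graded free Lie algebra `L(S⁺g)`: the free associative
algebra on the vector space `S⁺g`, with `S^k g` in degree `1 - 2 k`. -/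
abbrev UL : Type _ := TensorAlgebra ℝ (SPlus ι)

/-- All elements of `S⁺g` are odd. -/
instance : SuperAlg (UL ι) where
  σ := TensorAlgebra.lift ℝ (-TensorAlgebra.ι ℝ)
  σ_σ := by
    have h : (TensorAlgebra.lift ℝ (-TensorAlgebra.ι ℝ) : UL ι →ₐ[ℝ] UL ι).comp
        (TensorAlgebra.lift ℝ (-TensorAlgebra.ι ℝ)) = AlgHom.id ℝ _ := by
      ext u
      simp
    exact fun x => DFunLike.congr_fun h x

variable (ι) in
/-- The component `U(L(S⁺g))^{-n}`: it is spanned by the products `u₁ ⋯ u_m` with `u_i` in some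
`S^{k_i} g`, `k_i ≥ 1`, and `∑ (2 k_i - 1) = n`. -/
def ulDeg (n : ℕ) : Submodule ℝ (UL ι) :=
  Submodule.span ℝ {y | ∃ w : List (ℕ × SPlus ι),
    (∀ p ∈ w, 1 ≤ p.1 ∧ (p.2 : MvPolynomial ι ℝ).IsHomogeneous p.1) ∧
    (w.map fun p => 2 * p.1 - 1).sum = n ∧ y = (w.map fun p => TensorAlgebra.ι ℝ p.2).prod}

/-- The action of `x ∈ g` on `U(L(S⁺g))` by the even derivation that extends the adjoint action on
`S⁺g`, in the upper right corner. -/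
def ulAd (x : g) : UL ι →ₐ[ℝ] Matrix (Fin 2) (Fin 2) (UL ι) :=
  TensorAlgebra.lift ℝ
    { toFun := fun u => !![TensorAlgebra.ι ℝ u, TensorAlgebra.ι ℝ (adPlus b x u);
        0, TensorAlgebra.ι ℝ u]
      map_add' := fun u v => by
        ext i j; fin_cases i <;> fin_cases j <;> simp
      map_smul' := fun c u => by
        ext i j; fin_cases i <;> fin_cases j <;> simp }

/-- The action of `x ∈ g` on `U(L(S⁺g))`. -/
def ulLie (x : g) : UL ι →ₗ[ℝ] UL ι := Matrix.entryLinearMap ℝ _ 0 1 ∘ₗ (ulAd b x).toLinearMap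

/-- The defining relations of `Dg = g ⋉ L(S⁺g)`: `[l(x), l(y)] = l([x, y])` and
`[l(x), I(u)] = I(ad_x u)`. -/
inductive DRel : TensorAlgebra ℝ (g × SPlus ι) → TensorAlgebra ℝ (g × SPlus ι) → Prop
  | ll (x y : g) : DRel
      (TensorAlgebra.ι ℝ (x, 0) * TensorAlgebra.ι ℝ (y, 0) -
        TensorAlgebra.ι ℝ (y, 0) * TensorAlgebra.ι ℝ (x, 0))
      (TensorAlgebra.ι ℝ (⁅x, y⁆, 0))
  | lI (x : g) (u : SPlus ι) : DRel
      (TensorAlgebra.ι ℝ (x, 0) * TensorAlgebra.ι ℝ (0, u) -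
        TensorAlgebra.ι ℝ (0, u) * TensorAlgebra.ι ℝ (x, 0))
      (TensorAlgebra.ι ℝ (0, adPlus b x u))

/-- The enveloping algebra `U(Dg)`. The graded Lie algebra `Dg` is presented by generators `l(x)`
(`x ∈ g`, degree `0`) and `I(u)` (`u ∈ S^k g`, degree `1 - 2 k`), linear in `x` and in `u`, and the
relations `DRel`, so that `U(Dg)` is the associative algebra with this presentation. -/
def UD : Type _ := RingQuot (DRel b)

instance : Ring (UD b) := inferInstanceAs (Ring (RingQuot (DRel b)))

instance : Algebra ℝ (UD b) := inferInstanceAs (Algebra ℝ (RingQuot (DRel b)))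

/-- The quotient map of the presentation of `U(Dg)`. -/
def udMk : TensorAlgebra ℝ (g × SPlus ι) →ₐ[ℝ] UD b := RingQuot.mkAlgHom ℝ (DRel b)

/-- The generator `l(x)`, `x ∈ g`. -/
def lgen : g →ₗ[ℝ] UD b :=
  (udMk b).toLinearMap ∘ₗ TensorAlgebra.ι ℝ ∘ₗ LinearMap.inl ℝ g (SPlus ι)

/-- The generator `I(u)`, `u ∈ S⁺g`; as a map on `S g`, it is extended by `I(1) = 0`. -/
def Igen : MvPolynomial ι ℝ →ₗ[ℝ] UD b :=
  (udMk b).toLinearMap ∘ₗ TensorAlgebra.ι ℝ ∘ₗ LinearMap.inr ℝ g (SPlus ι) ∘ₗ toPlus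

theorem Igen_toPlus (p : MvPolynomial ι ℝ) : Igen b (toPlus p : MvPolynomial ι ℝ) = Igen b p := by
  simp only [Igen, LinearMap.comp_apply, toPlus_of_mem]

/-- The universal property of the presentation of `U(Dg)`. -/
def udLift {A : Type*} [Ring A] [Algebra ℝ A] (f : g →ₗ[ℝ] A) (k : SPlus ι →ₗ[ℝ] A)
    (hf : ∀ x y, f x * f y - f y * f x = f ⁅x, y⁆)
    (hk : ∀ x u, f x * k u - k u * f x = k (adPlus b x u)) : UD b →ₐ[ℝ] A :=
  RingQuot.liftAlgHom ℝ ⟨TensorAlgebra.lift ℝ (f.coprod k), by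
    rintro p q (⟨x, y⟩ | ⟨x, u⟩)
    · simp [hf]
    · simp [hk]⟩

section lift
variable {A : Type*} [Ring A] [Algebra ℝ A] (f : g →ₗ[ℝ] A) (k : SPlus ι →ₗ[ℝ] A)
    (hf : ∀ x y, f x * f y - f y * f x = f ⁅x, y⁆)
    (hk : ∀ x u, f x * k u - k u * f x = k (adPlus b x u))

theorem udLift_lgen (x : g) : udLift b f k hf hk (lgen b x) = f x := by
  refine (RingQuot.liftAlgHom_mkAlgHom_apply ℝ _ _ _).trans ?_
  simp

theorem udLift_Igen (p : MvPolynomial ι ℝ) : udLift b f k hf hk (Igen b p) = k (toPlus p) := by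
  refine (RingQuot.liftAlgHom_mkAlgHom_apply ℝ _ _ _).trans ?_
  simp

end lift

theorem ud_hom_ext {A : Type*} [Ring A] [Algebra ℝ A] {F G : UD b →ₐ[ℝ] A}
    (hl : ∀ x, F (lgen b x) = G (lgen b x)) (hI : ∀ u : SPlus ι, F (Igen b u) = G (Igen b u)) :
    F = G := by
  refine RingQuot.ringQuot_ext' ℝ _ _ (TensorAlgebra.hom_ext (LinearMap.prod_ext ?_ ?_))
  · exact LinearMap.ext hl
  · refine LinearMap.ext fun u => ?_
    have := hI u
    simp only [Igen, LinearMap.comp_apply, toPlus_of_mem] at this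
    exact this

theorem lgen_lgen (x y : g) : lgen b x * lgen b y - lgen b y * lgen b x = lgen b ⁅x, y⁆ := by
  have := RingQuot.mkAlgHom_rel ℝ (DRel.ll (b := b) x y)
  rw [map_sub, map_mul, map_mul] at this
  exact this

theorem Igen_C (r : ℝ) : Igen b (MvPolynomial.C r) = 0 := by
  have : toPlus (MvPolynomial.C r : MvPolynomial ι ℝ) = 0 := by
    apply Subtype.ext
    rw [coe_toPlus]
    simp
  rw [← Igen_toPlus, this, ZeroMemClass.coe_zero, map_zero]

theorem lgen_Igen (x : g) (p : MvPolynomial ι ℝ) :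
    lgen b x * Igen b p - Igen b p * lgen b x = Igen b (adS b x p) := by
  have h := RingQuot.mkAlgHom_rel ℝ (DRel.lI (b := b) x (toPlus p))
  rw [map_sub, map_mul, map_mul] at h
  have hp : adS b x (toPlus p : MvPolynomial ι ℝ) = adS b x p := by
    rw [coe_toPlus, map_sub, MvPolynomial.derivation_C, sub_zero]
  rw [← hp, ← coe_adPlus]
  simp only [Igen, LinearMap.comp_apply, toPlus_of_mem]
  exact h

/-- The parity of `U(Dg)`: the `l(x)` are even and the `I(u)` are odd. -/
instance : SuperAlg (UD b) where
  σ := udLift b (lgen b) (-(Igen b ∘ₗ (SPlus ι).subtype)) (lgen_lgen b) (fun x u => by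
    simp only [LinearMap.neg_apply, LinearMap.comp_apply, Submodule.subtype_apply, coe_adPlus]
    rw [← lgen_Igen]
    noncomm_ring)
  σ_σ := by
    refine DFunLike.congr_fun (f := AlgHom.comp _ _) (g := AlgHom.id ℝ _)
      (ud_hom_ext b (fun x => ?_) (fun u => ?_))
    · simp [udLift_lgen]
    · simp [udLift_Igen, toPlus_of_mem]

/-- The inclusion `U(L(S⁺g)) → U(Dg)`. -/
def ulToUd : UL ι →ₐ[ℝ] UD b := TensorAlgebra.lift ℝ (Igen b ∘ₗ (SPlus ι).subtype)

/-- The value `d I(u) = [I, I](u) / 2 + l(u)` of the differential, where the last term only sees the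
component of `u` in `S¹ g = g`. By `kappa_pow` and `I(1) = 0`,
`d I(x^k) = ∑_{r + s = k, r, s ≥ 1} I(x^r) I(x^s)` for `k ≥ 2` and `d I(x) = l(x)`, that is
`d i(x) = [i(x), i(x)] / 2 + l(x)` for `i(x) = ∑_k I(x^k)`. -/
def dIgen : MvPolynomial ι ℝ →ₗ[ℝ] UD b :=
  LinearMap.mul' ℝ (UD b) ∘ₗ TensorProduct.map (Igen b) (Igen b) ∘ₗ kappa + lgen b ∘ₗ linPart b

theorem lgen_dIgen (x : g) (p : MvPolynomial ι ℝ) :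
    lgen b x * dIgen b p - dIgen b p * lgen b x = dIgen b (adS b x p) := by
  have key : ∀ z : MvPolynomial ι ℝ ⊗[ℝ] MvPolynomial ι ℝ,
      lgen b x * LinearMap.mul' ℝ (UD b) (TensorProduct.map (Igen b) (Igen b) z) -
        LinearMap.mul' ℝ (UD b) (TensorProduct.map (Igen b) (Igen b) z) * lgen b x =
      LinearMap.mul' ℝ (UD b) (TensorProduct.map (Igen b) (Igen b) (diag (adS b x) z)) := by
    intro z
    induction z using TensorProduct.induction_on with
    | zero => simp
    | add z z' h h' => simp only [map_add, mul_add, add_mul, ← h, ← h']; abel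
    | tmul p q =>
      simp only [diag_tmul, map_add, TensorProduct.map_tmul, LinearMap.mul'_apply, ← lgen_Igen]
      noncomm_ring
  simp only [dIgen, LinearMap.add_apply, LinearMap.comp_apply]
  rw [kappa_adS, ← key, linPart_adS, ← lgen_lgen]
  noncomm_ring

/-- The differential of `U(Dg)`, in the upper right corner: the algebra map
`a ↦ !![σ a, d a; 0, a]`. -/
def udDMat : UD b →ₐ[ℝ] Matrix (Fin 2) (Fin 2) (UD b) :=
  udLift b
    { toFun := fun x => !![lgen b x, 0; 0, lgen b x]
      map_add' := fun x y => by
        ext i j; fin_cases i <;> fin_cases j <;> simp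
      map_smul' := fun c x => by
        ext i j; fin_cases i <;> fin_cases j <;> simp }
    { toFun := fun u => !![-Igen b u, dIgen b u; 0, Igen b u]
      map_add' := fun u v => by
        ext i j; fin_cases i <;> fin_cases j <;> simp [add_comm]
      map_smul' := fun c u => by
        ext i j; fin_cases i <;> fin_cases j <;> simp }
    (fun x y => by
      ext i j; fin_cases i <;> fin_cases j <;> simp [lgen_lgen])
    (fun x u => by
      have h1 := lgen_Igen b x u
      have h2 := lgen_dIgen b x u
      ext i j
      fin_cases i <;> fin_cases j <;> simp [coe_adPlus, h1, h2]
      rw [← h1]; abel)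

/-- The differential of `U(Dg)`: the odd derivation with `d l(x) = 0` and `d I(u) = dIgen b u`. -/
def udD : UD b →ₗ[ℝ] UD b := Matrix.entryLinearMap ℝ _ 0 1 ∘ₗ (udDMat b).toLinearMap

/-! ### Degree completed tensor products -/

/-- An element of the degree completion of `Wg ⊗ U`, where `U = ⨁_n U^{-n}`, is a formal sum
`∑_n φ_n` with `φ_n ∈ Wg ⊗ U^{-n}` for `n = 0, 1, 2, …`. It is written as the power series
`∑_n φ_n z^n` with coefficients in `Wg ⊗ U`; since `z` marks the degree in `U`, the product of power
series is the product of the completion. A linear map that preserves the degree in `U` is applied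
to the coefficients. -/
def cmap {A B : Type*} [Ring A] [Algebra ℝ A] [Ring B] [Algebra ℝ B] (f : A →ₗ[ℝ] B)
    (φ : PowerSeries A) : PowerSeries B :=
  PowerSeries.mk fun n => f (PowerSeries.coeff n φ)

/-- `Φ` is an element of total degree zero of the completion of `Wg ⊗ U(L(S⁺g))`: its `n`-th
coefficient lies in `(Wg)^n ⊗ U(L(S⁺g))^{-n}`. -/
def IsDegreeZero (Φ : PowerSeries (STensor (Weil g ι) (UL ι))) : Prop :=
  ∀ n, PowerSeries.coeff n Φ ∈
    Submodule.span ℝ {z | ∃ w ∈ weilDeg g ι n, ∃ u ∈ ulDeg ι n, z = tm w u}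

/-- `Φ` is invariant for the diagonal action of `g` on (the completion of) `Wg ⊗ U(L(S⁺g))`. -/
def IsInvariant (Φ : PowerSeries (STensor (Weil g ι) (UL ι))) : Prop :=
  ∀ x : g, cmap (smap (weilLie b x) LinearMap.id + smap LinearMap.id (ulLie b x)) Φ = 0

/-- The coproduct of `U(L(S⁺g))`: the algebra map for which the elements of `S⁺g` (and hence those
of `L(S⁺g)`) are primitive. -/
def ulComul : UL ι →ₐ[ℝ] STensor (UL ι) (UL ι) :=
  TensorAlgebra.lift ℝ
    ((GradedTensorProduct.includeLeft (parity (UL ι)) (parity (UL ι))).toLinearMap ∘ₗ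
        TensorAlgebra.ι ℝ +
      (GradedTensorProduct.includeRight (parity (UL ι)) (parity (UL ι))).toLinearMap ∘ₗ
        TensorAlgebra.ι ℝ)

/-- The counit of `U(L(S⁺g))`, extended to `Wg ⊗ U(L(S⁺g)) → Wg`. -/
def weilCounit : STensor (Weil g ι) (UL ι) →ₗ[ℝ] Weil g ι :=
  (TensorProduct.rid ℝ (Weil g ι)).toLinearMap ∘ₗ
    TensorProduct.map LinearMap.id (TensorAlgebra.algebraMapInv (M := SPlus ι)).toLinearMap ∘ₗ
    (GradedTensorProduct.of ℝ (parity (Weil g ι)) (parity (UL ι))).symm.toLinearMap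

/-- `Φ` is group-like in the Hopf algebra `Wg ⊗ U(L(S⁺g))` over `Wg` (completed):
`(id ⊗ Δ) Φ = Φ ⊗_{Wg} Φ` and `(id ⊗ ε) Φ = 1`. Here
`(Wg ⊗ U) ⊗_{Wg} (Wg ⊗ U) = Wg ⊗ (U ⊗ U)`, where `Φ ⊗_{Wg} Φ` is the product of the images of `Φ`
under `u ↦ u ⊗ 1` and `u ↦ 1 ⊗ u`. -/
def IsGroupLike (Φ : PowerSeries (STensor (Weil g ι) (UL ι))) : Prop :=
  cmap (smap LinearMap.id ulComul.toLinearMap) Φ =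
    cmap (smap LinearMap.id
      (GradedTensorProduct.includeLeft (parity (UL ι)) (parity (UL ι))).toLinearMap) Φ *
    cmap (smap LinearMap.id
      (GradedTensorProduct.includeRight (parity (UL ι)) (parity (UL ι))).toLinearMap) Φ ∧
  cmap weilCounit Φ = 1

/-- The inclusion of the completion of `Wg ⊗ U(L(S⁺g))` in that of `Wg ⊗ U(Dg)`. -/
def inclD (Φ : PowerSeries (STensor (Weil g ι) (UL ι))) : PowerSeries (STensor (Weil g ι) (UD b)) :=
  cmap (smap LinearMap.id (ulToUd b).toLinearMap) Φ

/-- The differential `d_{Wg} + d_{Dg}` of the completion of `Wg ⊗ U(Dg)`, where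
`d (w ⊗ u) = d w ⊗ u + (-1)^|w| w ⊗ d u`; the differential of `U(Dg)` maps `U(Dg)^{-(n + 1)}` to
`U(Dg)^{-n}`. -/
def totalD (φ : PowerSeries (STensor (Weil g ι) (UD b))) :
    PowerSeries (STensor (Weil g ι) (UD b)) :=
  PowerSeries.mk fun n =>
    smap (weilD b) LinearMap.id (PowerSeries.coeff n φ) +
      smap (SuperAlg.σ (A := Weil g ι)).toLinearMap (udD b) (PowerSeries.coeff (n + 1) φ)

/-- `i(t) = ∑_{k ≥ 1} ∑_{a_1, …, a_k} t^{a_1} ⋯ t^{a_k} ⊗ I(e_{a_1} ⋯ e_{a_k})`; the `k`-th summand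
has degree `1 - 2 k` in `U(Dg)`. -/
def iT : PowerSeries (STensor (Weil g ι) (UD b)) :=
  PowerSeries.mk fun n => if Odd n then
    ∑ f : Fin ((n + 1) / 2) → ι,
      tm (wt (∏ j, MvPolynomial.X (f j)) 1) (Igen b (∏ j, MvPolynomial.X (f j)))
    else 0

/-- `l(θ) = ∑_a θ^a ⊗ l(e_a)`. -/
def lTheta : PowerSeries (STensor (Weil g ι) (UD b)) :=
  PowerSeries.C (∑ a, tm (theta b a) (lgen b (b a)))

/-! ### The Kalkman element -/

/-- The enveloping algebra of the abelian graded Lie algebra `g ε = (Cg)^{-1}` is `Λ g`; its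
generators `I(x)` are odd. -/
instance : SuperAlg (ExteriorAlgebra ℝ g) where
  σ := ExteriorAlgebra.map (-LinearMap.id)
  σ_σ := by
    have h : (ExteriorAlgebra.map (-LinearMap.id : g →ₗ[ℝ] g)).comp
        (ExteriorAlgebra.map (-LinearMap.id)) = AlgHom.id ℝ _ := by
      rw [ExteriorAlgebra.map_comp_map, ← ExteriorAlgebra.map_id]
      congr 1
      ext
      simp
    exact fun x => DFunLike.congr_fun h x

/-- The projection `U(L(S⁺g)) → U(g ε)`, induced by `Dg → Cg`, which maps `I(x)` to `I(x)` for
`x ∈ g` and `I(u)` to `0` for `u ∈ S^k g`, `k ≥ 2`. -/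
def ulToExt : UL ι →ₐ[ℝ] ExteriorAlgebra ℝ g :=
  TensorAlgebra.lift ℝ (ExteriorAlgebra.ι ℝ ∘ₗ linPart b ∘ₗ (SPlus ι).subtype)

/-- The Kalkman element `exp(-I(θ)) = ∑_n (-I(θ))^n / n!`, where `I(θ) = ∑_a θ^a ⊗ I(e_a)`. -/
def kalkman : PowerSeries (STensor (Weil g ι) (ExteriorAlgebra ℝ g)) :=
  PowerSeries.mk fun n => (n.factorial : ℝ)⁻¹ •
    (-∑ a, tm (theta b a) (ExteriorAlgebra.ι ℝ (b a)) :
      STensor (Weil g ι) (ExteriorAlgebra ℝ g)) ^ n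

end data
end
end DgTwist

open scoped TensorProduct

namespace DgTwist
noncomputable section
set_option linter.unusedSectionVars false

/-! ### Calculus in tensor products of superalgebras -/

section superCalculus
variable {A B A' B' A'' B'' : Type*} [Ring A] [Algebra ℝ A] [SuperAlg A]
  [Ring B] [Algebra ℝ B] [SuperAlg B] [Ring A'] [Algebra ℝ A'] [SuperAlg A']
  [Ring B'] [Algebra ℝ B'] [SuperAlg B'] [Ring A''] [Algebra ℝ A''] [SuperAlg A'']
  [Ring B''] [Algebra ℝ B''] [SuperAlg B'']

/-! The equation `dΦ = Φα` for the connection `α = -i(t) + l(θ)` is solved by parallel transport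
along the contraction of the Weil algebra. Everything then follows from uniqueness for one linear
equation.

The Weil algebra is free graded commutative on `θ^a` and `dθ^a` (`tgen_eq`). The odd derivation `K`
with `K t^a = θ^a`, `K θ^a = 0` also satisfies `K dθ^a = θ^a`, so the even derivation `E = dK + Kd`
counts the letters `θ`, `dθ` of a word. Hence `E` is diagonalizable and invertible on the
augmentation ideal, with inverse `G` (`weilE_weilG`, `weilG_weilE`).

Let `h = Kα`. Since `K` kills `θ`, `h = -K i(t)`; it lies in `Wg ⊗ U(L(S⁺g))` and has no term of
degree zero in the second factor. Therefore `E X = X h` can be solved recursively in that degree,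
and a solution is determined by its augmentation (`eul_sol`, `eul_unique`). `Φ` is the solution with
augmentation `1`. Its properties come from comparing solutions:

Group-like: `h` is primitive and `h ⊗ 1` commutes with `1 ⊗ Φ`, all degrees being zero, so `ΔΦ` and
the product of the two copies of `Φ` solve the same equation (`comul_phi`).

Invariance: `E` commutes with the action and `h` is invariant, so `L_x Φ` is a solution with
augmentation `0` (`isInvariant_phi`).

Kalkman element: `h` projects to `-I(θ)`, and `exp(-I(θ))` solves the projected equation
(`ulToExt_phi`).

Differential: `α` is flat, `dα = -α²` (`totalD_maurerCartan`). Thus `Eα = dKα + Kdα = dh - hα + αh`,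
and as `E` commutes with `d` this yields `E(dΦ - Φα) = (dΦ - Φα)h`. The augmentation of `dΦ - Φα`
vanishes, so the difference is zero (`totalD_inclD_phi`). -/

theorem add_tm (a a' : A) (b : B) : tm (a + a') b = tm a b + tm a' b :=
  TensorProduct.add_tmul a a' b

theorem tm_add (a : A) (b b' : B) : tm a (b + b') = tm a b + tm a b' :=
  TensorProduct.tmul_add a b b'

theorem smul_tm (c : ℝ) (a : A) (b : B) : tm (c • a) b = c • tm a b := rfl

theorem tm_smul (c : ℝ) (a : A) (b : B) : tm a (c • b) = c • tm a b :=
  TensorProduct.tmul_smul c a b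

theorem zero_tm (b : B) : tm (0 : A) b = 0 := TensorProduct.zero_tmul A b

theorem tm_zero (a : A) : tm a (0 : B) = 0 := TensorProduct.tmul_zero B a

theorem neg_tm (a : A) (b : B) : tm (-a) b = -tm a b := TensorProduct.neg_tmul a b

theorem tm_neg (a : A) (b : B) : tm a (-b) = -tm a b := TensorProduct.tmul_neg a b

theorem sub_tm (a a' : A) (b : B) : tm (a - a') b = tm a b - tm a' b :=
  TensorProduct.sub_tmul a a' b

theorem tm_sub (a : A) (b b' : B) : tm a (b - b') = tm a b - tm a b' :=
  TensorProduct.tmul_sub a b b'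

theorem sum_tm {κ : Type*} (s : Finset κ) (f : κ → A) (b : B) :
    tm (∑ k ∈ s, f k) b = ∑ k ∈ s, tm (f k) b :=
  TensorProduct.sum_tmul s f b

theorem tm_sum {κ : Type*} (s : Finset κ) (a : A) (f : κ → B) :
    tm a (∑ k ∈ s, f k) = ∑ k ∈ s, tm a (f k) :=
  TensorProduct.tmul_sum a s f

theorem tm_one_one : tm (1 : A) (1 : B) = 1 := rfl

/-- The sign rule is available for homogeneous `a'` only; decomposing `a'` removes this restriction,
because an even `b` passes both components without a sign. -/
theorem tm_mul_of_even (a a' : A) {b : B} (b' : B) (hb : SuperAlg.σ b = b) :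
    tm a b * tm a' b' = tm (a * a') (b * b') := by
  have key : ∀ (i : ZMod 2) (x : parity A i), tm a b * tm (x : A) b' = tm (a * x) (b * b') :=
    fun i x => GradedTensorProduct.tmul_zero_coe_mul_coe_tmul (R := ℝ) (parity A) (parity B) a
      ⟨b, by rw [mem_parity, if_pos rfl, hb]⟩ x b'
  classical
  rw [← DirectSum.sum_support_decompose (parity A) a', Finset.mul_sum, sum_tm, sum_tm,
    Finset.mul_sum]
  exact Finset.sum_congr rfl fun i _ => key i _

/-- The sign `(-1)^|a'|` is absorbed into `σ a'`, which makes sense for inhomogeneous `a'`. Together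
with the even case, this reduces sign computations to the parity of the second factor alone. -/
theorem tm_mul_of_odd (a a' : A) {b : B} (b' : B) (hb : SuperAlg.σ b = -b) :
    tm a b * tm a' b' = tm (a * SuperAlg.σ a') (b * b') := by
  have key : ∀ (i : ZMod 2) (x : parity A i),
      tm a b * tm (x : A) b' = tm (a * SuperAlg.σ (x : A)) (b * b') := fun i x => by
    have h := GradedTensorProduct.tmul_coe_mul_coe_tmul (R := ℝ) (parity A) (parity B) a
      (j₁ := 1) ⟨b, by rw [mem_parity, if_neg one_ne_zero, hb]⟩ x b'
    refine Eq.trans h ?_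
    have hx := x.2
    rw [mem_parity] at hx
    obtain rfl | rfl := zmod_two_cases i
    · simp only [if_true] at hx
      rw [hx, mul_zero, uzpow_zero, one_smul]
      rfl
    · simp only [if_neg (one_ne_zero : (1 : ZMod 2) ≠ 0)] at hx
      rw [hx, mul_one, uzpow_one, mul_neg, neg_tm]
      exact (Units.neg_smul _ _).trans (congrArg _ (one_smul _ _))
  classical
  conv_lhs => rw [← DirectSum.sum_support_decompose (parity A) a']
  conv_rhs => rw [← DirectSum.sum_support_decompose (parity A) a']
  rw [map_sum, Finset.mul_sum, sum_tm, sum_tm, Finset.mul_sum]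
  exact Finset.sum_congr rfl fun i _ => key i _

theorem stensor_induction {p : STensor A B → Prop} (zero : p 0)
    (add : ∀ x y, p x → p y → p (x + y)) (tm : ∀ a b, p (tm a b)) (x : STensor A B) : p x :=
  TensorProduct.induction_on (motive := p) x zero tm add

/-- Induction on a tensor product of superalgebras, with homogeneous second factors. -/
theorem stensor_induction_parity {p : STensor A B → Prop} (zero : p 0)
    (add : ∀ x y, p x → p y → p (x + y))
    (even : ∀ a b, SuperAlg.σ b = b → p (tm a b))
    (odd : ∀ a b, SuperAlg.σ b = -b → p (tm a b)) (x : STensor A B) : p x := by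
  refine stensor_induction zero add (fun a b => ?_) x
  have h : b = (2⁻¹ : ℝ) • (b + SuperAlg.σ b) + (2⁻¹ : ℝ) • (b - SuperAlg.σ b) := by module
  rw [h, tm_add]
  refine add _ _ (even _ _ ?_) (odd _ _ ?_)
  · rw [map_smul, map_add, SuperAlg.σ_σ, add_comm]
  · rw [map_smul, map_sub, SuperAlg.σ_σ, ← smul_neg, neg_sub]

theorem stensor_ext {M : Type*} [AddCommGroup M] [Module ℝ M] {F G : STensor A B →ₗ[ℝ] M}
    (h : ∀ a b, F (tm a b) = G (tm a b)) : F = G :=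
  TensorProduct.ext' h

theorem smap_tm (f : A →ₗ[ℝ] A') (k : B →ₗ[ℝ] B') (a : A) (b : B) :
    smap f k (tm a b) = tm (f a) (k b) := rfl

theorem smap_smap (f : A →ₗ[ℝ] A') (k : B →ₗ[ℝ] B') (f' : A' →ₗ[ℝ] A'') (k' : B' →ₗ[ℝ] B'')
    (x : STensor A B) : smap f' k' (smap f k x) = smap (f' ∘ₗ f) (k' ∘ₗ k) x := by
  refine LinearMap.congr_fun (f := smap f' k' ∘ₗ smap f k) (stensor_ext fun a b => ?_) x
  simp [smap_tm]

theorem smap_id (x : STensor A B) : smap LinearMap.id LinearMap.id x = x := by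
  refine LinearMap.congr_fun (g := LinearMap.id) (stensor_ext fun a b => ?_) x
  simp [smap_tm]

theorem smap_add_left (f f' : A →ₗ[ℝ] A') (k : B →ₗ[ℝ] B') :
    smap (f + f') k = smap f k + smap f' k :=
  stensor_ext fun a b => by simp [smap_tm, add_tm]

theorem smap_sub_left (f f' : A →ₗ[ℝ] A') (k : B →ₗ[ℝ] B') :
    smap (f - f') k = smap f k - smap f' k :=
  stensor_ext fun a b => by simp [smap_tm, sub_tm]

theorem smap_zero_left (k : B →ₗ[ℝ] B') : smap (0 : A →ₗ[ℝ] A') k = 0 :=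
  stensor_ext fun a b => by simp [smap_tm, zero_tm]

theorem smap_one (f : A →ₗ[ℝ] A') (k : B →ₗ[ℝ] B') (hf : f 1 = 1) (hk : k 1 = 1) :
    smap f k 1 = 1 := by
  rw [← tm_one_one, smap_tm, hf, hk, tm_one_one]

/-- A map `f ⊗ k`, where `f` and `k` are multiplicative and respect parity, is multiplicative. -/
theorem smap_mul (f : A →ₐ[ℝ] A') (k : B →ₐ[ℝ] B')
    (hf : ∀ a, f (SuperAlg.σ a) = SuperAlg.σ (f a)) (hk : ∀ b, k (SuperAlg.σ b) = SuperAlg.σ (k b))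
    (x y : STensor A B) :
    smap f.toLinearMap k.toLinearMap (x * y) =
      smap f.toLinearMap k.toLinearMap x * smap f.toLinearMap k.toLinearMap y := by
  induction y using stensor_induction with
  | zero => simp
  | add y y' h h' => simp only [mul_add, map_add, h, h']
  | tm a' b' =>
    induction x using stensor_induction_parity with
    | zero => simp
    | add x x' h h' => simp only [add_mul, map_add, h, h']
    | even a b hb =>
      rw [tm_mul_of_even _ _ _ hb, smap_tm, smap_tm, smap_tm, tm_mul_of_even]
      · simp
      · simp [← hk, hb]
    | odd a b hb =>
      rw [tm_mul_of_odd _ _ _ hb, smap_tm, smap_tm, smap_tm, tm_mul_of_odd]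
      · simp [hf]
      · simp [← hk, hb]

/-! ### Derivations twisted by parity, and their extension to tensor products. -/

/-- `F` is a derivation, twisted by `α` on the left: `F (x y) = F x y + α x F y`. For `α = id` this
is an even derivation, for `α = σ` an odd one. -/
def IsDer (α F : A →ₗ[ℝ] A) : Prop := ∀ x y, F (x * y) = F x * y + α x * F y

variable (A) in
/-- The parity involution as a linear map. -/
abbrev sg : A →ₗ[ℝ] A := (SuperAlg.σ (A := A)).toLinearMap

theorem sg_one : sg A 1 = 1 := map_one (SuperAlg.σ (A := A))

theorem sg_mul (x y : A) : sg A (x * y) = sg A x * sg A y := map_mul (SuperAlg.σ (A := A)) x y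

theorem IsDer.map_one {F : A →ₗ[ℝ] A} {α : A →ₗ[ℝ] A} (hα : α 1 = 1) (h : IsDer α F) :
    F 1 = 0 := by
  have := h 1 1
  rw [hα, one_mul, one_mul, mul_one] at this
  exact left_eq_add.mp this

theorem IsDer.smap_left_even {F : A →ₗ[ℝ] A} (hF : IsDer LinearMap.id F)
    (hs : ∀ a, F (SuperAlg.σ a) = SuperAlg.σ (F a)) :
    IsDer LinearMap.id (smap F (LinearMap.id : B →ₗ[ℝ] B)) := by
  intro x y
  induction y using stensor_induction with
  | zero => simp
  | add y y' h h' => simp only [mul_add, map_add, h, h']; abel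
  | tm a' b' =>
    induction x using stensor_induction_parity with
    | zero => simp
    | add x x' h h' => simp only [add_mul, map_add, h, h']; abel
    | even a b hb =>
      simp only [tm_mul_of_even _ _ _ hb, smap_tm, LinearMap.id_apply, hF _ _, add_tm]
    | odd a b hb =>
      simp only [tm_mul_of_odd _ _ _ hb, smap_tm, LinearMap.id_apply, hF _ _, add_tm, hs]

/-- `F` acts on the leftmost factor, so no sign enters its definition. In a product, an odd `b` has
passed `a'` and left `σ a'`; moving `F` through that `σ` costs the sign by which `σ b` differs from
`b`. -/
theorem IsDer.smap_left_odd {F : A →ₗ[ℝ] A} (hF : IsDer (sg A) F)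
    (hs : ∀ a, F (SuperAlg.σ a) = -SuperAlg.σ (F a)) :
    IsDer (sg _) (smap F (LinearMap.id : B →ₗ[ℝ] B)) := by
  intro x y
  induction y using stensor_induction with
  | zero => simp
  | add y y' h h' => simp only [mul_add, map_add, h, h']; abel
  | tm a' b' =>
    induction x using stensor_induction_parity with
    | zero => simp
    | add x x' h h' => simp only [add_mul, map_add, h, h']; abel
    | even a b hb =>
      simp only [tm_mul_of_even _ _ _ hb, smap_tm, LinearMap.id_apply, hF _ _, add_tm,
        AlgHom.toLinearMap_apply, σ_tm, hb]
    | odd a b hb =>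
      simp only [tm_mul_of_odd _ _ _ hb, smap_tm, LinearMap.id_apply,
        hF _ _, add_tm, AlgHom.toLinearMap_apply, σ_tm, hb, hs, mul_neg, neg_mul, neg_tm, tm_neg]

theorem IsDer.smap_right_even {F : B →ₗ[ℝ] B} (hF : IsDer LinearMap.id F)
    (hs : ∀ b, F (SuperAlg.σ b) = SuperAlg.σ (F b)) :
    IsDer LinearMap.id (smap (LinearMap.id : A →ₗ[ℝ] A) F) := by
  intro x y
  induction y using stensor_induction with
  | zero => simp
  | add y y' h h' => simp only [mul_add, map_add, h, h']; abel
  | tm a' b' =>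
    induction x using stensor_induction_parity with
    | zero => simp
    | add x x' h h' => simp only [add_mul, map_add, h, h']; abel
    | even a b hb =>
      have hb' : SuperAlg.σ (F b) = F b := by rw [← hs, hb]
      simp only [tm_mul_of_even _ _ _ hb, tm_mul_of_even _ _ _ hb', smap_tm, LinearMap.id_apply,
        hF _ _, tm_add]
    | odd a b hb =>
      have hb' : SuperAlg.σ (F b) = -F b := by rw [← hs, hb, map_neg]
      simp only [tm_mul_of_odd _ _ _ hb, tm_mul_of_odd _ _ _ hb', smap_tm, LinearMap.id_apply,
        hF _ _, tm_add]

/-- The left tensorand is `σ` and not the identity because the odd `F` has to pass it. This is the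
shape in which the differential of `U(Dg)` enters the total differential. -/
theorem IsDer.smap_right_odd {F : B →ₗ[ℝ] B} (hF : IsDer (sg B) F)
    (hs : ∀ b, F (SuperAlg.σ b) = -SuperAlg.σ (F b)) :
    IsDer (sg _) (smap (sg A) F) := by
  intro x y
  induction y using stensor_induction with
  | zero => simp
  | add y y' h h' => simp only [mul_add, map_add, h, h']; abel
  | tm a' b' =>
    induction x using stensor_induction_parity with
    | zero => simp
    | add x x' h h' => simp only [add_mul, map_add, h, h']; abel
    | even a b hb =>
      have hb' : SuperAlg.σ (F b) = -F b := by rw [← neg_eq_iff_eq_neg, ← hs, hb]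
      simp only [tm_mul_of_even _ _ _ hb, tm_mul_of_odd _ _ _ hb', smap_tm, hF _ _, tm_add,
        AlgHom.toLinearMap_apply, σ_tm, hb, map_mul]
    | odd a b hb =>
      have hb' : SuperAlg.σ (F b) = F b := by
        rw [← neg_inj, ← hs, hb, map_neg]
      -- The parity involution of `a ⊗ b` has second factor `-b`, so the odd product rule is needed
      -- for `-b` as well.
      have hb2 : SuperAlg.σ (-b) = -(-b) := by rw [map_neg, hb]
      simp only [tm_mul_of_odd _ _ _ hb, tm_mul_of_even _ _ _ hb', tm_mul_of_odd _ _ _ hb2,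
        smap_tm, hF _ _, tm_add, AlgHom.toLinearMap_apply, σ_tm, hb, map_mul, SuperAlg.σ_σ]

theorem IsDer.add {α F F' : A →ₗ[ℝ] A} (h : IsDer α F) (h' : IsDer α F') : IsDer α (F + F') := by
  intro x y
  simp only [LinearMap.add_apply, h x y, h' x y, add_mul, mul_add]
  abel

/-! ### Coefficientwise maps of power series -/

theorem coeff_cmap (f : A →ₗ[ℝ] B) (φ : PowerSeries A) (n : ℕ) :
    PowerSeries.coeff n (cmap f φ) = f (PowerSeries.coeff n φ) :=
  PowerSeries.coeff_mk _ _

theorem cmap_add (f : A →ₗ[ℝ] B) (φ ψ : PowerSeries A) :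
    cmap f (φ + ψ) = cmap f φ + cmap f ψ := by
  ext n; simp [coeff_cmap]

theorem cmap_sub (f : A →ₗ[ℝ] B) (φ ψ : PowerSeries A) :
    cmap f (φ - ψ) = cmap f φ - cmap f ψ := by
  ext n; simp [coeff_cmap]

theorem cmap_neg (f : A →ₗ[ℝ] B) (φ : PowerSeries A) : cmap f (-φ) = -cmap f φ := by
  ext n; simp [coeff_cmap]

theorem cmap_one (f : A →ₗ[ℝ] B) (h : f 1 = 1) : cmap f (1 : PowerSeries A) = 1 := by
  ext n
  rw [coeff_cmap, PowerSeries.coeff_one, PowerSeries.coeff_one]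
  split_ifs <;> simp [h]

theorem cmap_cmap (f : A →ₗ[ℝ] B) (k : B →ₗ[ℝ] A') (φ : PowerSeries A) :
    cmap k (cmap f φ) = cmap (k ∘ₗ f) φ := by
  ext n; simp [coeff_cmap]

theorem cmap_mul (f : A →ₗ[ℝ] B) (h : ∀ x y, f (x * y) = f x * f y) (φ ψ : PowerSeries A) :
    cmap f (φ * ψ) = cmap f φ * cmap f ψ := by
  ext n; simp [coeff_cmap, PowerSeries.coeff_mul, h]

theorem cmap_der {α F : A →ₗ[ℝ] A} (h : IsDer α F) (φ ψ : PowerSeries A) :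
    cmap F (φ * ψ) = cmap F φ * ψ + cmap α φ * cmap F ψ := by
  ext n
  simp only [coeff_cmap, PowerSeries.coeff_mul, map_add, map_sum, h _ _, Finset.sum_add_distrib]

end superCalculus

section weil
variable {g : Type*} [LieRing g] [LieAlgebra ℝ g] {ι : Type*} [Fintype ι] (b : Module.Basis ι ℝ g)

/-! ### Generators and derivations of the Weil algebra -/

theorem wt_one_one : (wt 1 1 : Weil g ι) = 1 := rfl

theorem smul_wt (s s' : MvPolynomial ι ℝ) (l : ExteriorAlgebra ℝ (Module.Dual ℝ g)) :
    s • wt s' l = wt (s * s') l := by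
  change s • (s' ⊗ₜ[ℝ] l) = _
  rw [TensorProduct.smul_tmul']; rfl

theorem wt_eq_smul (s : MvPolynomial ι ℝ) (l : ExteriorAlgebra ℝ (Module.Dual ℝ g)) :
    wt s l = s • (extToWeil l : Weil g ι) := by
  change _ = s • wt 1 l
  rw [smul_wt, mul_one]

theorem tgen_mul (a : ι) (w : Weil g ι) :
    tgen a * w = (MvPolynomial.X a : MvPolynomial ι ℝ) • w := by
  have h : (tgen a : Weil g ι) = (MvPolynomial.X a : MvPolynomial ι ℝ) • 1 := by
    rw [← wt_one_one, smul_wt, mul_one]; rfl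
  rw [h, smul_mul_assoc, one_mul]

theorem thetaOf_mul_wt (ξ : Module.Dual ℝ g) (s : MvPolynomial ι ℝ)
    (l : ExteriorAlgebra ℝ (Module.Dual ℝ g)) :
    thetaOf ξ * wt s l = wt s (ExteriorAlgebra.ι ℝ ξ * l) := by
  change wt 1 _ * wt s l = _
  rw [wt_mul, one_mul]

theorem weil_tensor_induction {p : Weil g ι → Prop} (zero : p 0)
    (add : ∀ x y, p x → p y → p (x + y)) (wt : ∀ s l, p (wt s l)) (w : Weil g ι) : p w :=
  TensorProduct.induction_on (motive := p) w zero wt add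

theorem weil_induction {p : Weil g ι → Prop} (one : p 1)
    (add : ∀ x y, p x → p y → p (x + y)) (smul : ∀ (c : ℝ) x, p x → p (c • x))
    (tgen : ∀ a w, p w → p (tgen a * w)) (theta : ∀ ξ w, p w → p (thetaOf ξ * w))
    (w : Weil g ι) : p w := by
  have zero : p 0 := by simpa using smul 0 _ one
  refine weil_tensor_induction zero add (fun s l => ?_) w
  rw [wt_eq_smul]
  induction s using MvPolynomial.induction_on with
  | C r =>
    have : (MvPolynomial.C r : MvPolynomial ι ℝ) • (extToWeil l : Weil g ι) = r • extToWeil l := by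
      rw [← MvPolynomial.algebraMap_eq, algebraMap_smul]
    rw [this]
    clear this
    refine smul _ _ ?_
    induction l using CliffordAlgebra.left_induction with
    | algebraMap r =>
      rw [AlgHom.commutes, Algebra.algebraMap_eq_smul_one]
      exact smul _ _ one
    | add x y hx hy => rw [map_add]; exact add _ _ hx hy
    | ι_mul x m h => rw [map_mul]; exact theta _ _ h
  | add s s' h h' => rw [add_smul]; exact add _ _ h h'
  | mul_X s a h =>
    rw [mul_comm, mul_smul, ← tgen_mul]
    exact tgen _ _ h

theorem σ_wt (s : MvPolynomial ι ℝ) (l : ExteriorAlgebra ℝ (Module.Dual ℝ g)) :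
    SuperAlg.σ (wt s l : Weil g ι) = wt s (ExteriorAlgebra.map (-LinearMap.id) l) :=
  Algebra.TensorProduct.map_tmul _ _ s l

theorem σ_wt_one (s : MvPolynomial ι ℝ) : SuperAlg.σ (wt s 1 : Weil g ι) = wt s 1 := by
  rw [σ_wt, map_one]

theorem σ_tgen (a : ι) : SuperAlg.σ (tgen a : Weil g ι) = tgen a := σ_wt_one _

theorem σ_thetaOf (ξ : Module.Dual ℝ g) : SuperAlg.σ (thetaOf ξ : Weil g ι) = -thetaOf ξ := by
  change SuperAlg.σ (wt 1 _) = - wt 1 _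
  rw [σ_wt, ExteriorAlgebra.map_apply_ι]
  simp only [LinearMap.neg_apply, LinearMap.id_apply, map_neg]
  exact TensorProduct.tmul_neg _ _

theorem σ_smul (s : MvPolynomial ι ℝ) (w : Weil g ι) :
    SuperAlg.σ (s • w) = s • SuperAlg.σ w := by
  have : s • w = wt s 1 * w := by
    rw [wt_eq_smul, map_one, smul_mul_assoc, one_mul]
  rw [this, map_mul, σ_wt_one, wt_eq_smul, map_one, smul_mul_assoc, one_mul]

/-- Graded commutativity: an odd generator passes any element at the cost of its parity sign, which
needs checking only on left multiplication by generators. -/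
theorem thetaOf_mul (ξ : Module.Dual ℝ g) (w : Weil g ι) :
    thetaOf ξ * w = SuperAlg.σ w * thetaOf ξ := by
  induction w using weil_induction with
  | one => simp
  | add x y hx hy => rw [mul_add, hx, hy, map_add, add_mul]
  | smul c x hx => rw [mul_smul_comm, hx, map_smul, smul_mul_assoc]
  | tgen a w h =>
    rw [map_mul, σ_tgen, mul_assoc, ← h, ← mul_assoc, ← mul_assoc, (commute_tgen a _).eq]
  | theta η w h =>
    rw [map_mul, σ_thetaOf, neg_mul, neg_mul, mul_assoc, ← h, ← mul_assoc, ← mul_assoc,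
      thetaOf_anticomm, neg_mul]

/-- Since `Wg` is spanned by iterated left products of generators, the Leibniz rule with a generator
on the left propagates to all left factors by associativity. -/
theorem isDer_of_generators {α F : Weil g ι →ₗ[ℝ] Weil g ι} (hα : α 1 = 1)
    (hm : ∀ x y, α (x * y) = α x * α y) (h1 : F 1 = 0)
    (ht : ∀ a w, F (tgen a * w) = F (tgen a) * w + α (tgen a) * F w)
    (hθ : ∀ ξ w, F (thetaOf ξ * w) = F (thetaOf ξ) * w + α (thetaOf ξ) * F w) : IsDer α F := by
  intro x y
  induction x using weil_induction with
  | one => rw [h1, hα, one_mul, zero_mul, one_mul, zero_add]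
  | add x x' h h' => simp only [add_mul, map_add, h, h']; abel
  | smul c x h => simp only [smul_mul_assoc, map_smul, h, smul_add]
  | tgen a w h => rw [mul_assoc, ht, h, ht, hm, add_mul, mul_add]; simp only [mul_assoc, add_assoc]
  | theta a w h => rw [mul_assoc, hθ, h, hθ, hm, add_mul, mul_add]; simp only [mul_assoc, add_assoc]

theorem IsDer.eq_zero_of_generators {α F : Weil g ι →ₗ[ℝ] Weil g ι} (hα : α 1 = 1)
    (hF : IsDer α F) (ht : ∀ a, F (tgen a) = 0) (hθ : ∀ ξ, F (thetaOf ξ) = 0) : F = 0 := by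
  ext w
  rw [LinearMap.zero_apply]
  induction w using weil_induction with
  | one => exact hF.map_one hα
  | add x x' h h' => rw [map_add, h, h', add_zero]
  | smul c x h => rw [map_smul, h, smul_zero]
  | tgen a w h => rw [hF, h, ht, zero_mul, mul_zero, add_zero]
  | theta a w h => rw [hF, h, hθ, zero_mul, mul_zero, add_zero]

theorem IsDer.odd_of_generators {F : Weil g ι →ₗ[ℝ] Weil g ι} (hF : IsDer (sg _) F)
    (ht : ∀ a, SuperAlg.σ (F (tgen a)) = -F (tgen a))
    (hθ : ∀ ξ, SuperAlg.σ (F (thetaOf ξ)) = F (thetaOf ξ)) (w : Weil g ι) :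
    F (SuperAlg.σ w) = -SuperAlg.σ (F w) := by
  have h1 := hF.map_one sg_one
  induction w using weil_induction with
  | one => rw [_root_.map_one (SuperAlg.σ (A := Weil g ι)), h1, map_zero, neg_zero]
  | add x x' h h' => simp only [map_add, h, h', neg_add]
  | smul c x h => simp only [map_smul, h, smul_neg]
  | tgen a w h =>
    rw [map_mul, σ_tgen, hF, hF, h, map_add, map_mul, map_mul, ht, AlgHom.toLinearMap_apply, σ_tgen,
      σ_tgen]
    simp only [neg_mul, mul_neg, neg_add, neg_neg]
  | theta a w h =>
    rw [map_mul, σ_thetaOf, hF, hF, h, map_add, map_mul, map_mul, map_neg, hθ,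
      AlgHom.toLinearMap_apply, AlgHom.toLinearMap_apply, map_neg,
      σ_thetaOf, map_neg, σ_thetaOf]
    simp only [neg_mul, mul_neg, neg_add, neg_neg]

theorem IsDer.even_of_generators {F : Weil g ι →ₗ[ℝ] Weil g ι} (hF : IsDer LinearMap.id F)
    (ht : ∀ a, SuperAlg.σ (F (tgen a)) = F (tgen a))
    (hθ : ∀ ξ, SuperAlg.σ (F (thetaOf ξ)) = -F (thetaOf ξ)) (w : Weil g ι) :
    F (SuperAlg.σ w) = SuperAlg.σ (F w) := by
  have h1 := hF.map_one rfl
  induction w using weil_induction with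
  | one => rw [_root_.map_one (SuperAlg.σ (A := Weil g ι)), h1, map_zero]
  | add x x' h h' => simp only [map_add, h, h']
  | smul c x h => simp only [map_smul, h]
  | tgen a w h =>
    rw [map_mul, σ_tgen, hF, hF, h, map_add, map_mul, map_mul, ht]
    simp only [LinearMap.id_apply, σ_tgen]
  | theta a w h =>
    rw [map_mul, σ_thetaOf, hF, hF, h, map_add, map_mul, map_mul, map_neg, hθ]
    simp only [LinearMap.id_apply, map_neg, σ_thetaOf]

/-! ### The Weil differential -/

theorem weilD_wt (s : MvPolynomial ι ℝ) (l : ExteriorAlgebra ℝ (Module.Dual ℝ g)) :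
    weilD b (wt s l) = weilDS b s * extToWeil l + s • weilDExt b l 0 1 := rfl

/-- The Leibniz rule is the upper right entry of a product of triangular matrices. It uses only that
the lower right entry is the inclusion of `Λ g*` in `Wg`. -/
theorem weilDExt_ι_mul (ξ : Module.Dual ℝ g) (l : ExteriorAlgebra ℝ (Module.Dual ℝ g)) :
    weilDExt b (ExteriorAlgebra.ι ℝ ξ * l) 0 1 =
      -thetaOf ξ * weilDExt b l 0 1 + weilDTheta b ξ * extToWeil (ι := ι) l := by
  have h1 : ∀ l, weilDExt b l 1 0 = 0 ∧ weilDExt b l 1 1 = extToWeil (ι := ι) l := by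
    intro l
    induction l using CliffordAlgebra.left_induction with
    | algebraMap r => rw [AlgHom.commutes, AlgHom.commutes]; simp [Matrix.algebraMap_matrix_apply]
    | add x y hx hy => simp [hx.1, hx.2, hy.1, hy.2]
    | ι_mul m x h =>
      have h2 : weilDExt b (CliffordAlgebra.ι 0 x) =
          !![-thetaOf x, weilDTheta b x; 0, thetaOf x] := ExteriorAlgebra.lift_ι_apply ℝ _ _ _
      rw [map_mul, map_mul, h2, Matrix.mul_apply, Matrix.mul_apply]
      simp only [Fin.sum_univ_two, h.1, h.2]
      simp
      rfl
  have h2 : weilDExt b (ExteriorAlgebra.ι ℝ ξ) =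
      !![-thetaOf ξ, weilDTheta b ξ; 0, thetaOf ξ] := ExteriorAlgebra.lift_ι_apply ℝ _ _ _
  rw [map_mul, h2, Matrix.mul_apply]
  simp only [Fin.sum_univ_two, (h1 l).2]
  simp

theorem weilDExt_one : weilDExt b (1 : ExteriorAlgebra ℝ (Module.Dual ℝ g)) 0 1 = 0 := by
  rw [map_one]; simp

theorem weilD_wt_one (s : MvPolynomial ι ℝ) : weilD b (wt s (1 : ExteriorAlgebra ℝ (Module.Dual ℝ g))) = weilDS b s := by
  rw [weilD_wt, weilDExt_one, smul_zero, add_zero, map_one, mul_one]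

theorem weilD_tgen (a : ι) : weilD b (tgen a) =
    - ∑ c, ∑ c', strConst b c c' a • (theta b c * tgen c') := by
  rw [tgen, weilD_wt_one, weilDS, MvPolynomial.mkDerivation_X]

theorem weilD_thetaOf (ξ : Module.Dual ℝ g) : weilD b (thetaOf ξ) = weilDTheta b ξ := by
  have h : (thetaOf ξ : Weil g ι) = wt 1 (ExteriorAlgebra.ι ℝ ξ * 1) := by rw [mul_one]; rfl
  rw [h, weilD_wt, weilDExt_ι_mul, weilDExt_one]
  simp

theorem σ_derivation_eq_neg (D : Derivation ℝ (MvPolynomial ι ℝ) (Weil g ι))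
    (h : ∀ a, SuperAlg.σ (D (MvPolynomial.X a)) = -D (MvPolynomial.X a)) (s : MvPolynomial ι ℝ) :
    SuperAlg.σ (D s) = -D s := by
  induction s using MvPolynomial.induction_on with
  | C r => rw [MvPolynomial.derivation_C]; simp
  | add p q hp hq => rw [map_add, map_add, hp, hq, neg_add]
  | mul_X p a hp =>
    rw [Derivation.leibniz, map_add, σ_smul, σ_smul, hp, h]
    simp only [smul_neg, neg_add]

theorem σ_weilDS (s : MvPolynomial ι ℝ) : SuperAlg.σ (weilDS b s) = -weilDS b s := by
  refine σ_derivation_eq_neg _ (fun a => ?_) s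
  simp only [weilDS, MvPolynomial.mkDerivation_X, map_neg, map_sum, map_smul, map_mul, theta,
    σ_thetaOf, σ_tgen, neg_mul, smul_neg, Finset.sum_neg_distrib]

theorem weilD_isDer : IsDer (sg _) (weilD b) := by
  have h1 : weilD b 1 = 0 := by
    rw [← wt_one_one, weilD_wt_one, Derivation.map_one_eq_zero]
  refine isDer_of_generators sg_one sg_mul h1 (fun a w => ?_) (fun ξ w => ?_)
  · induction w using weil_tensor_induction with
    | zero => simp
    | add x y hx hy => simp only [mul_add, map_add, hx, hy]; abel
    | wt s l =>
      rw [tgen_mul, smul_wt, weilD_wt, AlgHom.toLinearMap_apply, σ_tgen, tgen_mul, weilD_wt,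
        tgen, weilD_wt_one, Derivation.leibniz, wt_eq_smul, mul_smul_comm, smul_add, add_mul,
        mul_smul, smul_mul_assoc, smul_mul_assoc]
      abel
  · induction w using weil_tensor_induction with
    | zero => simp
    | add x y hx hy => simp only [mul_add, map_add, hx, hy]; abel
    | wt s l =>
      -- Moving `θ` past the odd element `d s` produces the sign of the odd Leibniz rule.
      have h : weilDS b s * thetaOf ξ = -(thetaOf ξ * weilDS b s) := by
        rw [thetaOf_mul, σ_weilDS, neg_mul, neg_neg]
      rw [thetaOf_mul_wt, weilD_wt, weilD_wt, weilDExt_ι_mul, weilD_thetaOf,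
        AlgHom.toLinearMap_apply, σ_thetaOf, map_mul, wt_eq_smul, ← mul_assoc]
      rw [show extToWeil (ExteriorAlgebra.ι ℝ ξ) = (thetaOf ξ : Weil g ι) from rfl, h, mul_smul_comm,
        smul_add, mul_add, neg_mul, neg_mul, neg_mul, neg_mul, mul_smul_comm, smul_neg, mul_assoc]
      abel

theorem σ_weilDTheta (ξ : Module.Dual ℝ g) : SuperAlg.σ (weilDTheta b ξ) = weilDTheta b ξ := by
  simp only [weilDTheta, LinearMap.sub_apply, LinearMap.smul_apply, LinearMap.sum_apply,
    LinearMap.smulRight_apply, map_sub, map_smul, map_sum, σ_tgen, map_mul, theta, σ_thetaOf,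
    neg_mul, mul_neg, neg_neg]

theorem weilD_σ (w : Weil g ι) : weilD b (SuperAlg.σ w) = -SuperAlg.σ (weilD b w) := by
  refine (weilD_isDer b).odd_of_generators (fun a => ?_) (fun ξ => ?_) w
  · rw [tgen, weilD_wt_one, σ_weilDS]
  · rw [weilD_thetaOf, σ_weilDTheta]

/-! ### The homotopy and the Euler operator -/

/-- The derivation of `S g*` with `t^a ↦ θ^a`. -/
def weilKS : Derivation ℝ (MvPolynomial ι ℝ) (Weil g ι) :=
  MvPolynomial.mkDerivation ℝ (theta b)

/-- The odd derivation of `Wg` with `t^a ↦ θ^a` and `θ^a ↦ 0`. -/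
def weilK : Weil g ι →ₗ[ℝ] Weil g ι :=
  TensorProduct.lift (R := ℝ) (LinearMap.mk₂ ℝ (fun s l => weilKS b s * extToWeil l)
    (fun s s' l => by rw [map_add, add_mul])
    (fun c s l => by rw [Derivation.map_smul, smul_mul_assoc])
    (fun s l l' => by rw [map_add, mul_add])
    (fun c s l => by rw [map_smul, mul_smul_comm]))

theorem weilK_wt (s : MvPolynomial ι ℝ) (l : ExteriorAlgebra ℝ (Module.Dual ℝ g)) :
    weilK b (wt s l) = weilKS b s * extToWeil l := rfl

theorem σ_weilKS (s : MvPolynomial ι ℝ) : SuperAlg.σ (weilKS b s) = -weilKS b s := by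
  refine σ_derivation_eq_neg _ (fun a => ?_) s
  simp only [weilKS, MvPolynomial.mkDerivation_X, theta, σ_thetaOf]

theorem weilK_wt_one (s : MvPolynomial ι ℝ) :
    weilK b (wt s (1 : ExteriorAlgebra ℝ (Module.Dual ℝ g))) = weilKS b s := by
  rw [weilK_wt, map_one, mul_one]

theorem weilK_tgen (a : ι) : weilK b (tgen a) = theta b a := by
  rw [tgen, weilK_wt_one, weilKS, MvPolynomial.mkDerivation_X]

theorem weilK_thetaOf (ξ : Module.Dual ℝ g) : weilK b (thetaOf ξ) = (0 : Weil g ι) := by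
  change weilK b (wt 1 _) = 0
  rw [weilK_wt, Derivation.map_one_eq_zero, zero_mul]

theorem weilK_isDer : IsDer (sg _) (weilK b) := by
  have h1 : weilK b 1 = 0 := by
    rw [← wt_one_one, weilK_wt_one, Derivation.map_one_eq_zero]
  refine isDer_of_generators sg_one sg_mul h1 (fun a w => ?_) (fun ξ w => ?_)
  · induction w using weil_tensor_induction with
    | zero => simp
    | add x y hx hy => simp only [mul_add, map_add, hx, hy]; abel
    | wt s l =>
      rw [tgen_mul, smul_wt, weilK_wt, AlgHom.toLinearMap_apply, σ_tgen, tgen_mul, weilK_wt,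
        tgen, weilK_wt_one, Derivation.leibniz, wt_eq_smul, mul_smul_comm, add_mul,
        smul_mul_assoc, smul_mul_assoc]
      abel
  · induction w using weil_tensor_induction with
    | zero => simp
    | add x y hx hy => simp only [mul_add, map_add, hx, hy]; abel
    | wt s l =>
      have h : weilKS b s * thetaOf ξ = -(thetaOf ξ * weilKS b s) := by
        rw [thetaOf_mul, σ_weilKS, neg_mul, neg_neg]
      rw [thetaOf_mul_wt, weilK_wt, weilK_wt, weilK_thetaOf,
        AlgHom.toLinearMap_apply, σ_thetaOf, map_mul, ← mul_assoc]
      rw [show extToWeil (ExteriorAlgebra.ι ℝ ξ) = (thetaOf ξ : Weil g ι) from rfl, h, neg_mul,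
        neg_mul, zero_mul, zero_add, mul_assoc]

theorem weilK_σ (w : Weil g ι) : weilK b (SuperAlg.σ w) = -SuperAlg.σ (weilK b w) := by
  refine (weilK_isDer b).odd_of_generators (fun a => ?_) (fun ξ => ?_) w
  · rw [weilK_tgen, theta, σ_thetaOf]
  · rw [weilK_thetaOf, map_zero]

/-- The commutator of two odd derivations is an even derivation. -/
theorem IsDer.anticommutator {A : Type*} [Ring A] [Algebra ℝ A] [SuperAlg A] {F F' : A →ₗ[ℝ] A}
    (hF : IsDer (sg A) F) (hF' : IsDer (sg A) F') (hs : ∀ a, F (SuperAlg.σ a) = -SuperAlg.σ (F a))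
    (hs' : ∀ a, F' (SuperAlg.σ a) = -SuperAlg.σ (F' a)) :
    IsDer LinearMap.id (F ∘ₗ F' + F' ∘ₗ F) := by
  intro x y
  simp only [LinearMap.add_apply, LinearMap.comp_apply, hF x y, hF' x y, map_add, hF (F' x) y,
    hF' (F x) y, hF (SuperAlg.σ x), hF' (SuperAlg.σ x), AlgHom.toLinearMap_apply, hs, hs', SuperAlg.σ_σ,
    LinearMap.id_apply, add_mul, mul_add, neg_mul]
  abel

theorem IsDer.commutator_even {A : Type*} [Ring A] [Algebra ℝ A] [SuperAlg A] {F F' : A →ₗ[ℝ] A}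
    (hF : IsDer LinearMap.id F) (hF' : IsDer LinearMap.id F') :
    IsDer LinearMap.id (F ∘ₗ F' - F' ∘ₗ F) := by
  intro x y
  simp only [LinearMap.sub_apply, LinearMap.comp_apply, hF x y, hF' x y, map_add, hF (F' x) y,
    hF' (F x) y, LinearMap.id_apply, hF x _, hF' x _, sub_mul, mul_sub]
  abel

theorem IsDer.commutator_odd {A : Type*} [Ring A] [Algebra ℝ A] [SuperAlg A] {F F' : A →ₗ[ℝ] A}
    (hF : IsDer LinearMap.id F) (hF' : IsDer (sg A) F')
    (hs : ∀ a, F (SuperAlg.σ a) = SuperAlg.σ (F a)) :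
    IsDer (sg A) (F ∘ₗ F' - F' ∘ₗ F) := by
  intro x y
  simp only [LinearMap.sub_apply, LinearMap.comp_apply, hF x y, hF' x y, map_add, hF (F' x) y,
    hF' (F x) y, LinearMap.id_apply, hF (SuperAlg.σ x) _, hF' x _, sub_mul, mul_sub,
    AlgHom.toLinearMap_apply, hs]
  abel

/-- The Euler operator `d K + K d` of the Weil algebra. -/
def weilE : Weil g ι →ₗ[ℝ] Weil g ι := weilD b ∘ₗ weilK b + weilK b ∘ₗ weilD b

theorem weilE_isDer : IsDer LinearMap.id (weilE b) :=
  (weilD_isDer b).anticommutator (weilK_isDer b) (weilD_σ b) (weilK_σ b)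

theorem weilE_σ (w : Weil g ι) : weilE b (SuperAlg.σ w) = SuperAlg.σ (weilE b w) := by
  simp only [weilE, LinearMap.add_apply, LinearMap.comp_apply, weilK_σ, weilD_σ, map_neg, neg_neg,
    map_add]

theorem sum_smul_theta (ξ : Module.Dual ℝ g) :
    ∑ a, ξ (b a) • theta b a = (thetaOf ξ : Weil g ι) := by
  have h : ξ = ∑ a, ξ (b a) • b.coord a := by
    refine b.ext fun c => ?_
    simp
  conv_rhs => rw [h, map_sum]
  simp [theta]

theorem weilDTheta_apply (ξ : Module.Dual ℝ g) : weilDTheta b ξ =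
    ∑ a, ξ (b a) • (tgen a : Weil g ι) -
      (2⁻¹ : ℝ) • ∑ a, ∑ c, ξ ⁅b a, b c⁆ • (theta b a * theta b c) := by
  simp [weilDTheta, LinearMap.sum_apply]

theorem weilK_theta_mul_theta (a c : ι) : weilK b (theta b a * theta b c) = 0 := by
  rw [weilK_isDer b, theta, theta, weilK_thetaOf, weilK_thetaOf, zero_mul, mul_zero, add_zero]

/-- The part of `dξ` quadratic in `θ` is killed, and the linear part in `t` is sent back to `ξ`.
This is what makes the homotopy an inverse of `d` on the generators. -/
theorem weilK_weilDTheta (ξ : Module.Dual ℝ g) : weilK b (weilDTheta b ξ) = thetaOf ξ := by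
  rw [weilDTheta_apply]
  simp only [map_sub, map_sum, map_smul, weilK_tgen, weilK_theta_mul_theta, smul_zero,
    Finset.sum_const_zero, sub_zero, sum_smul_theta]

theorem weilE_thetaOf (ξ : Module.Dual ℝ g) : weilE b (thetaOf ξ) = (thetaOf ξ : Weil g ι) := by
  simp only [weilE, LinearMap.add_apply, LinearMap.comp_apply, weilK_thetaOf, map_zero, zero_add,
    weilD_thetaOf, weilK_weilDTheta]

/-- A cyclic rotation of three odd generators is an even permutation and fixes their product. Three
times the sum is therefore the sum with coefficients `F` cyclically symmetrized, which vanish. It is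
applied to the Jacobi identity. -/
theorem sum_cyclic_eq_zero (F : ι → ι → ι → ℝ) (hF : ∀ p q r, F p q r + F q r p + F r p q = 0) :
    ∑ p, ∑ q, ∑ r, F p q r • (theta b p * theta b q * theta b r : Weil g ι) = 0 := by
  have hc : ∀ p q r, (theta b p * theta b q * theta b r : Weil g ι) =
      theta b q * theta b r * theta b p := fun p q r => by
    rw [theta, theta, theta, mul_assoc, thetaOf_mul, map_mul, σ_thetaOf, σ_thetaOf, neg_mul_neg]
  have hr : ∀ H : ι → ι → ι → Weil g ι,
      ∑ p, ∑ q, ∑ r, H q r p = ∑ p, ∑ q, ∑ r, H p q r := fun H => by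
    rw [Finset.sum_comm]
    exact Finset.sum_congr rfl fun q _ => Finset.sum_comm
  set M : ι → ι → ι → Weil g ι := fun p q r => theta b p * theta b q * theta b r
  have h1 := hr fun p q r => F p q r • M p q r
  have h2 := hr fun p q r => F q r p • M p q r
  have h3 : (3 : ℝ) • ∑ p, ∑ q, ∑ r, F p q r • M p q r = 0 := by
    have h4 : ∑ p, ∑ q, ∑ r, (F p q r • M p q r + F q r p • M p q r + F r p q • M p q r) = 0 := by
      simp only [← add_smul, hF, zero_smul, Finset.sum_const_zero]
    simp only [Finset.sum_add_distrib] at h4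
    have e1 : ∀ p q r, M q r p = M p q r := fun p q r => (hc p q r).symm
    simp only [e1] at h1 h2
    rw [h2, h1] at h4
    rw [← h4]
    module
  exact (smul_eq_zero.mp h3).resolve_left three_ne_zero

theorem coad_apply (x : g) (ξ : Module.Dual ℝ g) (y : g) : coad x ξ y = -ξ ⁅x, y⁆ := by
  simp [coad]

/-- This is `d² = 0` on `θ`. The derivative of the quadratic part is `2 ∑ θ^c d(coad_c ξ)`;
expanding it once more gives terms `θ t`, which cancel the derivative of the `t`-part, and a cubic
term in `θ`, which vanishes by Jacobi. -/
theorem weilD_weilDTheta (ξ : Module.Dual ℝ g) : weilD b (weilDTheta b ξ) = 0 := by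
  have hst : ∀ (η : Module.Dual ℝ g) c c', ∑ a, (η (b a) * strConst b c c' a) = η ⁅b c, b c'⁆ :=
    fun η c c' => by
      conv_rhs => rw [← b.sum_repr ⁅b c, b c'⁆, map_sum]
      exact Finset.sum_congr rfl fun a _ => by rw [map_smul, smul_eq_mul, mul_comm]; rfl
  have hD : ∀ η : Module.Dual ℝ g, ∑ a, η (b a) • weilDTheta b (b.coord a) =
      (weilDTheta b η : Weil g ι) := fun η => by
    rw [← weilD_thetaOf, ← sum_smul_theta b η, map_sum]
    simp only [map_smul, theta, weilD_thetaOf]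
  have h1 : weilD b (∑ a, ξ (b a) • (tgen a : Weil g ι)) =
      - ∑ c, ∑ c', ξ ⁅b c, b c'⁆ • (theta b c * tgen c') := by
    simp only [map_sum, map_smul, weilD_tgen, smul_neg, Finset.sum_neg_distrib, Finset.smul_sum,
      smul_smul]
    rw [Finset.sum_comm, neg_inj]
    refine Finset.sum_congr rfl fun c _ => ?_
    rw [Finset.sum_comm]
    refine Finset.sum_congr rfl fun c' _ => ?_
    rw [← Finset.sum_smul, hst]
  have h2 : weilD b (∑ a, ∑ c, ξ ⁅b a, b c⁆ • (theta b a * theta b c)) =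
      (2 : ℝ) • ∑ c, theta b c * weilDTheta b (coad (b c) ξ) := by
    have e1 : ∀ c, ∑ a, ξ ⁅b a, b c⁆ • weilDTheta b (b.coord a) =
        (weilDTheta b (coad (b c) ξ) : Weil g ι) := fun c => by
      rw [← hD]
      refine Finset.sum_congr rfl fun a _ => ?_
      rw [coad_apply, ← map_neg, lie_skew]
    have e2 : ∀ a, ∑ c, -ξ ⁅b a, b c⁆ • weilDTheta b (b.coord c) =
        (weilDTheta b (coad (b a) ξ) : Weil g ι) := fun a => by
      rw [← hD]
      exact Finset.sum_congr rfl fun c _ => by rw [coad_apply]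
    have e3 : ∀ a c, weilD b (ξ ⁅b a, b c⁆ • (theta b a * theta b c)) =
        (ξ ⁅b a, b c⁆ • weilDTheta b (b.coord a)) * theta b c +
        theta b a * (-ξ ⁅b a, b c⁆ • weilDTheta b (b.coord c)) := fun a c => by
      rw [map_smul, weilD_isDer b, theta, theta, weilD_thetaOf, weilD_thetaOf,
        AlgHom.toLinearMap_apply, σ_thetaOf, smul_add, smul_mul_assoc, mul_smul_comm, neg_mul,
        smul_neg, neg_smul]
    simp only [map_sum, e3, Finset.sum_add_distrib, ← Finset.mul_sum, e2]
    rw [Finset.sum_comm]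
    simp only [← Finset.sum_mul, e1]
    rw [two_smul]
    congr 1
    exact Finset.sum_congr rfl fun c _ => (commute_weilDTheta b _ _).symm
  have h3 : ∑ c, theta b c * weilDTheta b (coad (b c) ξ) =
      - ∑ c, ∑ c', ξ ⁅b c, b c'⁆ • (theta b c * tgen c') := by
    have e : ∀ c, theta b c * weilDTheta b (coad (b c) ξ) =
        -∑ c', ξ ⁅b c, b c'⁆ • (theta b c * tgen c') +
        (2⁻¹ : ℝ) • ∑ p, ∑ q, ξ ⁅b c, ⁅b p, b q⁆⁆ • (theta b c * theta b p * theta b q) := fun c => by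
      simp only [weilDTheta_apply, coad_apply, neg_smul, Finset.sum_neg_distrib, smul_neg,
        sub_neg_eq_add, mul_assoc, mul_add, mul_neg, Finset.mul_sum, mul_smul_comm]
    simp only [e, Finset.sum_add_distrib, Finset.sum_neg_distrib, ← Finset.smul_sum]
    -- The cubic term in `θ`, whose coefficients are nested brackets.
    rw [sum_cyclic_eq_zero b fun p q r => ξ ⁅b p, ⁅b q, b r⁆⁆, smul_zero, add_zero]
    intro p q r
    rw [← map_add, ← map_add, lie_jacobi, map_zero]
  rw [weilDTheta_apply, map_sub, map_smul, h1, h2, h3, smul_smul, inv_mul_cancel₀ two_ne_zero,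
    one_smul, sub_self]

theorem weilE_weilDTheta (ξ : Module.Dual ℝ g) :
    weilE b (weilDTheta b ξ) = (weilDTheta b ξ : Weil g ι) := by
  simp only [weilE, LinearMap.add_apply, LinearMap.comp_apply, weilD_weilDTheta, map_zero, add_zero,
    weilK_weilDTheta, weilD_thetaOf]

/-- The change of generators from `t` to `dθ`, triangular modulo products of `θ`. In the generators
`θ`, `dθ` the Euler operator is diagonal, which it is not in `θ`, `t`. -/
theorem tgen_eq (a : ι) : (tgen a : Weil g ι) = weilDTheta b (b.coord a) +
    (2⁻¹ : ℝ) • ∑ p, ∑ q, b.coord a ⁅b p, b q⁆ • (theta b p * theta b q) := by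
  classical
  rw [weilDTheta_apply, sub_add_cancel, Finset.sum_eq_single a]
  · simp
  · intro c _ hc
    simp [hc]
  · simp

/-- A derivation that vanishes on the generators `θ` and `dθ` of `Wg` is zero. -/
theorem IsDer.eq_zero_of_theta {α F : Weil g ι →ₗ[ℝ] Weil g ι} (hα : α 1 = 1)
    (hF : IsDer α F) (ht : ∀ ξ, F (weilDTheta b ξ) = 0) (hθ : ∀ ξ, F (thetaOf ξ) = 0) : F = 0 := by
  refine hF.eq_zero_of_generators hα (fun a => ?_) hθ
  rw [tgen_eq b, map_add, ht, map_smul, zero_add]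
  simp only [map_sum, map_smul, hF _ _, theta, hθ, zero_mul, mul_zero, add_zero, smul_zero,
    Finset.sum_const_zero]

/-- `2 d²` is the anticommutator of `d` with itself, hence an even derivation, and it vanishes on
`θ` and `dθ`. -/
theorem weilD_weilD (w : Weil g ι) : weilD b (weilD b w) = 0 := by
  have h := ((weilD_isDer b).anticommutator (weilD_isDer b) (weilD_σ b)
    (weilD_σ b)).eq_zero_of_theta b rfl
    (fun ξ => by simp [weilD_weilDTheta]) (fun ξ => by simp [weilD_thetaOf, weilD_weilDTheta])
  have h' := LinearMap.congr_fun h w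
  rw [LinearMap.add_apply, LinearMap.comp_apply, LinearMap.zero_apply, ← two_smul ℝ] at h'
  exact (smul_eq_zero.mp h').resolve_left two_ne_zero

theorem weilE_weilD (w : Weil g ι) : weilE b (weilD b w) = weilD b (weilE b w) := by
  simp [weilE, weilD_weilD]

/-! ### The action of the Lie algebra on the Weil algebra -/

theorem weilLie_wt (x : g) (s : MvPolynomial ι ℝ) (l : ExteriorAlgebra ℝ (Module.Dual ℝ g)) :
    weilLie b x (wt s l) = wt (lieSym b x s) l + wt s (lieExt x l 0 1) := rfl

theorem lieExt_ι_mul (x : g) (ξ : Module.Dual ℝ g) (l : ExteriorAlgebra ℝ (Module.Dual ℝ g)) :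
    lieExt x (ExteriorAlgebra.ι ℝ ξ * l) 0 1 =
      ExteriorAlgebra.ι ℝ ξ * lieExt x l 0 1 + ExteriorAlgebra.ι ℝ (coad x ξ) * l := by
  have hι : ∀ ξ, lieExt x (ExteriorAlgebra.ι ℝ ξ) = !![ExteriorAlgebra.ι ℝ ξ,
      ExteriorAlgebra.ι ℝ (coad x ξ); 0, ExteriorAlgebra.ι ℝ ξ] :=
    fun ξ => ExteriorAlgebra.lift_ι_apply ℝ _ _ _
  have h1 : ∀ l, lieExt x l 1 0 = 0 ∧ lieExt x l 1 1 = l := by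
    intro l
    induction l using CliffordAlgebra.left_induction with
    | algebraMap r => rw [AlgHom.commutes]; simp [Matrix.algebraMap_matrix_apply]
    | add x y hx hy => simp [hx.1, hx.2, hy.1, hy.2]
    | ι_mul m x h =>
      have h2 := hι x
      change lieExt _ (CliffordAlgebra.ι 0 x) = _ at h2
      rw [map_mul, h2, Matrix.mul_apply, Matrix.mul_apply]
      simp only [Fin.sum_univ_two, h.1, h.2]
      simp
  rw [map_mul, hι, Matrix.mul_apply]
  simp only [Fin.sum_univ_two, (h1 l).2]
  simp

theorem wt_add_left (s s' : MvPolynomial ι ℝ) (l : ExteriorAlgebra ℝ (Module.Dual ℝ g)) :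
    wt (s + s') l = wt s l + wt s' l := TensorProduct.add_tmul s s' l

theorem wt_add_right (s : MvPolynomial ι ℝ) (l l' : ExteriorAlgebra ℝ (Module.Dual ℝ g)) :
    wt s (l + l') = wt s l + wt s l' := TensorProduct.tmul_add s l l'

theorem wt_zero_left (l : ExteriorAlgebra ℝ (Module.Dual ℝ g)) :
    wt (0 : MvPolynomial ι ℝ) l = 0 := TensorProduct.zero_tmul _ l

theorem wt_zero_right (s : MvPolynomial ι ℝ) : (wt s 0 : Weil g ι) = 0 :=
  TensorProduct.tmul_zero _ s

theorem weilLie_wt_one (x : g) (s : MvPolynomial ι ℝ) :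
    weilLie b x (wt s 1) = wt (lieSym b x s) 1 := by
  rw [weilLie_wt, map_one, Matrix.one_apply_ne (by decide), wt_zero_right, add_zero]

theorem weilLie_thetaOf (x : g) (ξ : Module.Dual ℝ g) :
    weilLie b x (thetaOf ξ) = thetaOf (coad x ξ) := by
  have h : (thetaOf ξ : Weil g ι) = wt 1 (ExteriorAlgebra.ι ℝ ξ * 1) := by rw [mul_one]; rfl
  rw [h, weilLie_wt, Derivation.map_one_eq_zero, wt_zero_left, zero_add, lieExt_ι_mul, map_one,
    Matrix.one_apply_ne (by decide), mul_zero, zero_add, mul_one]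
  rfl

theorem weilLie_isDer (x : g) : IsDer LinearMap.id (weilLie b x) := by
  have h1 : weilLie b x 1 = 0 := by
    rw [← wt_one_one, weilLie_wt_one, Derivation.map_one_eq_zero, wt_zero_left]
  refine isDer_of_generators rfl (fun _ _ => rfl) h1 (fun a w => ?_) (fun ξ w => ?_)
  · induction w using weil_tensor_induction with
    | zero => simp
    | add x y hx hy => simp only [mul_add, map_add, hx, hy]; abel
    | wt s l =>
      rw [tgen_mul, smul_wt, weilLie_wt, LinearMap.id_apply, tgen_mul, weilLie_wt,
        tgen, weilLie_wt_one, Derivation.leibniz, wt_mul, one_mul, wt_add_left, smul_add, smul_wt,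
        smul_wt, smul_eq_mul, smul_eq_mul, mul_comm s]
      abel
  · induction w using weil_tensor_induction with
    | zero => simp
    | add x y hx hy => simp only [mul_add, map_add, hx, hy]; abel
    | wt s l =>
      rw [thetaOf_mul_wt, weilLie_wt, weilLie_wt, lieExt_ι_mul, weilLie_thetaOf, LinearMap.id_apply,
        thetaOf_mul_wt, mul_add, thetaOf_mul_wt, thetaOf_mul_wt, wt_add_right]
      abel

theorem weilLie_tgen (x : g) (a : ι) :
    weilLie b x (tgen a) = ∑ c, coad x (b.coord a) (b c) • (tgen c : Weil g ι) := by
  rw [tgen, weilLie_wt_one, lieSym, MvPolynomial.mkDerivation_X, wt]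
  exact TensorProduct.sum_tmul _ _ _

theorem weilLie_σ (x : g) (w : Weil g ι) :
    weilLie b x (SuperAlg.σ w) = SuperAlg.σ (weilLie b x w) := by
  refine (weilLie_isDer b x).even_of_generators (fun a => ?_) (fun ξ => ?_) w
  · simp only [weilLie_tgen, map_sum, map_smul, σ_tgen]
  · rw [weilLie_thetaOf, σ_thetaOf]

theorem weilLie_weilK (x : g) (w : Weil g ι) :
    weilLie b x (weilK b w) = weilK b (weilLie b x w) := by
  have h := ((weilLie_isDer b x).commutator_odd (weilK_isDer b) (weilLie_σ b x)).eq_zero_of_generators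
    sg_one (fun a => ?_) (fun ξ => ?_)
  · exact sub_eq_zero.mp (LinearMap.congr_fun h w)
  · simp only [LinearMap.sub_apply, LinearMap.comp_apply, weilK_tgen, weilLie_tgen, map_sum,
      map_smul, sum_smul_theta]
    rw [theta, weilLie_thetaOf, sub_self]
  · simp only [LinearMap.sub_apply, LinearMap.comp_apply, weilK_thetaOf, weilLie_thetaOf, map_zero,
      sub_zero]

/-- Equivariance of the differential on `Λ¹ g*`. For the linear part it is the invariance of the
pairing of `g*` with `g`; for the quadratic part it is the Leibniz form of the Jacobi identity. -/
theorem weilLie_weilDTheta (x : g) (ξ : Module.Dual ℝ g) :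
    weilLie b x (weilDTheta b ξ) = (weilDTheta b (coad x ξ) : Weil g ι) := by
  have hco : ∀ η : Module.Dual ℝ g, ∀ c, ∑ a, η (b a) * coad x (b.coord a) (b c) =
      coad x η (b c) := fun η c => by
    conv_rhs => rw [coad_apply, ← b.sum_repr ⁅x, b c⁆, map_sum, ← Finset.sum_neg_distrib]
    refine Finset.sum_congr rfl fun a _ => ?_
    rw [map_smul, smul_eq_mul, coad_apply, mul_neg, mul_comm]
    rfl
  have h1 : weilLie b x (∑ a, ξ (b a) • (tgen a : Weil g ι)) = ∑ a, coad x ξ (b a) • tgen a := by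
    simp only [map_sum, map_smul, weilLie_tgen, Finset.smul_sum, smul_smul]
    rw [Finset.sum_comm]
    simp only [← Finset.sum_smul, hco]
  -- Both sides expand `coad_x η`, once by acting on the dual basis and once by acting on the
  -- coefficients. This moves the action from the generators into the brackets.
  have hθ : ∀ η : Module.Dual ℝ g, ∑ a, η (b a) • thetaOf (coad x (b.coord a)) =
      ∑ a, coad x η (b a) • (theta b a : Weil g ι) := fun η => by
    rw [sum_smul_theta, ← weilLie_thetaOf b, ← sum_smul_theta b η, map_sum]
    simp only [map_smul, theta, weilLie_thetaOf]
  have h2 : weilLie b x (∑ a, ∑ c, ξ ⁅b a, b c⁆ • (theta b a * theta b c : Weil g ι)) =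
      ∑ a, ∑ c, coad x ξ ⁅b a, b c⁆ • (theta b a * theta b c) := by
    have e1 : ∀ c, ∑ a, ξ ⁅b a, b c⁆ • (thetaOf (coad x (b.coord a)) : Weil g ι) =
        ∑ a, -ξ ⁅⁅x, b a⁆, b c⁆ • theta b a := fun c => by
      have := hθ (coad (b c) ξ)
      simp only [coad_apply] at this
      refine Eq.trans ?_ (this.trans ?_)
      · exact Finset.sum_congr rfl fun a _ => by rw [← lie_skew (b c) (b a), map_neg, neg_neg]
      · exact Finset.sum_congr rfl fun a _ => by
          rw [← lie_skew (b c) ⁅x, b a⁆, map_neg, neg_neg]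
    have e2 : ∀ a, ∑ c, ξ ⁅b a, b c⁆ • (thetaOf (coad x (b.coord c)) : Weil g ι) =
        ∑ c, -ξ ⁅b a, ⁅x, b c⁆⁆ • theta b c := fun a => by
      have := hθ (coad (b a) ξ)
      simp only [coad_apply] at this
      rw [← neg_inj, ← Finset.sum_neg_distrib, ← Finset.sum_neg_distrib]
      simpa only [← neg_smul, neg_neg] using this
    have e3 : ∀ a c, weilLie b x (ξ ⁅b a, b c⁆ • (theta b a * theta b c)) =
        (ξ ⁅b a, b c⁆ • thetaOf (coad x (b.coord a)) : Weil g ι) * theta b c +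
        theta b a * (ξ ⁅b a, b c⁆ • thetaOf (coad x (b.coord c))) := fun a c => by
      rw [map_smul, weilLie_isDer b, theta, theta, weilLie_thetaOf, weilLie_thetaOf,
        LinearMap.id_apply, smul_add, smul_mul_assoc, mul_smul_comm]
    simp only [map_sum, e3, Finset.sum_add_distrib, ← Finset.mul_sum, e2]
    rw [Finset.sum_comm]
    simp only [← Finset.sum_mul, e1]
    simp only [Finset.sum_mul]
    rw [Finset.sum_comm]
    simp only [Finset.mul_sum, mul_smul_comm, smul_mul_assoc, ← Finset.sum_add_distrib, ← add_smul]
    refine Finset.sum_congr rfl fun a _ => Finset.sum_congr rfl fun c _ => ?_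
    rw [coad_apply, leibniz_lie x (b a), map_add, neg_add]
  rw [weilDTheta_apply, map_sub, map_smul, h1, h2, ← weilDTheta_apply]

/-- The commutator is an even derivation, and on `θ` and `dθ` the Euler operator is the identity
while the action preserves their span. -/
theorem weilE_weilLie (x : g) (w : Weil g ι) :
    weilE b (weilLie b x w) = weilLie b x (weilE b w) := by
  have h := ((weilE_isDer b).commutator_even (weilLie_isDer b x)).eq_zero_of_theta b
    rfl (fun ξ => ?_) (fun ξ => ?_)
  · exact sub_eq_zero.mp (LinearMap.congr_fun h w)
  · simp only [LinearMap.sub_apply, LinearMap.comp_apply, weilLie_weilDTheta, weilE_weilDTheta,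
      sub_self]
  · simp only [LinearMap.sub_apply, LinearMap.comp_apply, weilLie_thetaOf, weilE_thetaOf, sub_self]

end weil

/-! ### Diagonalization of the Euler operator -/

/-- An operator that is diagonalizable with natural eigenvalues has a pseudo-inverse. -/
theorem exists_pseudoinverse {V : Type*} [AddCommGroup V] [Module ℝ V] (E : Module.End ℝ V)
    (h : ⨆ m : ℕ, E.eigenspace (m : ℝ) = ⊤) :
    ∃ G : V →ₗ[ℝ] V, ∀ (m : ℕ) v, E v = (m : ℝ) • v → G v = (m : ℝ)⁻¹ • v := by
  have hind : iSupIndep fun m : ℕ => E.eigenspace (m : ℝ) :=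
    (Module.End.eigenspaces_iSupIndep E).comp Nat.cast_injective
  have hint := DirectSum.isInternal_submodule_of_iSupIndep_of_iSup_eq_top hind h
  let e := LinearEquiv.ofBijective
    (DirectSum.coeLinearMap fun m : ℕ => E.eigenspace (m : ℝ)) hint
  -- On the eigenspace of `0` the factor is `0⁻¹ = 0`, so the pseudo-inverse kills the kernel.
  refine ⟨DirectSum.toModule ℝ ℕ V (fun m => (m : ℝ)⁻¹ • (E.eigenspace (m : ℝ)).subtype) ∘ₗ
    e.symm.toLinearMap, fun m v hv => ?_⟩
  have hmem : v ∈ E.eigenspace (m : ℝ) := Module.End.mem_eigenspace_iff.mpr hv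
  have he : e.symm v = DirectSum.lof ℝ ℕ (fun m : ℕ => E.eigenspace (m : ℝ)) m ⟨v, hmem⟩ := by
    rw [LinearEquiv.symm_apply_eq]
    exact (DirectSum.coeLinearMap_lof (fun m : ℕ => E.eigenspace (m : ℝ)) m ⟨v, hmem⟩).symm
  rw [LinearMap.comp_apply, LinearEquiv.coe_coe, he, DirectSum.toModule_lof]
  rfl

section weil
variable {g : Type*} [LieRing g] [LieAlgebra ℝ g] {ι : Type*} [Fintype ι] (b : Module.Basis ι ℝ g)

/-- `IsWord b m n w`: `w` is a product of `m` generators `θ^a`, `d θ^a`, of total degree `n`. -/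
inductive IsWord : ℕ → ℕ → Weil g ι → Prop
  | one : IsWord 0 0 1
  | theta (m n : ℕ) (w : Weil g ι) (a : ι) : IsWord m n w → IsWord (m + 1) (n + 1) (theta b a * w)
  | dtheta (m n : ℕ) (w : Weil g ι) (a : ι) : IsWord m n w →
      IsWord (m + 1) (n + 2) (weilDTheta b (b.coord a) * w)

theorem IsWord.weilE {m n : ℕ} {w : Weil g ι} (h : IsWord b m n w) :
    weilE b w = (m : ℝ) • w := by
  induction h with
  | one => rw [(weilE_isDer b).map_one rfl, Nat.cast_zero, zero_smul]
  | theta m n w a _ h =>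
    rw [weilE_isDer b, DgTwist.theta, weilE_thetaOf, h, LinearMap.id_apply, Nat.cast_add,
      Nat.cast_one, add_smul, one_smul, mul_smul_comm, add_comm]
  | dtheta m n w a _ h =>
    rw [weilE_isDer b, weilE_weilDTheta, h, LinearMap.id_apply, Nat.cast_add,
      Nat.cast_one, add_smul, one_smul, mul_smul_comm, add_comm]

/-- The span of the words of degree `n`. -/
def wordSpan (n : ℕ) : Submodule ℝ (Weil g ι) := Submodule.span ℝ {w | ∃ m, IsWord b m n w}

theorem thetaOf_mul_mem_wordSpan (ξ : Module.Dual ℝ g) {n : ℕ} {w : Weil g ι}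
    (hw : w ∈ wordSpan b n) : thetaOf ξ * w ∈ wordSpan b (n + 1) := by
  have h : wordSpan b n ≤ (wordSpan b (n + 1)).comap (LinearMap.mulLeft ℝ (thetaOf ξ)) := by
    refine Submodule.span_le.mpr ?_
    rintro w ⟨m, hw⟩
    rw [SetLike.mem_coe, Submodule.mem_comap, LinearMap.mulLeft_apply, ← sum_smul_theta b,
      Finset.sum_mul]
    refine Submodule.sum_mem _ fun a _ => ?_
    rw [smul_mul_assoc]
    exact Submodule.smul_mem _ _ (Submodule.subset_span ⟨_, hw.theta _ _ _ a⟩)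
  exact h hw

/-- Replacing `t` by `dθ` and a quadratic term in `θ` is homogeneous: both have degree two, although
their word lengths differ. -/
theorem tgen_mul_mem_wordSpan (a : ι) {n : ℕ} {w : Weil g ι}
    (hw : w ∈ wordSpan b n) : tgen a * w ∈ wordSpan b (n + 2) := by
  have h : wordSpan b n ≤ (wordSpan b (n + 2)).comap
      (LinearMap.mulLeft ℝ (weilDTheta b (b.coord a))) := by
    refine Submodule.span_le.mpr ?_
    rintro w ⟨m, hw⟩
    exact Submodule.subset_span ⟨_, hw.dtheta _ _ _ a⟩
  rw [tgen_eq b, add_mul, smul_mul_assoc, Finset.sum_mul]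
  refine Submodule.add_mem _ (h hw) (Submodule.smul_mem _ _ (Submodule.sum_mem _ fun p _ => ?_))
  rw [Finset.sum_mul]
  refine Submodule.sum_mem _ fun q _ => ?_
  rw [smul_mul_assoc, mul_assoc]
  exact Submodule.smul_mem _ _ (thetaOf_mul_mem_wordSpan b _ (thetaOf_mul_mem_wordSpan b _ hw))

theorem one_mem_wordSpan : 1 ∈ wordSpan b 0 := Submodule.subset_span ⟨0, .one⟩

theorem extToWeil_mem_wordSpan {j : ℕ} {l : ExteriorAlgebra ℝ (Module.Dual ℝ g)}
    (hl : l ∈ ⋀[ℝ]^j (Module.Dual ℝ g)) : extToWeil l ∈ wordSpan b j := by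
  induction hl using Submodule.pow_induction_on_left' with
  | algebraMap r =>
    rw [AlgHom.commutes, Algebra.algebraMap_eq_smul_one]
    exact Submodule.smul_mem _ _ (one_mem_wordSpan b)
  | add x y i _ _ hx hy => rw [map_add]; exact Submodule.add_mem _ hx hy
  | mem_mul m hm i x _ h =>
    obtain ⟨ξ, rfl⟩ := hm
    rw [map_mul]
    exact thetaOf_mul_mem_wordSpan b ξ h

theorem monomial_smul_mem_wordSpan (i : ℕ) : ∀ (α : ι →₀ ℕ), α.degree = i → ∀ (j : ℕ)
    (w : Weil g ι), w ∈ wordSpan b j →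
    (MvPolynomial.monomial α (1 : ℝ)) • w ∈ wordSpan b (2 * i + j) := by
  induction i with
  | zero =>
    intro α hα j w hw
    rw [Finsupp.degree_eq_zero_iff] at hα
    subst hα
    rw [MvPolynomial.monomial_zero', MvPolynomial.C_1, one_smul, mul_zero, zero_add]
    exact hw
  | succ i ih =>
    intro α hα j w hw
    obtain ⟨a, ha⟩ : ∃ a, α a ≠ 0 := by
      by_contra! h
      have : α = 0 := Finsupp.ext h
      simp [this] at hα
    have hle : Finsupp.single a 1 ≤ α := by
      rw [Finsupp.single_le_iff]
      exact Nat.one_le_iff_ne_zero.mpr ha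
    have e := tsub_add_cancel_of_le hle
    have hdeg : (α - Finsupp.single a 1).degree = i := by
      have h := congrArg Finsupp.degree e
      rw [map_add, hα] at h
      simpa using h
    have hm : MvPolynomial.monomial α (1 : ℝ) =
        MvPolynomial.X a * MvPolynomial.monomial (α - Finsupp.single a 1) 1 := by
      rw [MvPolynomial.X, MvPolynomial.monomial_mul, one_mul, add_comm, e]
    rw [hm, mul_smul, ← tgen_mul, show 2 * (i + 1) + j = 2 * i + j + 2 by ring]
    exact tgen_mul_mem_wordSpan b a (ih _ hdeg j w hw)

theorem wt_mem_wordSpan {i j : ℕ} {s : MvPolynomial ι ℝ} (hs : s.IsHomogeneous i)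
    {l : ExteriorAlgebra ℝ (Module.Dual ℝ g)} (hl : l ∈ ⋀[ℝ]^j (Module.Dual ℝ g)) :
    wt s l ∈ wordSpan b (2 * i + j) := by
  rw [wt_eq_smul, s.as_sum, Finset.sum_smul]
  refine Submodule.sum_mem _ fun α hα => ?_
  have h1 : MvPolynomial.monomial α (s.coeff α) = s.coeff α • MvPolynomial.monomial α (1 : ℝ) := by
    rw [MvPolynomial.smul_monomial, smul_eq_mul, mul_one]
  have h2 : α.degree = i := by
    by_contra h
    exact (MvPolynomial.mem_support_iff.mp hα) (hs.coeff_eq_zero h)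
  rw [h1, smul_assoc]
  exact Submodule.smul_mem _ _ (monomial_smul_mem_wordSpan b i α h2 j _ (extToWeil_mem_wordSpan b hl))

theorem weilDeg_le_wordSpan (n : ℕ) : weilDeg g ι n ≤ wordSpan b n := by
  refine Submodule.span_le.mpr ?_
  rintro w ⟨i, j, rfl, s, hs, l, hl, rfl⟩
  exact wt_mem_wordSpan b hs hl

/-! ### The grading of the Weil algebra by degree. -/

theorem mul_mem_weilDeg {m n : ℕ} {v w : Weil g ι} (hv : v ∈ weilDeg g ι m)
    (hw : w ∈ weilDeg g ι n) : v * w ∈ weilDeg g ι (m + n) := by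
  have h : weilDeg g ι m * weilDeg g ι n ≤ weilDeg g ι (m + n) := by
    rw [weilDeg, weilDeg, Submodule.span_mul_span]
    refine Submodule.span_le.mpr ?_
    rintro _ ⟨_, ⟨i, j, rfl, s, hs, l, hl, rfl⟩, _, ⟨i', j', rfl, s', hs', l', hl', rfl⟩, rfl⟩
    refine Submodule.subset_span ⟨i + i', j + j', by ring, s * s', hs.mul hs', l * l', ?_,
      wt_mul _ _ _ _⟩
    rw [ExteriorAlgebra.exteriorPower, pow_add]
    exact Submodule.mul_mem_mul hl hl'
  exact h (Submodule.mul_mem_mul hv hw)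

theorem one_mem_weilDeg : (1 : Weil g ι) ∈ weilDeg g ι 0 :=
  Submodule.subset_span ⟨0, 0, rfl, 1, MvPolynomial.isHomogeneous_one _ _, 1,
    by rw [ExteriorAlgebra.exteriorPower, pow_zero]; exact Submodule.one_le.mp le_rfl, rfl⟩

theorem thetaOf_mem_weilDeg (ξ : Module.Dual ℝ g) : (thetaOf ξ : Weil g ι) ∈ weilDeg g ι 1 :=
  Submodule.subset_span ⟨0, 1, rfl, 1, MvPolynomial.isHomogeneous_one _ _, ExteriorAlgebra.ι ℝ ξ,
    by rw [ExteriorAlgebra.exteriorPower, pow_one]; exact ⟨ξ, rfl⟩, rfl⟩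

theorem wt_one_mem_weilDeg {s : MvPolynomial ι ℝ} {i : ℕ} (hs : s.IsHomogeneous i) :
    (wt s 1 : Weil g ι) ∈ weilDeg g ι (2 * i) :=
  Submodule.subset_span ⟨i, 0, rfl, s, hs, 1,
    by rw [ExteriorAlgebra.exteriorPower, pow_zero]; exact Submodule.one_le.mp le_rfl, rfl⟩

theorem weilDTheta_mem_weilDeg (ξ : Module.Dual ℝ g) : weilDTheta b ξ ∈ weilDeg g ι 2 := by
  rw [weilDTheta_apply]
  refine Submodule.sub_mem _ (Submodule.sum_mem _ fun a _ => Submodule.smul_mem _ _ ?_)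
    (Submodule.smul_mem _ _ (Submodule.sum_mem _ fun a _ => Submodule.sum_mem _ fun c _ =>
      Submodule.smul_mem _ _ ?_))
  · have h := wt_one_mem_weilDeg (g := g) (MvPolynomial.isHomogeneous_X ℝ a)
    rw [mul_one] at h
    exact h
  · have h := mul_mem_weilDeg (thetaOf_mem_weilDeg (ι := ι) (b.coord a))
      (thetaOf_mem_weilDeg (b.coord c))
    exact h

theorem IsWord.mem_weilDeg {m n : ℕ} {w : Weil g ι} (h : IsWord b m n w) :
    w ∈ weilDeg g ι n := by
  induction h with
  | one => exact one_mem_weilDeg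
  | theta m n w a _ h => rw [add_comm n]; exact mul_mem_weilDeg (thetaOf_mem_weilDeg _) h
  | dtheta m n w a _ h => rw [add_comm n]; exact mul_mem_weilDeg (weilDTheta_mem_weilDeg b _) h

/-- The degree of `Wg` can be read off in either set of generators. Since words are eigenvectors of
the Euler operator, its inverse is compatible with the degree. -/
theorem wordSpan_eq_weilDeg (n : ℕ) : wordSpan b n = weilDeg g ι n := by
  refine le_antisymm (Submodule.span_le.mpr ?_) (weilDeg_le_wordSpan b n)
  rintro w ⟨m, hw⟩
  exact hw.mem_weilDeg

/-- A property of the elements of `Wg` which is linear may be checked on words. -/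
theorem word_induction {p : Weil g ι → Prop} (add : ∀ x y, p x → p y → p (x + y))
    (smul : ∀ (c : ℝ) x, p x → p (c • x)) (word : ∀ m n w, IsWord b m n w → p w)
    (w : Weil g ι) : p w := by
  have zero : p 0 := by simpa using smul 0 _ (word _ _ _ .one)
  suffices h : w ∈ Submodule.span ℝ {w | ∃ m n, IsWord b m n w} by
    induction h using Submodule.span_induction with
    | mem x hx => obtain ⟨m, n, hx⟩ := hx; exact word m n x hx
    | zero => exact zero
    | add x y _ _ hx hy => exact add x y hx hy
    | smul c x _ hx => exact smul c x hx
  have hn : ∀ n, wordSpan b n ≤ Submodule.span ℝ {w | ∃ m n, IsWord b m n w} := fun n =>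
    Submodule.span_mono fun w ⟨m, hw⟩ => ⟨m, n, hw⟩
  have key : w ∈ ⨆ n, wordSpan b n := by
    induction w using weil_induction with
    | one => exact Submodule.mem_iSup_of_mem 0 (one_mem_wordSpan b)
    | add x y hx hy => exact Submodule.add_mem _ hx hy
    | smul c x hx => exact Submodule.smul_mem _ _ hx
    | tgen a w h =>
      induction h using Submodule.iSup_induction' with
      | mem i x hx => exact Submodule.mem_iSup_of_mem _ (tgen_mul_mem_wordSpan b a hx)
      | zero => rw [mul_zero]; exact Submodule.zero_mem _
      | add x y _ _ hx hy => rw [mul_add]; exact Submodule.add_mem _ hx hy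
    | theta a w h =>
      induction h using Submodule.iSup_induction' with
      | mem i x hx => exact Submodule.mem_iSup_of_mem _ (thetaOf_mul_mem_wordSpan b a hx)
      | zero => rw [mul_zero]; exact Submodule.zero_mem _
      | add x y _ _ hx hy => rw [mul_add]; exact Submodule.add_mem _ hx hy
  exact iSup_le hn key

/-- Words in `θ` and `dθ` span `Wg`, and a word is an eigenvector whose eigenvalue is its length. No
linear independence of words is needed. -/
theorem exists_weilE_pseudoinverse : ∃ G : Weil g ι →ₗ[ℝ] Weil g ι,
    ∀ (m : ℕ) v, weilE b v = (m : ℝ) • v → G v = (m : ℝ)⁻¹ • v := by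
  refine exists_pseudoinverse (weilE b) ?_
  rw [eq_top_iff]
  rintro w -
  induction w using word_induction b with
  | add x y hx hy => exact Submodule.add_mem _ hx hy
  | smul c x hx => exact Submodule.smul_mem _ _ hx
  | word m n w hw =>
    exact Submodule.mem_iSup_of_mem m (Module.End.mem_eigenspace_iff.mpr hw.weilE)

/-- The inverse of the Euler operator on the augmentation ideal of `Wg`. -/
def weilG : Weil g ι →ₗ[ℝ] Weil g ι := (exists_weilE_pseudoinverse b).choose

theorem IsWord.weilG {m n : ℕ} {w : Weil g ι} (h : IsWord b m n w) :
    weilG b w = (m : ℝ)⁻¹ • w :=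
  (exists_weilE_pseudoinverse b).choose_spec m w h.weilE

theorem weilG_mem_weilDeg {n : ℕ} {w : Weil g ι} (hw : w ∈ weilDeg g ι n) :
    weilG b w ∈ weilDeg g ι n := by
  rw [← wordSpan_eq_weilDeg b] at *
  have h : wordSpan b n ≤ (wordSpan b n).comap (weilG b) := by
    refine Submodule.span_le.mpr ?_
    rintro w ⟨m, hw⟩
    rw [SetLike.mem_coe, Submodule.mem_comap, hw.weilG]
    exact Submodule.smul_mem _ _ (Submodule.subset_span ⟨m, hw⟩)
  exact h hw

/-! ### The augmentation and the inverse of the Euler operator. -/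

variable (g ι) in
/-- The augmentation `Wg → ℝ`, as an endomorphism of the algebra `Wg`. -/
def weilP : Weil g ι →ₐ[ℝ] Weil g ι :=
  (Algebra.ofId ℝ (Weil g ι)).comp
    (Algebra.TensorProduct.lift (MvPolynomial.aeval fun _ => 0) ExteriorAlgebra.algebraMapInv
      (fun _ _ => mul_comm _ _) :
      MvPolynomial ι ℝ ⊗[ℝ] ExteriorAlgebra ℝ (Module.Dual ℝ g) →ₐ[ℝ] ℝ)

theorem weilP_wt (s : MvPolynomial ι ℝ) (l : ExteriorAlgebra ℝ (Module.Dual ℝ g)) :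
    weilP g ι (wt s l) = algebraMap ℝ _ (MvPolynomial.aeval (fun _ => (0 : ℝ)) s *
      ExteriorAlgebra.algebraMapInv l) := rfl

theorem weilP_tgen (a : ι) : weilP g ι (tgen a) = 0 := by
  rw [tgen, weilP_wt, MvPolynomial.aeval_X, zero_mul, map_zero]

theorem weilP_thetaOf (ξ : Module.Dual ℝ g) : weilP g ι (thetaOf ξ) = 0 := by
  change weilP g ι (wt 1 _) = 0
  rw [weilP_wt]
  simp [ExteriorAlgebra.algebraMapInv]

theorem weilP_weilDTheta (ξ : Module.Dual ℝ g) : weilP g ι (weilDTheta b ξ) = 0 := by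
  simp [weilDTheta_apply, weilP_tgen, theta, weilP_thetaOf]

theorem weilP_σ (w : Weil g ι) : weilP g ι (SuperAlg.σ w) = SuperAlg.σ (weilP g ι w) := by
  induction w using weil_induction with
  | one => simp
  | add x y hx hy => simp only [map_add, hx, hy]
  | smul c x hx => simp only [map_smul, hx]
  | tgen a w h => rw [map_mul, map_mul, σ_tgen, weilP_tgen, map_mul, weilP_tgen]; simp
  | theta a w h => rw [map_mul, map_mul, σ_thetaOf, map_neg, map_mul, weilP_thetaOf]; simp

theorem IsWord.weilP {m n : ℕ} {w : Weil g ι} (h : IsWord b m n w) (hm : m ≠ 0) :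
    weilP g ι w = 0 := by
  cases h with
  | one => exact absurd rfl hm
  | theta m n w a h => rw [map_mul, DgTwist.theta, weilP_thetaOf, zero_mul]
  | dtheta m n w a h => rw [map_mul, weilP_weilDTheta, zero_mul]

theorem IsWord.eq_one {n : ℕ} {w : Weil g ι} (h : IsWord b 0 n w) : w = 1 := by
  cases h; rfl

/-- On a word of positive length the two eigenvalue factors cancel and the augmentation vanishes.
The only word of length zero is `1`, where both sides are zero. -/
theorem weilE_weilG (w : Weil g ι) : weilE b (weilG b w) = w - weilP g ι w := by
  induction w using word_induction b with
  | add x y hx hy => simp only [map_add, hx, hy]; abel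
  | smul c x hx => simp only [map_smul, hx, smul_sub]
  | word m n w hw =>
    rw [hw.weilG, map_smul, hw.weilE]
    by_cases hm : m = 0
    · subst hm
      simp [hw.eq_one]
    · rw [smul_smul, inv_mul_cancel₀ (Nat.cast_ne_zero.mpr hm), one_smul, hw.weilP b hm, sub_zero]

theorem weilG_weilE (w : Weil g ι) : weilG b (weilE b w) = w - weilP g ι w := by
  induction w using word_induction b with
  | add x y hx hy => simp only [map_add, hx, hy]; abel
  | smul c x hx => simp only [map_smul, hx, smul_sub]
  | word m n w hw =>
    rw [hw.weilE, map_smul, hw.weilG]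
    by_cases hm : m = 0
    · subst hm
      simp [hw.eq_one]
    · rw [smul_smul, mul_inv_cancel₀ (Nat.cast_ne_zero.mpr hm), one_smul, hw.weilP b hm, sub_zero]

theorem weilP_weilE (w : Weil g ι) : weilP g ι (weilE b w) = 0 := by
  induction w using word_induction b with
  | add x y hx hy => simp only [map_add, hx, hy, add_zero]
  | smul c x hx => simp only [map_smul, hx, smul_zero]
  | word m n w hw =>
    rw [hw.weilE, map_smul]
    by_cases hm : m = 0
    · rw [hm, Nat.cast_zero, zero_smul]
    · rw [hw.weilP b hm, smul_zero]

theorem weilP_weilG (w : Weil g ι) : weilP g ι (weilG b w) = 0 := by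
  induction w using word_induction b with
  | add x y hx hy => simp only [map_add, hx, hy, add_zero]
  | smul c x hx => simp only [map_smul, hx, smul_zero]
  | word m n w hw =>
    rw [hw.weilG, map_smul]
    by_cases hm : m = 0
    · rw [hm, Nat.cast_zero, inv_zero, zero_smul]
    · rw [hw.weilP b hm, smul_zero]

/-- An operator that commutes with the Euler operator and kills `1` has values in the augmentation
ideal. -/
theorem weilP_of_commute {F : Weil g ι →ₗ[ℝ] Weil g ι} (h1 : F 1 = 0)
    (h : ∀ w, weilE b (F w) = F (weilE b w)) (w : Weil g ι) : weilP g ι (F w) = 0 := by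
  induction w using word_induction b with
  | add x y hx hy => simp only [map_add, hx, hy, add_zero]
  | smul c x hx => simp only [map_smul, hx, smul_zero]
  | word m n w hw =>
    by_cases hm : m = 0
    · subst hm
      rw [hw.eq_one, h1, map_zero]
    · have h2 := h w
      rw [hw.weilE, map_smul] at h2
      have h3 := weilP_weilE b (F w)
      rw [h2, map_smul] at h3
      exact (smul_eq_zero.mp h3).resolve_left (Nat.cast_ne_zero.mpr hm)

theorem weilP_weilD (w : Weil g ι) : weilP g ι (weilD b w) = 0 :=
  weilP_of_commute b ((weilD_isDer b).map_one sg_one) (weilE_weilD b) w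

theorem weilP_weilLie (x : g) (w : Weil g ι) : weilP g ι (weilLie b x w) = 0 :=
  weilP_of_commute b ((weilLie_isDer b x).map_one rfl) (weilE_weilLie b x) w

/-- The elements of `Wg` of degree `n` commute with all elements up to the usual sign. -/
theorem mul_comm_of_mem_weilDeg (b : Module.Basis ι ℝ g) {n : ℕ} {w : Weil g ι}
    (hw : w ∈ weilDeg g ι n) (v : Weil g ι) : w * v = (sg _ ^ n) v * w := by
  rw [← wordSpan_eq_weilDeg b] at hw
  induction hw using Submodule.span_induction with
  | mem w hw =>
    obtain ⟨m, hw⟩ := hw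
    induction hw with
    | one => simp
    | theta m n w a _ h =>
      rw [mul_assoc, h, theta, ← mul_assoc, thetaOf_mul, mul_assoc, pow_succ']
      rfl
    | dtheta m n w a _ h =>
      -- `dθ` is even, hence central; it contributes degree two and leaves the sign unchanged.
      have hc : ∀ u : Weil g ι, weilDTheta b (b.coord a) * u = u * weilDTheta b (b.coord a) := by
        intro u
        induction u using weil_induction with
        | one => simp
        | add x y hx hy => rw [mul_add, add_mul, hx, hy]
        | smul c x hx => rw [mul_smul_comm, smul_mul_assoc, hx]
        | tgen a w h => rw [← mul_assoc, ← (commute_tgen a _).eq, mul_assoc, h, mul_assoc]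
        | theta ξ w h => rw [← mul_assoc, ← (commute_weilDTheta b ξ _).eq, mul_assoc, h, mul_assoc]
      have h2 : (sg (Weil g ι) ^ (n + 2)) v = (sg _ ^ n) v := by
        rw [add_comm, pow_add, Module.End.mul_apply, pow_two, Module.End.mul_apply]
        exact SuperAlg.σ_σ _
      rw [mul_assoc, h, ← mul_assoc, hc, mul_assoc, h2]
  | zero => simp
  | add x y _ _ hx hy => rw [add_mul, mul_add, hx, hy]
  | smul c x _ hx => rw [smul_mul_assoc, mul_smul_comm, hx]

end weil

section enveloping
variable {g : Type*} [LieRing g] [LieAlgebra ℝ g] {ι : Type*} [Fintype ι] (b : Module.Basis ι ℝ g)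

/-! ### The differential of the enveloping algebra -/

theorem ud_induction {p : UD b → Prop} (algebraMap : ∀ r, p (algebraMap ℝ _ r))
    (lgen : ∀ x, p (lgen b x)) (Igen : ∀ u, p (Igen b u)) (mul : ∀ x y, p x → p y → p (x * y))
    (add : ∀ x y, p x → p y → p (x + y)) (x : UD b) : p x := by
  obtain ⟨x, rfl⟩ := RingQuot.mkAlgHom_surjective ℝ (DRel b) x
  induction x using TensorAlgebra.induction with
  | algebraMap r => rw [AlgHom.commutes]; exact algebraMap r
  | ι z =>
    have h : RingQuot.mkAlgHom ℝ (DRel b) (TensorAlgebra.ι ℝ z) =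
        DgTwist.lgen b z.1 + DgTwist.Igen b z.2 := by
      obtain ⟨x, u⟩ := z
      simp only [DgTwist.lgen, DgTwist.Igen, LinearMap.comp_apply, toPlus_of_mem, ← map_add]
      simp only [udMk, LinearMap.inl_apply, LinearMap.inr_apply, Prod.mk_add_mk, add_zero, zero_add]
      rfl
    rw [h]
    exact add _ _ (lgen _) (Igen _)
  | mul x y hx hy => rw [map_mul]; exact mul _ _ hx hy
  | add x y hx hy => rw [map_add]; exact add _ _ hx hy

theorem σ_lgen (x : g) : SuperAlg.σ (lgen b x) = lgen b x := udLift_lgen b _ _ _ _ x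

theorem σ_Igen (p : MvPolynomial ι ℝ) : SuperAlg.σ (Igen b p) = -Igen b p := by
  refine (udLift_Igen b _ _ _ _ p).trans ?_
  rw [LinearMap.neg_apply, LinearMap.comp_apply, Submodule.subtype_apply, Igen_toPlus]

theorem kappa_C (r : ℝ) : kappa (MvPolynomial.C r : MvPolynomial ι ℝ) =
    r • (1 : MvPolynomial ι ℝ) ⊗ₜ[ℝ] (1 : MvPolynomial ι ℝ) := by
  have h : (MvPolynomial.C r : MvPolynomial ι ℝ) = r • 1 := by
    rw [MvPolynomial.smul_eq_C_mul, mul_one]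
  have h1 : ∀ c : ℕ → ℝ, scale c (1 : MvPolynomial ι ℝ) = c 0 • 1 := fun c =>
    scale_of_homogeneous c (MvPolynomial.isHomogeneous_one _ _)
  rw [h, map_smul]
  simp [kappa, h1, Algebra.TensorProduct.one_def]

/-- Constants contribute nothing: `kappa` sends them to multiples of `1 ⊗ 1`, where `I(1) = 0`, and
they have no linear part. -/
theorem dIgen_toPlus (p : MvPolynomial ι ℝ) : dIgen b (toPlus p : MvPolynomial ι ℝ) = dIgen b p := by
  have h : ∀ r : ℝ, dIgen b (MvPolynomial.C r) = 0 := fun r => by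
    have hI : Igen b (1 : MvPolynomial ι ℝ) = 0 := by
      rw [← MvPolynomial.C_1]; exact Igen_C b 1
    rw [dIgen, LinearMap.add_apply, LinearMap.comp_apply, LinearMap.comp_apply, kappa_C,
      LinearMap.comp_apply, linPart_of_homogeneous b (MvPolynomial.isHomogeneous_C _ r) zero_ne_one]
    simp [hI]
  rw [coe_toPlus, map_sub, h, sub_zero]

theorem udDMat_lgen (x : g) : udDMat b (lgen b x) = !![lgen b x, 0; 0, lgen b x] :=
  udLift_lgen b _ _ _ _ x

theorem udDMat_Igen (p : MvPolynomial ι ℝ) :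
    udDMat b (Igen b p) = !![-Igen b p, dIgen b p; 0, Igen b p] := by
  refine (udLift_Igen b _ _ _ _ p).trans ?_
  change !![-Igen b (toPlus p : MvPolynomial ι ℝ), dIgen b (toPlus p : MvPolynomial ι ℝ); 0,
    Igen b (toPlus p : MvPolynomial ι ℝ)] = _
  rw [Igen_toPlus, dIgen_toPlus]

/-- Triangularity and the diagonal entries hold on generators and survive products. Only with the
diagonal known is the upper right entry an odd derivation. -/
theorem udDMat_entries (x : UD b) :
    udDMat b x 0 0 = SuperAlg.σ x ∧ udDMat b x 1 0 = 0 ∧ udDMat b x 1 1 = x := by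
  induction x using ud_induction with
  | algebraMap r => rw [AlgHom.commutes, AlgHom.commutes]; simp [Matrix.algebraMap_matrix_apply]
  | lgen x => rw [udDMat_lgen, σ_lgen]; simp
  | Igen u => rw [udDMat_Igen, σ_Igen]; simp
  | mul x y hx hy =>
    simp only [map_mul, Matrix.mul_apply, Fin.sum_univ_two, hx, hy, zero_mul, mul_zero, add_zero,
      zero_add, and_self]
  | add x y hx hy => simp only [map_add, Matrix.add_apply, hx, hy, add_zero, and_self]

theorem udD_isDer : IsDer (sg _) (udD b) := by
  intro x y
  change udDMat b (x * y) 0 1 = udDMat b x 0 1 * y + SuperAlg.σ x * udDMat b y 0 1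
  rw [map_mul, Matrix.mul_apply, Fin.sum_univ_two, (udDMat_entries b x).1,
    (udDMat_entries b y).2.2, add_comm]

theorem udD_lgen (x : g) : udD b (lgen b x) = 0 := by
  change udDMat b (lgen b x) 0 1 = 0
  rw [udDMat_lgen]; rfl

theorem udD_Igen (p : MvPolynomial ι ℝ) : udD b (Igen b p) = dIgen b p := by
  change udDMat b (Igen b p) 0 1 = _
  rw [udDMat_Igen]; rfl

theorem σ_dIgen (p : MvPolynomial ι ℝ) : SuperAlg.σ (dIgen b p) = dIgen b p := by
  have h : ∀ z : MvPolynomial ι ℝ ⊗[ℝ] MvPolynomial ι ℝ,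
      SuperAlg.σ (LinearMap.mul' ℝ (UD b) (TensorProduct.map (Igen b) (Igen b) z)) =
        LinearMap.mul' ℝ (UD b) (TensorProduct.map (Igen b) (Igen b) z) := fun z => by
    induction z using TensorProduct.induction_on with
    | zero => simp
    | add z z' h h' => simp only [map_add, h, h']
    | tmul p q => simp [σ_Igen]
  simp only [dIgen, LinearMap.add_apply, LinearMap.comp_apply, map_add, h, σ_lgen]

theorem udD_σ (x : UD b) : udD b (SuperAlg.σ x) = -SuperAlg.σ (udD b x) := by
  have h0 : ∀ r, udD b (algebraMap ℝ _ r) = 0 := fun r => by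
    rw [Algebra.algebraMap_eq_smul_one, map_smul, (udD_isDer b).map_one sg_one, smul_zero]
  induction x using ud_induction with
  | algebraMap r => rw [AlgHom.commutes, h0]; simp
  | lgen x => rw [σ_lgen, udD_lgen]; simp
  | Igen u => rw [σ_Igen, map_neg, udD_Igen, σ_dIgen]
  | mul x y hx hy =>
    rw [map_mul, udD_isDer b, udD_isDer b, hx, hy, map_add, map_mul, map_mul]
    simp only [AlgHom.toLinearMap_apply, neg_mul, mul_neg, neg_add]
  | add x y hx hy => simp only [map_add, hx, hy, neg_add]

/-! ### The enveloping algebra of the free Lie algebra -/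

theorem σ_ι (u : SPlus ι) : SuperAlg.σ (TensorAlgebra.ι ℝ u : UL ι) = -TensorAlgebra.ι ℝ u :=
  TensorAlgebra.lift_ι_apply _ _

theorem ulToUd_σ (x : UL ι) : ulToUd b (SuperAlg.σ x) = SuperAlg.σ (ulToUd b x) := by
  refine DFunLike.congr_fun (f := (ulToUd b).comp SuperAlg.σ)
    (g := AlgHom.comp SuperAlg.σ (ulToUd b)) (TensorAlgebra.hom_ext (LinearMap.ext fun u => ?_)) x
  simp [σ_ι, ulToUd, σ_Igen]

theorem ulToUd_ι (u : SPlus ι) : ulToUd b (TensorAlgebra.ι ℝ u) = Igen b u :=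
  TensorAlgebra.lift_ι_apply _ _

theorem ulToExt_ι (u : SPlus ι) :
    ulToExt b (TensorAlgebra.ι ℝ u) = ExteriorAlgebra.ι ℝ (linPart b u) :=
  TensorAlgebra.lift_ι_apply _ _

theorem σ_ext_ι (x : g) : SuperAlg.σ (ExteriorAlgebra.ι ℝ x) = -ExteriorAlgebra.ι ℝ x := by
  refine (ExteriorAlgebra.map_apply_ι _ _).trans ?_
  simp

theorem ulToExt_σ (x : UL ι) : ulToExt b (SuperAlg.σ x) = SuperAlg.σ (ulToExt b x) := by
  refine DFunLike.congr_fun (f := (ulToExt b).comp SuperAlg.σ)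
    (g := AlgHom.comp SuperAlg.σ (ulToExt b)) (TensorAlgebra.hom_ext (LinearMap.ext fun u => ?_)) x
  simp [σ_ι, ulToExt_ι, σ_ext_ι]

theorem ulComul_ι (u : SPlus ι) : ulComul (TensorAlgebra.ι ℝ u : UL ι) =
    tm (TensorAlgebra.ι ℝ u) 1 + tm 1 (TensorAlgebra.ι ℝ u) :=
  TensorAlgebra.lift_ι_apply _ _

theorem ulComul_σ (x : UL ι) : ulComul (SuperAlg.σ x) = SuperAlg.σ (ulComul x) := by
  refine DFunLike.congr_fun (f := ulComul.comp SuperAlg.σ)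
    (g := AlgHom.comp SuperAlg.σ ulComul) (TensorAlgebra.hom_ext (LinearMap.ext fun u => ?_)) x
  simp [σ_ι, ulComul_ι, σ_tm, neg_tm, tm_neg, add_comm]

theorem ulAd_ι (x : g) (u : SPlus ι) : ulAd b x (TensorAlgebra.ι ℝ u) =
    !![TensorAlgebra.ι ℝ u, TensorAlgebra.ι ℝ (adPlus b x u); 0, TensorAlgebra.ι ℝ u] :=
  TensorAlgebra.lift_ι_apply _ _

theorem ulLie_ι (x : g) (u : SPlus ι) :
    ulLie b x (TensorAlgebra.ι ℝ u) = TensorAlgebra.ι ℝ (adPlus b x u) := by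
  change ulAd b x _ 0 1 = _
  rw [ulAd_ι]; rfl

theorem ulAd_entries (x : g) (y : UL ι) :
    ulAd b x y 0 0 = y ∧ ulAd b x y 1 0 = 0 ∧ ulAd b x y 1 1 = y := by
  induction y using TensorAlgebra.induction with
  | algebraMap r => rw [AlgHom.commutes]; simp [Matrix.algebraMap_matrix_apply]
  | ι u => rw [ulAd_ι]; simp
  | mul x y hx hy =>
    simp only [map_mul, Matrix.mul_apply, Fin.sum_univ_two, hx, hy, zero_mul, mul_zero, add_zero,
      zero_add, and_self]
  | add x y hx hy => simp only [map_add, Matrix.add_apply, hx, hy, add_zero, and_self]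

theorem ulLie_isDer (x : g) : IsDer LinearMap.id (ulLie b x) := by
  intro y z
  change ulAd b x (y * z) 0 1 = ulAd b x y 0 1 * z + y * ulAd b x z 0 1
  rw [map_mul, Matrix.mul_apply, Fin.sum_univ_two, (ulAd_entries b x y).1,
    (ulAd_entries b x z).2.2, add_comm]

theorem ulLie_σ (x : g) (y : UL ι) : ulLie b x (SuperAlg.σ y) = SuperAlg.σ (ulLie b x y) := by
  have h0 : ∀ r, ulLie b x (algebraMap ℝ _ r) = 0 := fun r => by
    rw [Algebra.algebraMap_eq_smul_one, map_smul, (ulLie_isDer b x).map_one rfl, smul_zero]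
  induction y using TensorAlgebra.induction with
  | algebraMap r => rw [AlgHom.commutes, h0, map_zero]
  | ι u => rw [σ_ι, map_neg, ulLie_ι, σ_ι]
  | mul y z hx hy =>
    rw [map_mul, ulLie_isDer b, ulLie_isDer b, hx, hy, map_add, map_mul, map_mul]
    simp only [LinearMap.id_apply]
  | add y z hx hy => simp only [map_add, hx, hy]

/-! ### The canonical element of `S g* ⊗ S g` -/

variable (g) in
/-- The inclusion of `S g*` in `Wg`. -/
def symToWeil : MvPolynomial ι ℝ →ₗ[ℝ] Weil g ι where
  toFun s := wt s 1
  map_add' s s' := wt_add_left s s' 1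
  map_smul' _ _ := rfl

theorem symToWeil_apply (s : MvPolynomial ι ℝ) : symToWeil g s = wt s 1 := rfl

section placing
variable {M : Type*} [AddCommGroup M] [Module ℝ M] {B : Type*} [Ring B] [Algebra ℝ B] [SuperAlg B]

variable (g) in
/-- The map `S g* ⊗ M → Wg ⊗ B` induced by `I : M → B`. -/
def place (I : M →ₗ[ℝ] B) : MvPolynomial ι ℝ ⊗[ℝ] M →ₗ[ℝ] STensor (Weil g ι) B :=
  (GradedTensorProduct.of ℝ (parity (Weil g ι)) (parity B)).toLinearMap ∘ₗ
    TensorProduct.map (symToWeil g) I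

theorem place_tmul (I : M →ₗ[ℝ] B) (s : MvPolynomial ι ℝ) (m : M) :
    place g I (s ⊗ₜ m) = tm (wt s 1) (I m) := rfl

theorem smap_id_place {B' : Type*} [Ring B'] [Algebra ℝ B'] [SuperAlg B'] (I : M →ₗ[ℝ] B)
    (f : B →ₗ[ℝ] B') (z : MvPolynomial ι ℝ ⊗[ℝ] M) :
    smap LinearMap.id f (place g I z) = place g (f ∘ₗ I) z := by
  induction z using TensorProduct.induction_on with
  | zero => simp
  | add z z' h h' => simp only [map_add, h, h']
  | tmul s m => rfl

theorem place_comp {N : Type*} [AddCommGroup N] [Module ℝ N] (f : N →ₗ[ℝ] M) (I : M →ₗ[ℝ] B)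
    (z : MvPolynomial ι ℝ ⊗[ℝ] N) :
    place g (I ∘ₗ f) z = place g I (TensorProduct.map LinearMap.id f z) := by
  induction z using TensorProduct.induction_on with
  | zero => simp
  | add z z' h h' => simp only [map_add, h, h']
  | tmul s m => rfl

theorem place_add (I I' : M →ₗ[ℝ] B) (z : MvPolynomial ι ℝ ⊗[ℝ] M) :
    place g (I + I') z = place g I z + place g I' z := by
  induction z using TensorProduct.induction_on with
  | zero => simp
  | add z z' h h' => simp only [map_add, h, h']; abel
  | tmul s m => simp only [place_tmul, LinearMap.add_apply, tm_add]

end placing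

variable (ι) in
/-- The canonical element `∑ t^a ⊗ e_a`. -/
def canon : MvPolynomial ι ℝ ⊗[ℝ] MvPolynomial ι ℝ :=
  ∑ a, MvPolynomial.X a ⊗ₜ MvPolynomial.X a

theorem canon_pow (k : ℕ) : canon ι ^ k = ∑ f : Fin k → ι,
    (∏ j, MvPolynomial.X (f j) : MvPolynomial ι ℝ) ⊗ₜ[ℝ] (∏ j, MvPolynomial.X (f j)) := by
  have h : ∀ f : Fin k → ι, (∏ j, MvPolynomial.X (f j) : MvPolynomial ι ℝ) ⊗ₜ[ℝ]
      (∏ j, MvPolynomial.X (f j) : MvPolynomial ι ℝ) =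
      ∏ j, (MvPolynomial.X (f j) : MvPolynomial ι ℝ) ⊗ₜ[ℝ] (MvPolynomial.X (f j)) := fun f => by
    induction (Finset.univ : Finset (Fin k)) using Finset.cons_induction with
    | empty => rfl
    | cons j s hj ih => simp only [Finset.prod_cons, ← ih, Algebra.TensorProduct.tmul_mul_tmul]
  rw [canon, Fintype.sum_pow]
  exact Finset.sum_congr rfl fun f _ => (h f).symm

theorem isHomogeneous_prod_X {k : ℕ} (f : Fin k → ι) :
    (∏ j, MvPolynomial.X (f j) : MvPolynomial ι ℝ).IsHomogeneous k := by
  have h := MvPolynomial.IsHomogeneous.prod (R := ℝ) Finset.univ (fun j => MvPolynomial.X (f j))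
    (fun _ => 1) (fun j _ => MvPolynomial.isHomogeneous_X ℝ (f j))
  simpa using h

/-- The action of `x ∈ g` on `S g* ⊗ S g`. -/
def coadAd (x : g) :
    MvPolynomial ι ℝ ⊗[ℝ] MvPolynomial ι ℝ →ₗ[ℝ] MvPolynomial ι ℝ ⊗[ℝ] MvPolynomial ι ℝ :=
  TensorProduct.map (lieSym b x).toLinearMap LinearMap.id +
    TensorProduct.map LinearMap.id (adS b x).toLinearMap

theorem coadAd_tmul (x : g) (p q : MvPolynomial ι ℝ) :
    coadAd b x (p ⊗ₜ q) = lieSym b x p ⊗ₜ q + p ⊗ₜ adS b x q := rfl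

theorem coadAd_mul (x : g) (z w : MvPolynomial ι ℝ ⊗[ℝ] MvPolynomial ι ℝ) :
    coadAd b x (z * w) = z * coadAd b x w + coadAd b x z * w := by
  induction z using TensorProduct.induction_on with
  | zero => simp
  | add z z' h h' => rw [add_mul, map_add, h, h', map_add]; ring
  | tmul p q =>
    induction w using TensorProduct.induction_on with
    | zero => simp
    | add w w' h h' => rw [mul_add, map_add, h, h', map_add]; ring
    | tmul p' q' =>
      simp only [Algebra.TensorProduct.tmul_mul_tmul, coadAd_tmul, Derivation.leibniz, smul_eq_mul,
        TensorProduct.add_tmul, TensorProduct.tmul_add, mul_add, add_mul]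
      rw [mul_comm p' (lieSym b x p), mul_comm q' (adS b x q)]
      abel

/-- The canonical element of `g* ⊗ g` is the identity map of `g`, which is invariant: the coadjoint
matrix is minus the transpose of the adjoint one. Powers are invariant since the action is by
derivations. -/
theorem coadAd_canon_pow (x : g) (k : ℕ) : coadAd b x (canon ι ^ k) = 0 := by
  induction k with
  | zero => rw [pow_zero, Algebra.TensorProduct.one_def, coadAd_tmul]; simp
  | succ k ih =>
    rw [pow_succ, coadAd_mul, ih, zero_mul, add_zero]
    have h : coadAd b x (canon ι) = 0 := by
      have hl : ∀ a, adS b x (MvPolynomial.X a) =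
          ∑ c, b.coord c ⁅x, b a⁆ • (MvPolynomial.X c : MvPolynomial ι ℝ) := fun a => by
        rw [adS, MvPolynomial.mkDerivation_X, linPoly, LinearMap.sum_apply]; rfl
      simp only [canon, map_sum, coadAd_tmul, hl, lieSym, MvPolynomial.mkDerivation_X, coad_apply,
        Finset.sum_add_distrib, TensorProduct.sum_tmul, TensorProduct.tmul_sum,
        TensorProduct.tmul_smul, ← TensorProduct.smul_tmul', neg_smul, TensorProduct.neg_tmul,
        Finset.sum_neg_distrib]
      rw [neg_add_eq_zero]
      exact Finset.sum_comm
    rw [h, mul_zero]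

theorem map_scale_canon_pow (c : ℕ → ℝ) (k : ℕ) :
    TensorProduct.map LinearMap.id (scale c) (canon ι ^ k) = c k • canon ι ^ k := by
  rw [canon_pow, map_sum, Finset.smul_sum]
  refine Finset.sum_congr rfl fun f _ => ?_
  rw [TensorProduct.map_tmul, scale_of_homogeneous c (isHomogeneous_prod_X f),
    TensorProduct.tmul_smul]
  rfl

variable (ι) in
/-- The algebra `S g* ⊗ (S g ⊗ S g)`. -/
def SymTriple : Type _ := MvPolynomial ι ℝ ⊗[ℝ] (MvPolynomial ι ℝ ⊗[ℝ] MvPolynomial ι ℝ)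

instance : CommRing (SymTriple ι) := inferInstanceAs
  (CommRing (MvPolynomial ι ℝ ⊗[ℝ] (MvPolynomial ι ℝ ⊗[ℝ] MvPolynomial ι ℝ)))

instance : Algebra ℝ (SymTriple ι) := inferInstanceAs
  (Algebra ℝ (MvPolynomial ι ℝ ⊗[ℝ] (MvPolynomial ι ℝ ⊗[ℝ] MvPolynomial ι ℝ)))

/-- The pure tensor `s ⊗ (p ⊗ q)`. -/
def triple (s p q : MvPolynomial ι ℝ) : SymTriple ι := s ⊗ₜ (p ⊗ₜ q)

theorem triple_mul (s s' p p' q q' : MvPolynomial ι ℝ) :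
    triple s p q * triple s' p' q' = triple (s * s') (p * p') (q * q') :=
  (Algebra.TensorProduct.tmul_mul_tmul s s' (p ⊗ₜ[ℝ] q) (p' ⊗ₜ[ℝ] q')).trans
    (congrArg (fun z => (s * s') ⊗ₜ[ℝ] z) (Algebra.TensorProduct.tmul_mul_tmul p p' q q'))

variable (ι) in
/-- The map `s ⊗ p ↦ s ⊗ (p ⊗ 1)`. -/
def inFirst : MvPolynomial ι ℝ ⊗[ℝ] MvPolynomial ι ℝ →ₐ[ℝ] SymTriple ι :=
  (Algebra.TensorProduct.map (AlgHom.id ℝ _) Algebra.TensorProduct.includeLeft :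
    MvPolynomial ι ℝ ⊗[ℝ] MvPolynomial ι ℝ →ₐ[ℝ]
      MvPolynomial ι ℝ ⊗[ℝ] (MvPolynomial ι ℝ ⊗[ℝ] MvPolynomial ι ℝ))

variable (ι) in
/-- The map `s ⊗ p ↦ s ⊗ (1 ⊗ p)`. -/
def inSecond : MvPolynomial ι ℝ ⊗[ℝ] MvPolynomial ι ℝ →ₐ[ℝ] SymTriple ι :=
  (Algebra.TensorProduct.map (AlgHom.id ℝ _) Algebra.TensorProduct.includeRight :
    MvPolynomial ι ℝ ⊗[ℝ] MvPolynomial ι ℝ →ₐ[ℝ]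
      MvPolynomial ι ℝ ⊗[ℝ] (MvPolynomial ι ℝ ⊗[ℝ] MvPolynomial ι ℝ))

variable (ι) in
/-- The coproduct on the second factor. -/
def inDelta : MvPolynomial ι ℝ ⊗[ℝ] MvPolynomial ι ℝ →ₐ[ℝ] SymTriple ι :=
  (Algebra.TensorProduct.map (AlgHom.id ℝ _) deltaS :
    MvPolynomial ι ℝ ⊗[ℝ] MvPolynomial ι ℝ →ₐ[ℝ]
      MvPolynomial ι ℝ ⊗[ℝ] (MvPolynomial ι ℝ ⊗[ℝ] MvPolynomial ι ℝ))

variable (ι) in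
/-- The map `kappa` on the second factor. -/
def inKappa : MvPolynomial ι ℝ ⊗[ℝ] MvPolynomial ι ℝ →ₗ[ℝ] SymTriple ι :=
  (TensorProduct.map LinearMap.id kappa : MvPolynomial ι ℝ ⊗[ℝ] MvPolynomial ι ℝ →ₗ[ℝ]
      MvPolynomial ι ℝ ⊗[ℝ] (MvPolynomial ι ℝ ⊗[ℝ] MvPolynomial ι ℝ))

/-- The map `f ⊗ f` on the second and third factor. -/
def mapLast (f : MvPolynomial ι ℝ →ₗ[ℝ] MvPolynomial ι ℝ) : SymTriple ι →ₗ[ℝ] SymTriple ι :=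
  (TensorProduct.map LinearMap.id (TensorProduct.map f f) :
    MvPolynomial ι ℝ ⊗[ℝ] (MvPolynomial ι ℝ ⊗[ℝ] MvPolynomial ι ℝ) →ₗ[ℝ]
      MvPolynomial ι ℝ ⊗[ℝ] (MvPolynomial ι ℝ ⊗[ℝ] MvPolynomial ι ℝ))

theorem inFirst_tmul (s p : MvPolynomial ι ℝ) : inFirst ι (s ⊗ₜ p) = triple s p 1 := rfl

theorem inSecond_tmul (s p : MvPolynomial ι ℝ) : inSecond ι (s ⊗ₜ p) = triple s 1 p := rfl

theorem inFirst_tmul_mul_inSecond_tmul (s s' p p' : MvPolynomial ι ℝ) :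
    inFirst ι (s ⊗ₜ p) * inSecond ι (s' ⊗ₜ p') = triple (s * s') p p' := by
  rw [inFirst_tmul, inSecond_tmul, triple_mul, mul_one, one_mul]

theorem mapLast_inFirst_mul_inSecond (f : MvPolynomial ι ℝ →ₗ[ℝ] MvPolynomial ι ℝ)
    (z w : MvPolynomial ι ℝ ⊗[ℝ] MvPolynomial ι ℝ) :
    mapLast f (inFirst ι z * inSecond ι w) =
      inFirst ι (TensorProduct.map LinearMap.id f z) *
        inSecond ι (TensorProduct.map LinearMap.id f w) := by
  induction z using TensorProduct.induction_on with
  | zero => simp only [map_zero, zero_mul]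
  | add z z' h h' => simp only [map_add, add_mul, h, h']
  | tmul p q =>
    induction w using TensorProduct.induction_on with
    | zero => simp only [map_zero, mul_zero]
    | add w w' h h' => simp only [map_add, mul_add, h, h']
    | tmul p' q' =>
      simp only [inFirst_tmul_mul_inSecond_tmul, TensorProduct.map_tmul, LinearMap.id_apply]
      rfl

/-- The polarized form of `x^k ↦ ∑ x^r ⊗ x^s`, with `x` replaced by the generic element `∑ t^a ⊗
e_a`. The coproduct sends the generic element to a sum of two copies, and the factorial rescalings
cancel the binomial coefficients. -/
theorem inKappa_canon_pow (k : ℕ) : inKappa ι (canon ι ^ k) =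
    ∑ r ∈ Finset.HasAntidiagonal.antidiagonal k,
      inFirst ι (canon ι ^ r.1) * inSecond ι (canon ι ^ r.2) := by
  have hδ : inDelta ι (canon ι ^ k) = (inFirst ι (canon ι) + inSecond ι (canon ι)) ^ k := by
    rw [map_pow]
    congr 1
    simp only [canon, map_sum, ← Finset.sum_add_distrib]
    refine Finset.sum_congr rfl fun a _ => ?_
    change MvPolynomial.X a ⊗ₜ deltaS (MvPolynomial.X a) = _
    rw [deltaS, MvPolynomial.aeval_X]
    exact TensorProduct.tmul_add _ _ _
  have hc : inKappa ι (canon ι ^ k) = mapLast (scale fun k => (k.factorial : ℝ))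
      (inDelta ι (TensorProduct.map LinearMap.id (scale fun k => (k.factorial : ℝ)⁻¹)
        (canon ι ^ k))) := by
    have h : ∀ z, inKappa ι z = mapLast (scale fun k => (k.factorial : ℝ))
      (inDelta ι (TensorProduct.map LinearMap.id (scale fun k => (k.factorial : ℝ)⁻¹) z)) := by
      intro z
      induction z using TensorProduct.induction_on with
      | zero => simp only [map_zero]
      | add z z' h h' => simp only [map_add, h, h']
      | tmul s p => rfl
    exact h _
  rw [hc, map_scale_canon_pow, map_smul, hδ, map_smul, (Commute.all _ _).add_pow', map_sum,
    Finset.smul_sum]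
  refine Finset.sum_congr rfl fun r hr => ?_
  rw [Finset.HasAntidiagonal.mem_antidiagonal] at hr
  rw [← map_pow, ← map_pow, map_nsmul, mapLast_inFirst_mul_inSecond, map_scale_canon_pow,
    map_scale_canon_pow, map_smul, map_smul, smul_mul_smul_comm, ← Nat.cast_smul_eq_nsmul ℝ,
    smul_smul, smul_smul]
  have h := Nat.choose_mul_factorial_mul_factorial (n := k) (k := r.1) (by omega)
  rw [show k - r.1 = r.2 by omega] at h
  have h' : ((k.choose r.1 : ℕ) : ℝ) * r.1.factorial * r.2.factorial = k.factorial := by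
    exact_mod_cast h
  have h0 : (k.factorial : ℝ) ≠ 0 := by positivity
  rw [show (k.factorial : ℝ)⁻¹ * (k.choose r.1) * (r.1.factorial * r.2.factorial) = 1 by
    rw [mul_assoc, ← mul_assoc (k.choose r.1 : ℝ), h', inv_mul_cancel₀ h0], one_smul]

theorem linPart_X (a : ι) : linPart b (MvPolynomial.X a) = b a := by
  classical
  have hX : MvPolynomial.X a = linPoly b (b a) := by
    simp [linPoly, Finsupp.single_apply]
  rw [hX, linPart_linPoly]

theorem map_linPart_canon_pow (k : ℕ) : TensorProduct.map LinearMap.id (linPart b) (canon ι ^ k) =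
    if k = 1 then ∑ a, MvPolynomial.X a ⊗ₜ b a else 0 := by
  split_ifs with hk
  · subst hk
    simp [canon, linPart_X]
  · rw [canon_pow, map_sum]
    refine Finset.sum_eq_zero fun f _ => ?_
    rw [TensorProduct.map_tmul, linPart_of_homogeneous b (isHomogeneous_prod_X f) hk,
      TensorProduct.tmul_zero]

end enveloping

section maurerCartan
variable {g : Type*} [LieRing g] [LieAlgebra ℝ g] {ι : Type*} [Fintype ι] (b : Module.Basis ι ℝ g)

/-! ### The Maurer-Cartan equation -/

section series
variable {B : Type*} [Ring B] [Algebra ℝ B] [SuperAlg B]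

variable (g) in
/-- The series `∑_k I((∑ t^a ⊗ e_a)^k)`, where the `k`-th summand has degree `2 k - 1`. -/
def placeSeries (I : MvPolynomial ι ℝ →ₗ[ℝ] B) : PowerSeries (STensor (Weil g ι) B) :=
  PowerSeries.mk fun n => if Odd n then place g I (canon ι ^ ((n + 1) / 2)) else 0

theorem coeff_placeSeries (I : MvPolynomial ι ℝ →ₗ[ℝ] B) (n : ℕ) :
    PowerSeries.coeff n (placeSeries g I) =
      if Odd n then place g I (canon ι ^ ((n + 1) / 2)) else 0 :=
  PowerSeries.coeff_mk _ _

theorem coeff_placeSeries_odd (I : MvPolynomial ι ℝ →ₗ[ℝ] B) (m : ℕ) :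
    PowerSeries.coeff (2 * m + 1) (placeSeries g I) = place g I (canon ι ^ (m + 1)) := by
  rw [coeff_placeSeries, if_pos (odd_two_mul_add_one m), show (2 * m + 1 + 1) / 2 = m + 1 by omega]

theorem coeff_placeSeries_even (I : MvPolynomial ι ℝ →ₗ[ℝ] B) (m : ℕ) :
    PowerSeries.coeff (2 * m) (placeSeries g I) = 0 := by
  rw [coeff_placeSeries, if_neg (by simp)]

theorem cmap_placeSeries {B' : Type*} [Ring B'] [Algebra ℝ B'] [SuperAlg B']
    (I : MvPolynomial ι ℝ →ₗ[ℝ] B) (f : B →ₗ[ℝ] B') :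
    cmap (smap LinearMap.id f) (placeSeries g I) = placeSeries g (f ∘ₗ I) := by
  ext n
  rw [coeff_cmap, coeff_placeSeries, coeff_placeSeries]
  split_ifs
  · rw [smap_id_place]
  · rw [map_zero]

theorem coeff_placeSeries_mul_self (I : MvPolynomial ι ℝ →ₗ[ℝ] B) (n : ℕ) :
    PowerSeries.coeff n (placeSeries g I * placeSeries g I) =
      ∑ p ∈ Finset.HasAntidiagonal.antidiagonal n, (if Odd p.1 ∧ Odd p.2 then
        place g I (canon ι ^ ((p.1 + 1) / 2)) * place g I (canon ι ^ ((p.2 + 1) / 2)) else 0) := by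
  rw [PowerSeries.coeff_mul]
  refine Finset.sum_congr rfl fun p _ => ?_
  rw [coeff_placeSeries, coeff_placeSeries]
  split_ifs <;> simp_all

theorem coeff_placeSeries_mul_self_odd (I : MvPolynomial ι ℝ →ₗ[ℝ] B) (m : ℕ) :
    PowerSeries.coeff (2 * m + 1) (placeSeries g I * placeSeries g I) = 0 := by
  rw [coeff_placeSeries_mul_self]
  refine Finset.sum_eq_zero fun p hp => if_neg ?_
  rw [Finset.HasAntidiagonal.mem_antidiagonal] at hp
  rintro ⟨⟨i, hi⟩, ⟨j, hj⟩⟩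
  omega

/-- Only odd indices occur in the factors, and `2m + 2 = (2i + 1) + (2j + 1)` means `i + j = m`. -/
theorem coeff_placeSeries_mul_self_even (I : MvPolynomial ι ℝ →ₗ[ℝ] B) (m : ℕ) :
    PowerSeries.coeff (2 * m + 2) (placeSeries g I * placeSeries g I) =
      ∑ p ∈ Finset.HasAntidiagonal.antidiagonal m,
        place g I (canon ι ^ (p.1 + 1)) * place g I (canon ι ^ (p.2 + 1)) := by
  rw [coeff_placeSeries_mul_self]
  symm
  refine Finset.sum_of_injOn (fun p => (2 * p.1 + 1, 2 * p.2 + 1)) ?_ ?_ ?_ ?_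
  · rintro ⟨i, j⟩ - ⟨i', j'⟩ - h
    simp only [Prod.mk.injEq] at h ⊢
    omega
  · rintro ⟨i, j⟩ h
    simp only [Finset.mem_coe, Finset.HasAntidiagonal.mem_antidiagonal] at h ⊢
    omega
  · rintro ⟨i, j⟩ h h'
    refine if_neg ?_
    rintro ⟨⟨r, hr⟩, ⟨s, hs⟩⟩
    refine h' ⟨(r, s), ?_, ?_⟩
    · simp only [Finset.mem_coe, Finset.HasAntidiagonal.mem_antidiagonal] at h ⊢
      omega
    · simp only [Prod.mk.injEq] at hr hs ⊢
      exact ⟨hr.symm, hs.symm⟩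
  · rintro ⟨i, j⟩ -
    rw [if_pos ⟨odd_two_mul_add_one i, odd_two_mul_add_one j⟩,
      show (2 * i + 1 + 1) / 2 = i + 1 by omega, show (2 * j + 1 + 1) / 2 = j + 1 by omega]

variable (g) in
/-- The map `s ⊗ (p ⊗ q) ↦ s ⊗ I(p) I(q)`. -/
def placeTriple (I : MvPolynomial ι ℝ →ₗ[ℝ] B) : SymTriple ι →ₗ[ℝ] STensor (Weil g ι) B :=
  (place g (LinearMap.mul' ℝ B ∘ₗ TensorProduct.map I I) :
    MvPolynomial ι ℝ ⊗[ℝ] (MvPolynomial ι ℝ ⊗[ℝ] MvPolynomial ι ℝ) →ₗ[ℝ] _)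

/-- No sign appears because the odd `I(p)` only passes polynomials in `t`, which are even. -/
theorem placeTriple_mul (I : MvPolynomial ι ℝ →ₗ[ℝ] B) (hI : ∀ p, SuperAlg.σ (I p) = -I p)
    (z w : MvPolynomial ι ℝ ⊗[ℝ] MvPolynomial ι ℝ) :
    placeTriple g I (inFirst ι z * inSecond ι w) = place g I z * place g I w := by
  induction z using TensorProduct.induction_on with
  | zero => simp only [map_zero, zero_mul]
  | add z z' h h' => simp only [map_add, add_mul, h, h']
  | tmul p q =>
    induction w using TensorProduct.induction_on with
    | zero => simp only [map_zero, mul_zero]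
    | add w w' h h' => simp only [map_add, mul_add, h, h']
    | tmul p' q' =>
      rw [inFirst_tmul_mul_inSecond_tmul, place_tmul, place_tmul, tm_mul_of_odd _ _ _ (hI q),
        σ_wt_one, wt_mul, one_mul]
      rfl

end series

theorem iT_eq_placeSeries : iT b = placeSeries g (Igen b) := by
  ext n
  rw [coeff_placeSeries, iT, PowerSeries.coeff_mk, canon_pow, map_sum]
  rfl

theorem place_Igen_one :
    place g (Igen b) (1 : MvPolynomial ι ℝ ⊗[ℝ] MvPolynomial ι ℝ) = 0 := by
  rw [Algebra.TensorProduct.one_def, place_tmul, ← MvPolynomial.C_1, Igen_C, tm_zero]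

/-- The differential of `U(Dg)` on the canonical elements. -/
theorem smap_udD_place (k : ℕ) :
    smap (sg _) (udD b) (place g (Igen b) (canon ι ^ k)) =
      ∑ r ∈ Finset.HasAntidiagonal.antidiagonal k,
        place g (Igen b) (canon ι ^ r.1) * place g (Igen b) (canon ι ^ r.2) +
      if k = 1 then ∑ a, tm (tgen a) (lgen b (b a)) else 0 := by
  have h1 : ∀ z : MvPolynomial ι ℝ ⊗[ℝ] MvPolynomial ι ℝ,
      smap (sg _) (udD b) (place g (Igen b) z) = place g (dIgen b) z := fun z => by
    induction z using TensorProduct.induction_on with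
    | zero => simp only [map_zero]
    | add z z' h h' => simp only [map_add, h, h']
    | tmul s p =>
      rw [place_tmul, place_tmul, smap_tm, udD_Igen, AlgHom.toLinearMap_apply, σ_wt_one]
  have h2 : ∀ z, place g (LinearMap.mul' ℝ (UD b) ∘ₗ TensorProduct.map (Igen b) (Igen b) ∘ₗ kappa) z =
      placeTriple g (Igen b) (inKappa ι z) := fun z =>
    place_comp kappa (LinearMap.mul' ℝ (UD b) ∘ₗ TensorProduct.map (Igen b) (Igen b)) z
  rw [h1, dIgen, place_add, h2, inKappa_canon_pow, map_sum, place_comp, map_linPart_canon_pow]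
  congr 1
  · exact Finset.sum_congr rfl fun r _ => placeTriple_mul _ (σ_Igen b) _ _
  · split_ifs
    · rw [map_sum]; rfl
    · rw [map_zero]

/-- On `S g*` the Weil differential is `∑ θ^c L_c`, with `L_c` the coadjoint action of `e_c`: both
sides are derivations with the same values on `t^a`. -/
theorem weilDS_eq (s : MvPolynomial ι ℝ) :
    weilDS b s = ∑ c, theta b c * wt (lieSym b (b c) s) 1 := by
  have hs : ∀ (p q : MvPolynomial ι ℝ), (wt (p * q) 1 : Weil g ι) = p • wt q 1 := fun p q =>
    (smul_wt p q 1).symm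
  induction s using MvPolynomial.induction_on with
  | C r => simp only [MvPolynomial.derivation_C, wt_zero_left, mul_zero, Finset.sum_const_zero]
  | add p q hp hq => simp only [map_add, wt_add_left, mul_add, Finset.sum_add_distrib, hp, hq]
  | mul_X p a hp =>
    simp only [Derivation.leibniz, hp, smul_eq_mul, wt_add_left, hs, mul_add,
      Finset.sum_add_distrib, mul_smul_comm, ← Finset.smul_sum]
    congr 2
    rw [weilDS, MvPolynomial.mkDerivation_X, ← Finset.sum_neg_distrib]
    refine Finset.sum_congr rfl fun c _ => ?_
    rw [← symToWeil_apply, lieSym, MvPolynomial.mkDerivation_X, map_sum, Finset.mul_sum,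
      ← Finset.sum_neg_distrib]
    refine Finset.sum_congr rfl fun c' _ => ?_
    rw [coad_apply, map_smul, mul_smul_comm, neg_smul]
    rfl

variable (g) in
/-- The coefficient `∑ θ^a ⊗ l(e_a)` of `lTheta`. -/
def lThetaCoeff : STensor (Weil g ι) (UD b) := ∑ a, tm (theta b a) (lgen b (b a))

/-- The differential contributes `∑ θ^c L_c` on the `t`-factor, and the anticommutator with `l(θ)`
contributes `∑ θ^c ad_c` on the other one. Together they apply the diagonal action, under which the
canonical element is invariant. -/
theorem smap_weilD_place (k : ℕ) :
    smap (weilD b) LinearMap.id (place g (Igen b) (canon ι ^ k)) +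
      lThetaCoeff g b * place g (Igen b) (canon ι ^ k) +
      place g (Igen b) (canon ι ^ k) * lThetaCoeff g b = 0 := by
  have h : ∀ z, smap (weilD b) LinearMap.id (place g (Igen b) z) +
      lThetaCoeff g b * place g (Igen b) z + place g (Igen b) z * lThetaCoeff g b =
      ∑ c, tm (theta b c) 1 * place g (Igen b) (coadAd b (b c) z) := fun z => by
    induction z using TensorProduct.induction_on with
    | zero => simp
    | add z z' h h' =>
      simp only [map_add, mul_add, add_mul, Finset.sum_add_distrib, ← h, ← h']
      abel
    | tmul s p =>
      have h1 : (SuperAlg.σ (1 : UD b)) = 1 := map_one _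
      rw [place_tmul, smap_tm, weilD_wt_one, weilDS_eq, sum_tm, lThetaCoeff, Finset.sum_mul,
        Finset.mul_sum, ← Finset.sum_add_distrib, ← Finset.sum_add_distrib]
      refine Finset.sum_congr rfl fun c _ => ?_
      rw [tm_mul_of_even _ _ _ (σ_lgen b _), tm_mul_of_odd _ _ _ (σ_Igen b _), coadAd_tmul,
        map_add, place_tmul, place_tmul, mul_add, tm_mul_of_even _ _ _ h1,
        tm_mul_of_even _ _ _ h1, one_mul, one_mul, ← lgen_Igen, theta, σ_thetaOf, mul_neg,
        thetaOf_mul, σ_wt_one, neg_tm, tm_sub, LinearMap.id_apply]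
      rw [thetaOf_mul, σ_wt_one]
      abel
  rw [h]
  simp only [coadAd_canon_pow, map_zero, mul_zero, Finset.sum_const_zero]

/-- The curvature of `l(θ)` is `l(t)`. By antisymmetry of `θ^p θ^q`, the square of `l(θ)` is half
the sum with the brackets `l([e_p, e_q])`, which cancels the quadratic part of `dθ`. -/
theorem smap_weilD_lThetaCoeff :
    smap (weilD b) LinearMap.id (lThetaCoeff g b) + lThetaCoeff g b * lThetaCoeff g b =
      ∑ a, tm (tgen a) (lgen b (b a)) := by
  have h1 : lThetaCoeff g b * lThetaCoeff g b =
      ∑ p, ∑ q, tm (theta b p * theta b q) (lgen b (b p) * lgen b (b q)) := by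
    simp only [lThetaCoeff, Finset.sum_mul, Finset.mul_sum]
    rw [Finset.sum_comm]
    exact Finset.sum_congr rfl fun p _ => Finset.sum_congr rfl fun q _ =>
      tm_mul_of_even _ _ _ (σ_lgen b _)
  have h2 : lThetaCoeff g b * lThetaCoeff g b =
      -∑ p, ∑ q, tm (theta b p * theta b q) (lgen b (b q) * lgen b (b p)) := by
    rw [h1, Finset.sum_comm]
    simp only [← Finset.sum_neg_distrib]
    refine Finset.sum_congr rfl fun p _ => Finset.sum_congr rfl fun q _ => ?_
    rw [theta, theta, thetaOf_anticomm, neg_tm]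
  have h3 : (2 : ℝ) • (lThetaCoeff g b * lThetaCoeff g b) =
      ∑ p, ∑ q, tm (theta b p * theta b q) (lgen b ⁅b p, b q⁆) := by
    rw [two_smul]
    conv_lhs => rw [h2]
    rw [← h2]
    nth_rw 2 [h2]
    rw [h1, ← sub_eq_add_neg]
    simp only [← Finset.sum_sub_distrib, ← tm_sub, lgen_lgen]
  have h4 : lThetaCoeff g b * lThetaCoeff g b =
      (2⁻¹ : ℝ) • ∑ p, ∑ q, tm (theta b p * theta b q) (lgen b ⁅b p, b q⁆) := by
    rw [← h3, smul_smul, inv_mul_cancel₀ two_ne_zero, one_smul]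
  have h5 : ∀ p q, tm (theta b p * theta b q : Weil g ι) (lgen b ⁅b p, b q⁆) =
      ∑ a, tm (b.coord a ⁅b p, b q⁆ • (theta b p * theta b q)) (lgen b (b a)) := fun p q => by
    conv_lhs => rw [← b.sum_repr ⁅b p, b q⁆, map_sum, tm_sum]
    refine Finset.sum_congr rfl fun a _ => ?_
    rw [map_smul, tm_smul, smul_tm]
    rfl
  have h6 : smap (weilD b) LinearMap.id (lThetaCoeff g b) =
      ∑ a, tm (tgen a) (lgen b (b a)) -
      (2⁻¹ : ℝ) • ∑ p, ∑ q, tm (theta b p * theta b q) (lgen b ⁅b p, b q⁆) := by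
    have e : ∀ a, weilD b (theta b a) = tgen a -
        (2⁻¹ : ℝ) • ∑ p, ∑ q, b.coord a ⁅b p, b q⁆ • (theta b p * theta b q) := fun a => by
      conv_rhs => rw [tgen_eq b]
      rw [theta, weilD_thetaOf, add_sub_cancel_right]
    simp only [lThetaCoeff, map_sum, smap_tm, e, sub_tm, smul_tm, sum_tm, Finset.sum_sub_distrib,
      LinearMap.id_apply, ← Finset.smul_sum, h5]
    rw [Finset.sum_comm]
    congr 2
    exact Finset.sum_congr rfl fun p _ => Finset.sum_comm
  rw [h4, h6, sub_add_cancel]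

theorem lTheta_eq : lTheta b = PowerSeries.C (lThetaCoeff g b) := rfl

theorem coeff_totalD (φ : PowerSeries (STensor (Weil g ι) (UD b))) (n : ℕ) :
    PowerSeries.coeff n (totalD b φ) =
    smap (weilD b) LinearMap.id (PowerSeries.coeff n φ) +
      smap (sg _) (udD b) (PowerSeries.coeff (n + 1) φ) := PowerSeries.coeff_mk _ _

/-- The Maurer-Cartan equation for `-i(t) + l(θ)`. -/
theorem totalD_maurerCartan : totalD b (-iT b + lTheta b) =
    -((-iT b + lTheta b) * (-iT b + lTheta b)) := by
  have hmul : (-iT b + lTheta b) * (-iT b + lTheta b) =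
      iT b * iT b - iT b * lTheta b - lTheta b * iT b + lTheta b * lTheta b := by noncomm_ring
  ext n
  rw [hmul, coeff_totalD, iT_eq_placeSeries, lTheta_eq, ← map_mul]
  simp only [map_neg, map_add, map_sub, PowerSeries.coeff_C_mul, PowerSeries.coeff_mul_C,
    PowerSeries.coeff_C]
  obtain ⟨m, rfl | rfl⟩ := Nat.even_or_odd' n
  · rw [coeff_placeSeries_odd, coeff_placeSeries_even, smap_udD_place]
    cases m with
    -- In degree zero, the curvature `l(t)` of `l(θ)` is cancelled by `d I(x) = l(x)` applied to the
    -- linear term of `i(t)`.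
    | zero =>
      have h0 : PowerSeries.coeff (2 * 0) (placeSeries g (Igen b) * placeSeries g (Igen b)) = 0 := by
        rw [mul_zero, PowerSeries.coeff_mul]
        have := coeff_placeSeries_even (g := g) (Igen b) 0
        simp_all
      have h1 := smap_weilD_lThetaCoeff b
      rw [h0]
      simp [place_Igen_one b, Finset.Nat.antidiagonal_succ, ← h1]
    | succ m =>
      -- The two end terms of the sum contain `I(1) = 0`; the interior terms, with both indices
      -- shifted by one, form the square of `i(t)`.
      rw [show 2 * (m + 1) = 2 * m + 2 by ring, coeff_placeSeries_mul_self_even,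
        Finset.Nat.antidiagonal_succ_succ']
      simp [place_Igen_one b]
  -- In odd degree only the anticommutator of `i(t)` with `l(θ)` survives.
  · have h := smap_weilD_place b (m + 1)
    rw [show 2 * m + 1 + 1 = 2 * (m + 1) by ring, coeff_placeSeries_odd, coeff_placeSeries_even,
      coeff_placeSeries_mul_self_odd]
    simp
    rw [← sub_eq_zero, ← neg_eq_zero, ← h]
    abel

end maurerCartan

section euler
variable {g : Type*} [LieRing g] [LieAlgebra ℝ g] {ι : Type*} [Fintype ι] (b : Module.Basis ι ℝ g)

/-! ### The differential equation `E X = X h` -/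

section equation
variable {B : Type*} [Ring B] [Algebra ℝ B] [SuperAlg B]

variable (B) in
/-- The Euler operator on the completion of `Wg ⊗ B`. -/
def eul (φ : PowerSeries (STensor (Weil g ι) B)) : PowerSeries (STensor (Weil g ι) B) :=
  cmap (smap (weilE b) LinearMap.id) φ

variable (g ι B) in
/-- The augmentation of `Wg` on `Wg ⊗ B`. -/
abbrev aug : STensor (Weil g ι) B →ₗ[ℝ] STensor (Weil g ι) B :=
  smap (weilP g ι).toLinearMap LinearMap.id

theorem aug_mul (x y : STensor (Weil g ι) B) : aug g ι B (x * y) = aug g ι B x * aug g ι B y :=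
  smap_mul (weilP g ι) (AlgHom.id ℝ B) weilP_σ (fun _ => rfl) x y

theorem aug_one : aug g ι B 1 = 1 := smap_one _ _ (map_one (weilP g ι)) rfl

theorem eul_mul (φ ψ : PowerSeries (STensor (Weil g ι) B)) :
    eul b B (φ * ψ) = eul b B φ * ψ + φ * eul b B ψ := by
  have h := cmap_der ((weilE_isDer b).smap_left_even (B := B) (weilE_σ b)) φ ψ
  have hid : cmap LinearMap.id φ = φ := by ext n; rw [coeff_cmap]; rfl
  rwa [hid] at h

theorem smap_weilG_weilE (x : STensor (Weil g ι) B) :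
    smap (weilG b) LinearMap.id (smap (weilE b) LinearMap.id x) = x - aug g ι B x := by
  rw [smap_smap]
  conv_rhs => rw [← smap_id x]
  rw [aug, smap_smap, ← LinearMap.sub_apply, LinearMap.id_comp, LinearMap.comp_id, ← smap_sub_left]
  congr 2
  ext w
  exact weilG_weilE b w

theorem smap_weilE_weilG (x : STensor (Weil g ι) B) :
    smap (weilE b) LinearMap.id (smap (weilG b) LinearMap.id x) = x - aug g ι B x := by
  rw [smap_smap]
  conv_rhs => rw [← smap_id x]
  rw [aug, smap_smap, ← LinearMap.sub_apply, LinearMap.id_comp, LinearMap.comp_id, ← smap_sub_left]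
  congr 2
  ext w
  exact weilE_weilG b w

theorem aug_weilG (x : STensor (Weil g ι) B) : aug g ι B (smap (weilG b) LinearMap.id x) = 0 := by
  rw [smap_smap, show (weilP g ι).toLinearMap ∘ₗ weilG b = 0 from
    LinearMap.ext fun w => weilP_weilG b w, smap_zero_left, LinearMap.zero_apply]

/-- As `h` has no constant term, the `n`-th coefficient of `X h` involves only earlier coefficients
of `X`. By induction `E X_n = 0`, and the Euler operator is injective on the augmentation ideal. -/
theorem eul_eq_zero {X h : PowerSeries (STensor (Weil g ι) B)}
    (h0 : PowerSeries.coeff 0 h = 0) (hX : eul b B X = X * h) (hP : cmap (aug g ι B) X = 0) :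
    X = 0 := by
  ext n
  rw [map_zero]
  induction n using Nat.strong_induction_on with
  | _ n ih =>
    have h1 : PowerSeries.coeff n (X * h) = 0 := by
      rw [PowerSeries.coeff_mul]
      refine Finset.sum_eq_zero fun p hp => ?_
      rw [Finset.HasAntidiagonal.mem_antidiagonal] at hp
      by_cases hp2 : p.2 = 0
      · rw [hp2, h0, mul_zero]
      · rw [ih p.1 (by omega), zero_mul]
    rw [← hX, eul, coeff_cmap] at h1
    have h2 := smap_weilG_weilE b (PowerSeries.coeff n X)
    rw [h1, map_zero, ← coeff_cmap, hP, map_zero, sub_zero] at h2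
    exact h2.symm

theorem eul_unique {X Y h : PowerSeries (STensor (Weil g ι) B)}
    (h0 : PowerSeries.coeff 0 h = 0) (hX : eul b B X = X * h) (hY : eul b B Y = Y * h)
    (hP : cmap (aug g ι B) X = cmap (aug g ι B) Y) : X = Y := by
  refine sub_eq_zero.mp (eul_eq_zero b h0 ?_ ?_)
  · rw [eul] at *
    rw [cmap_sub, hX, hY, sub_mul]
  · rw [cmap_sub, hP, sub_self]

/-- The coefficients of the solution of `E X = X h` with constant coefficient `1`. -/
def solCoeff (h : PowerSeries (STensor (Weil g ι) B)) : ℕ → STensor (Weil g ι) B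
  | 0 => 1
  | n + 1 => smap (weilG b) LinearMap.id
      (∑ i : Fin (n + 1), solCoeff h i * PowerSeries.coeff (n + 1 - i) h)

/-- The solution of `E X = X h` with constant coefficient `1`. -/
def sol (h : PowerSeries (STensor (Weil g ι) B)) : PowerSeries (STensor (Weil g ι) B) :=
  PowerSeries.mk (solCoeff b h)

theorem coeff_zero_sol (h : PowerSeries (STensor (Weil g ι) B)) :
    PowerSeries.coeff 0 (sol b h) = 1 := by
  rw [sol, PowerSeries.coeff_mk, solCoeff]

theorem coeff_succ_sol {h : PowerSeries (STensor (Weil g ι) B)} (h0 : PowerSeries.coeff 0 h = 0)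
    (n : ℕ) : PowerSeries.coeff (n + 1) (sol b h) =
      smap (weilG b) LinearMap.id (PowerSeries.coeff (n + 1) (sol b h * h)) := by
  rw [PowerSeries.coeff_mul, Finset.Nat.sum_antidiagonal_eq_sum_range_succ
    (fun i j => PowerSeries.coeff i (sol b h) * PowerSeries.coeff j h), Finset.sum_range_succ,
    Nat.sub_self, h0, mul_zero, add_zero, Finset.sum_range]
  simp only [sol, PowerSeries.coeff_mk]
  rw [solCoeff]

theorem aug_sol {h : PowerSeries (STensor (Weil g ι) B)} (h0 : PowerSeries.coeff 0 h = 0) :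
    cmap (aug g ι B) (sol b h) = 1 := by
  ext n
  rw [coeff_cmap, PowerSeries.coeff_one]
  cases n with
  | zero => rw [coeff_zero_sol, if_pos rfl, aug_one]
  | succ n => rw [coeff_succ_sol b h0, aug_weilG, if_neg (Nat.succ_ne_zero n)]

/-- The recursion inverts `E` on the augmentation ideal, where `X h` lies because `h` has
augmentation zero. -/
theorem eul_sol {h : PowerSeries (STensor (Weil g ι) B)} (h0 : PowerSeries.coeff 0 h = 0)
    (hP : cmap (aug g ι B) h = 0) : eul b B (sol b h) = sol b h * h := by
  ext n
  rw [eul, coeff_cmap]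
  cases n with
  | zero =>
    rw [coeff_zero_sol, PowerSeries.coeff_mul, Finset.Nat.antidiagonal_zero, Finset.sum_singleton, h0,
      mul_zero, ((weilE_isDer b).smap_left_even (weilE_σ b)).map_one rfl]
  | succ n =>
    rw [coeff_succ_sol b h0, smap_weilE_weilG, ← coeff_cmap, cmap_mul _ aug_mul, hP, mul_zero,
      map_zero, sub_zero]

end equation

/-! ### The right hand side `h` of the differential equation -/

theorem weilK_weilK (w : Weil g ι) : weilK b (weilK b w) = 0 := by
  have h := ((weilK_isDer b).anticommutator (weilK_isDer b) (weilK_σ b)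
    (weilK_σ b)).eq_zero_of_generators rfl
    (fun a => by simp [weilK_tgen, theta, weilK_thetaOf]) (fun ξ => by simp [weilK_thetaOf])
  have h' := LinearMap.congr_fun h w
  rw [LinearMap.add_apply, LinearMap.comp_apply, LinearMap.zero_apply, ← two_smul ℝ] at h'
  exact (smul_eq_zero.mp h').resolve_left two_ne_zero

theorem weilP_weilK (w : Weil g ι) : weilP g ι (weilK b w) = 0 :=
  weilP_of_commute b ((weilK_isDer b).map_one sg_one) (fun w => by simp [weilE, weilK_weilK]) w

section hSeries
variable {B B' : Type*} [Ring B] [Algebra ℝ B] [SuperAlg B] [Ring B'] [Algebra ℝ B'] [SuperAlg B']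

/-- The contraction of `-i(t)` by the homotopy of `Wg`. -/
def hSeries (I : MvPolynomial ι ℝ →ₗ[ℝ] B) : PowerSeries (STensor (Weil g ι) B) :=
  -cmap (smap (weilK b) LinearMap.id) (placeSeries g I)

theorem coeff_hSeries (I : MvPolynomial ι ℝ →ₗ[ℝ] B) (n : ℕ) :
    PowerSeries.coeff n (hSeries b I) = if Odd n then
      -smap (weilK b) LinearMap.id (place g I (canon ι ^ ((n + 1) / 2))) else 0 := by
  rw [hSeries, map_neg, coeff_cmap, coeff_placeSeries]
  split_ifs <;> simp

theorem coeff_zero_hSeries (I : MvPolynomial ι ℝ →ₗ[ℝ] B) :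
    PowerSeries.coeff 0 (hSeries b I) = 0 := by
  rw [coeff_hSeries, if_neg (by simp)]

theorem aug_hSeries (I : MvPolynomial ι ℝ →ₗ[ℝ] B) : cmap (aug g ι B) (hSeries b I) = 0 := by
  rw [hSeries, cmap_neg, cmap_cmap]
  have h : aug g ι B ∘ₗ smap (weilK b) LinearMap.id = 0 :=
    stensor_ext fun w u => by
      rw [LinearMap.comp_apply, smap_tm, smap_tm, AlgHom.toLinearMap_apply, weilP_weilK, zero_tm]
      rfl
  rw [h]
  ext n
  simp [coeff_cmap]

theorem cmap_hSeries (f : B →ₗ[ℝ] B') (I : MvPolynomial ι ℝ →ₗ[ℝ] B) :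
    cmap (smap LinearMap.id f) (hSeries b I) = hSeries b (f ∘ₗ I) := by
  rw [hSeries, hSeries, cmap_neg, ← cmap_placeSeries, cmap_cmap, cmap_cmap]
  congr 2
  exact stensor_ext fun _ _ => rfl

theorem hSeries_add (I I' : MvPolynomial ι ℝ →ₗ[ℝ] B) :
    hSeries b (I + I') = hSeries b I + hSeries b I' := by
  ext n
  rw [map_add, coeff_hSeries, coeff_hSeries, coeff_hSeries]
  split_ifs
  · rw [place_add, map_add, neg_add]
  · rw [add_zero]

end hSeries

variable (ι) in
/-- The map `S g → S⁺g ⊂ U(L(S⁺g))`. -/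
def plusGen : MvPolynomial ι ℝ →ₗ[ℝ] UL ι := TensorAlgebra.ι ℝ ∘ₗ toPlus

theorem ulToUd_comp_plusGen : (ulToUd b).toLinearMap ∘ₗ plusGen ι = Igen b := by
  refine LinearMap.ext fun p => ?_
  exact (ulToUd_ι b (toPlus p)).trans (Igen_toPlus b p)

/-- The element `Φ`: the solution of `E Φ = Φ h`. -/
def phi : PowerSeries (STensor (Weil g ι) (UL ι)) := sol b (hSeries b (plusGen ι))

theorem aug_phi : cmap (aug g ι (UL ι)) (phi b) = 1 := aug_sol b (coeff_zero_hSeries b _)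

theorem eul_phi : eul b (UL ι) (phi b) = phi b * hSeries b (plusGen ι) :=
  eul_sol b (coeff_zero_hSeries b _) (aug_hSeries b _)

section push
variable {B : Type*} [Ring B] [Algebra ℝ B] [SuperAlg B] (f : UL ι →ₐ[ℝ] B)

theorem push_mul (hf : ∀ u, f (SuperAlg.σ u) = SuperAlg.σ (f u))
    (φ ψ : PowerSeries (STensor (Weil g ι) (UL ι))) :
    cmap (smap LinearMap.id f.toLinearMap) (φ * ψ) =
      cmap (smap LinearMap.id f.toLinearMap) φ * cmap (smap LinearMap.id f.toLinearMap) ψ :=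
  cmap_mul _ (smap_mul (AlgHom.id ℝ (Weil g ι)) f (fun _ => rfl) hf) φ ψ

theorem push_one : cmap (smap LinearMap.id f.toLinearMap)
    (1 : PowerSeries (STensor (Weil g ι) (UL ι))) = 1 :=
  cmap_one _ (smap_one _ _ rfl (map_one f))

/-- `E` acts on the Weil factor only and so commutes with `id ⊗ f`; multiplicativity carries the
equation over, with `h` replaced by its image. Each comparison of `Φ` with another element starts
from such an image. -/
theorem eul_push_phi (hf : ∀ u, f (SuperAlg.σ u) = SuperAlg.σ (f u)) :
    eul b B (cmap (smap LinearMap.id f.toLinearMap) (phi b)) =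
      cmap (smap LinearMap.id f.toLinearMap) (phi b) *
        hSeries b (f.toLinearMap ∘ₗ plusGen ι) := by
  have h : eul b B (cmap (smap LinearMap.id f.toLinearMap) (phi b)) =
      cmap (smap LinearMap.id f.toLinearMap) (eul b (UL ι) (phi b)) := by
    ext n
    simp only [eul, coeff_cmap, smap_smap]
    rfl
  rw [h, eul_phi, push_mul f hf, cmap_hSeries]

theorem aug_push_phi : cmap (aug g ι B) (cmap (smap LinearMap.id f.toLinearMap) (phi b)) = 1 := by
  rw [← push_one f, ← aug_phi b, cmap_cmap, cmap_cmap]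
  ext n
  simp only [coeff_cmap, LinearMap.comp_apply, smap_smap]
  rfl

end push

/-! ### Degrees -/

theorem one_mem_ulDeg : (1 : UL ι) ∈ ulDeg ι 0 :=
  Submodule.subset_span ⟨[], by simp, rfl, rfl⟩

theorem mul_mem_ulDeg {m n : ℕ} {u v : UL ι} (hu : u ∈ ulDeg ι m) (hv : v ∈ ulDeg ι n) :
    u * v ∈ ulDeg ι (m + n) := by
  have h : ulDeg ι m * ulDeg ι n ≤ ulDeg ι (m + n) := by
    rw [ulDeg, ulDeg, Submodule.span_mul_span]
    refine Submodule.span_le.mpr ?_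
    rintro _ ⟨_, ⟨w, hw, hm, rfl⟩, _, ⟨w', hw', hn, rfl⟩, rfl⟩
    refine Submodule.subset_span ⟨w ++ w', fun p hp => ?_, ?_, ?_⟩
    · rcases List.mem_append.mp hp with hp | hp
      · exact hw p hp
      · exact hw' p hp
    · rw [List.map_append, List.sum_append, hm, hn]
    · rw [List.map_append, List.prod_append]
  exact h (Submodule.mul_mem_mul hu hv)

theorem plusGen_mem_ulDeg {p : MvPolynomial ι ℝ} {k : ℕ} (hp : p.IsHomogeneous (k + 1)) :
    plusGen ι p ∈ ulDeg ι (2 * k + 1) := by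
  have h : (toPlus p : MvPolynomial ι ℝ) = p := by
    rw [coe_toPlus, hp.coeff_eq_zero (by simp), map_zero, sub_zero]
  refine Submodule.subset_span ⟨[(k + 1, toPlus p)], ?_, ?_, ?_⟩
  · intro q hq
    rw [List.mem_singleton] at hq
    subst hq
    exact ⟨Nat.le_add_left 1 k, by rw [h]; exact hp⟩
  · simp; omega
  · simp [plusGen]

theorem σ_of_mem_ulDeg {n : ℕ} {u : UL ι} (hu : u ∈ ulDeg ι n) :
    SuperAlg.σ u = (-1 : ℝ) ^ n • u := by
  induction hu using Submodule.span_induction with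
  | mem u hu =>
    obtain ⟨w, hw, rfl, rfl⟩ := hu
    induction w with
    | nil => simp
    | cons p w ih =>
      have h1 := (hw p List.mem_cons_self).1
      -- `p.1 ≥ 1` makes the truncated subtraction genuine, so the exponent is odd.
      have h2 : (-1 : ℝ) ^ (2 * p.1 - 1) = -1 := Odd.neg_one_pow ⟨p.1 - 1, by omega⟩
      rw [List.map_cons, List.prod_cons, map_mul, σ_ι, ih fun q hq => hw q (List.mem_cons_of_mem _ hq),
        List.map_cons, List.sum_cons, pow_add, h2, neg_one_mul, neg_smul, mul_smul_comm, neg_mul,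
        smul_neg]
  | zero => simp
  | add x y _ _ hx hy => rw [map_add, hx, hy, smul_add]
  | smul c x _ hx => rw [map_smul, hx, smul_comm]

theorem σ_of_mem_weilDeg (b : Module.Basis ι ℝ g) {n : ℕ} {w : Weil g ι} (hw : w ∈ weilDeg g ι n) :
    SuperAlg.σ w = (-1 : ℝ) ^ n • w := by
  rw [← wordSpan_eq_weilDeg b] at hw
  induction hw using Submodule.span_induction with
  | mem w hw =>
    obtain ⟨m, hw⟩ := hw
    induction hw with
    | one => simp
    | theta m n w a _ h =>
      rw [map_mul, h, theta, σ_thetaOf, pow_succ, mul_neg_one, neg_smul, mul_smul_comm, neg_mul,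
        smul_neg]
    | dtheta m n w a _ h =>
      rw [map_mul, h, σ_weilDTheta, mul_smul_comm, pow_add, neg_one_sq, mul_one]
  | zero => simp
  | add x y _ _ hx hy => rw [map_add, hx, hy, smul_add]
  | smul c x _ hx => rw [map_smul, hx, smul_comm]

theorem sg_pow_apply {A : Type*} [Ring A] [Algebra ℝ A] [SuperAlg A] {x : A} {i : ℕ}
    (hx : SuperAlg.σ x = (-1 : ℝ) ^ i • x) (j : ℕ) :
    (sg A ^ j) x = ((-1 : ℝ) ^ i) ^ j • x := by
  induction j with
  | zero => simp
  | succ j ih =>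
    rw [pow_succ, Module.End.mul_apply, AlgHom.toLinearMap_apply, hx, map_smul, ih, smul_smul,
      pow_succ']

theorem tm_mul_tm {A B : Type*} [Ring A] [Algebra ℝ A] [SuperAlg A] [Ring B] [Algebra ℝ B]
    [SuperAlg B] (a a' : A) {u : B} (u' : B) {i : ℕ} (hu : SuperAlg.σ u = (-1 : ℝ) ^ i • u) :
    tm a u * tm a' u' = tm (a * (sg A ^ i) a') (u * u') := by
  have hsq : sg A ^ 2 = 1 := by
    rw [pow_two]
    exact LinearMap.ext fun x => SuperAlg.σ_σ x
  obtain ⟨k, rfl | rfl⟩ := Nat.even_or_odd' i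
  · rw [Even.neg_one_pow (even_two_mul k), one_smul] at hu
    rw [tm_mul_of_even _ _ _ hu, pow_mul, hsq, one_pow, Module.End.one_apply]
  · rw [Odd.neg_one_pow (odd_two_mul_add_one k), neg_one_smul] at hu
    rw [tm_mul_of_odd _ _ _ hu, pow_add, pow_mul, hsq, one_pow, pow_one, one_mul]
    rfl

variable (g ι) in
/-- The part of `Wg ⊗ U(L(S⁺g))` of bidegree `(n, -n)`. -/
def degZero (n : ℕ) : Submodule ℝ (STensor (Weil g ι) (UL ι)) :=
  Submodule.span ℝ {z | ∃ w ∈ weilDeg g ι n, ∃ u ∈ ulDeg ι n, z = tm w u}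

/-- On homogeneous tensors the sign rule yields only a scalar, so the product is again a multiple of
a pure tensor of opposite degrees. -/
theorem mul_mem_degZero (b : Module.Basis ι ℝ g) {m n : ℕ} {x y : STensor (Weil g ι) (UL ι)} (hx : x ∈ degZero g ι m)
    (hy : y ∈ degZero g ι n) : x * y ∈ degZero g ι (m + n) := by
  have h : degZero g ι m * degZero g ι n ≤ degZero g ι (m + n) := by
    rw [degZero, degZero, Submodule.span_mul_span]
    refine Submodule.span_le.mpr ?_
    rintro _ ⟨_, ⟨w, hw, u, hu, rfl⟩, _, ⟨w', hw', u', hu', rfl⟩, rfl⟩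
    change tm w u * tm w' u' ∈ _
    rw [tm_mul_tm _ _ _ (σ_of_mem_ulDeg hu), sg_pow_apply (σ_of_mem_weilDeg b hw'), mul_smul_comm,
      smul_tm]
    exact Submodule.smul_mem _ _ (Submodule.subset_span
      ⟨_, mul_mem_weilDeg hw hw', _, mul_mem_ulDeg hu hu', rfl⟩)
  exact h (Submodule.mul_mem_mul hx hy)

theorem smap_weilG_mem_degZero {n : ℕ} {x : STensor (Weil g ι) (UL ι)} (hx : x ∈ degZero g ι n) :
    smap (weilG b) LinearMap.id x ∈ degZero g ι n := by
  have h : degZero g ι n ≤ (degZero g ι n).comap (smap (weilG b) LinearMap.id) := by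
    refine Submodule.span_le.mpr ?_
    rintro _ ⟨w, hw, u, hu, rfl⟩
    exact Submodule.subset_span ⟨_, weilG_mem_weilDeg b hw, u, hu, rfl⟩
  exact h hx

theorem weilKS_eq (s : MvPolynomial ι ℝ) :
    weilKS b s = ∑ a, wt (MvPolynomial.pderiv a s) 1 * theta b a := by
  classical
  have hs : ∀ (p q : MvPolynomial ι ℝ), (wt (p * q) 1 : Weil g ι) = p • wt q 1 := fun p q =>
    (smul_wt p q 1).symm
  induction s using MvPolynomial.induction_on with
  | C r => simp only [MvPolynomial.derivation_C, wt_zero_left, zero_mul, Finset.sum_const_zero]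
  | add p q hp hq => simp only [map_add, wt_add_left, add_mul, Finset.sum_add_distrib, hp, hq]
  | mul_X p c hp =>
    simp only [Derivation.leibniz, hp, smul_eq_mul, wt_add_left, hs, add_mul,
      Finset.sum_add_distrib, smul_mul_assoc, ← Finset.smul_sum]
    congr 2
    rw [weilKS, MvPolynomial.mkDerivation_X, Finset.sum_eq_single c]
    · rw [MvPolynomial.pderiv_X_self, wt_one_one, one_mul]
    · intro a _ ha
      rw [MvPolynomial.pderiv_X_of_ne ha.symm, wt_zero_left, zero_mul]
    · simp

theorem weilK_mem_weilDeg {s : MvPolynomial ι ℝ} {k : ℕ} (hs : s.IsHomogeneous (k + 1)) :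
    weilK b (wt s 1) ∈ weilDeg g ι (2 * k + 1) := by
  rw [weilK_wt_one, weilKS_eq]
  exact Submodule.sum_mem _ fun a _ =>
    mul_mem_weilDeg (wt_one_mem_weilDeg hs.pderiv) (thetaOf_mem_weilDeg _)

theorem coeff_hSeries_mem_degZero (n : ℕ) :
    PowerSeries.coeff n (hSeries b (plusGen ι)) ∈ degZero g ι n := by
  rw [coeff_hSeries]
  split_ifs with hn
  · obtain ⟨k, rfl⟩ := hn
    rw [show (2 * k + 1 + 1) / 2 = k + 1 by omega, canon_pow, map_sum, map_sum]
    refine Submodule.neg_mem _ (Submodule.sum_mem _ fun f _ => ?_)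
    rw [place_tmul, smap_tm]
    exact Submodule.subset_span ⟨_, weilK_mem_weilDeg b (isHomogeneous_prod_X f), _,
      plusGen_mem_ulDeg (isHomogeneous_prod_X f), rfl⟩
  · exact Submodule.zero_mem _

/-- The recursion multiplies by coefficients of `h`, which have total degree zero, and applies `G`,
which preserves the degree in `Wg`. -/
theorem coeff_phi_mem_degZero (n : ℕ) : PowerSeries.coeff n (phi b) ∈ degZero g ι n := by
  induction n using Nat.strong_induction_on with
  | _ n ih =>
    cases n with
    | zero =>
      rw [phi, coeff_zero_sol]
      exact Submodule.subset_span ⟨1, one_mem_weilDeg, 1, one_mem_ulDeg, rfl⟩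
    | succ n =>
      rw [phi, coeff_succ_sol b (coeff_zero_hSeries b _), PowerSeries.coeff_mul, ← phi]
      refine smap_weilG_mem_degZero b (Submodule.sum_mem _ fun p hp => ?_)
      rw [Finset.HasAntidiagonal.mem_antidiagonal] at hp
      by_cases h2 : p.2 = 0
      · rw [h2, coeff_zero_hSeries, mul_zero]
        exact Submodule.zero_mem _
      · have h := mul_mem_degZero b (ih p.1 (by omega)) (coeff_hSeries_mem_degZero b p.2)
        rwa [hp] at h

theorem isDegreeZero_phi : IsDegreeZero (phi b) := coeff_phi_mem_degZero b

theorem σ_of_mem_degZero (b : Module.Basis ι ℝ g) {n : ℕ} {x : STensor (Weil g ι) (UL ι)} (hx : x ∈ degZero g ι n) :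
    SuperAlg.σ x = x := by
  induction hx using Submodule.span_induction with
  | mem x hx =>
    obtain ⟨w, hw, u, hu, rfl⟩ := hx
    rw [σ_tm, σ_of_mem_weilDeg b hw, σ_of_mem_ulDeg hu, smul_tm, tm_smul, smul_smul, ← mul_pow,
      neg_one_mul, neg_neg, one_pow, one_smul]
  | zero => simp
  | add x y _ _ hx hy => rw [map_add, hx, hy]
  | smul c x _ hx => rw [map_smul, hx]

end euler

section properties
variable {g : Type*} [LieRing g] [LieAlgebra ℝ g] {ι : Type*} [Fintype ι] (b : Module.Basis ι ℝ g)

/-! ### `Φ` is group-like -/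

section groupLike
variable {A B : Type*} [Ring A] [Algebra ℝ A] [SuperAlg A] [Ring B] [Algebra ℝ B] [SuperAlg B]

variable (A B) in
/-- The inclusion `A → A ⊗ B`. -/
abbrev inL : A →ₐ[ℝ] STensor A B := GradedTensorProduct.includeLeft (parity A) (parity B)

variable (A B) in
/-- The inclusion `B → A ⊗ B`. -/
abbrev inR : B →ₐ[ℝ] STensor A B := GradedTensorProduct.includeRight (parity A) (parity B)

theorem inL_apply (a : A) : inL A B a = tm a 1 := rfl

theorem inR_apply (u : B) : inR A B u = tm 1 u := rfl

theorem inL_σ (a : A) : inL A B (SuperAlg.σ a) = SuperAlg.σ (inL A B a) := by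
  rw [inL_apply, inL_apply, σ_tm, map_one]

theorem inR_σ (u : B) : inR A B (SuperAlg.σ u) = SuperAlg.σ (inR A B u) := by
  rw [inR_apply, inR_apply, σ_tm, map_one]

end groupLike

theorem sg_pow_sg_pow {A : Type*} [Ring A] [Algebra ℝ A] [SuperAlg A] (i : ℕ) (x : A) :
    (sg A ^ i) ((sg A ^ i) x) = x := by
  have hsq : sg A * sg A = 1 := LinearMap.ext fun x => SuperAlg.σ_σ x
  rw [← Module.End.mul_apply, ← (Commute.refl (sg A)).mul_pow, hsq, one_pow, Module.End.one_apply]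

/-- Elements of total degree zero are even, and the two copies of `U(L(S⁺g))` commute up to sign.
Reordering the tensorands gives the sign `(-1)^(mn)` an even number of times. -/
theorem commute_of_mem_degZero (b : Module.Basis ι ℝ g) {m n : ℕ} {x y : STensor (Weil g ι) (UL ι)}
    (hx : x ∈ degZero g ι m) (hy : y ∈ degZero g ι n) :
    smap LinearMap.id (inL (UL ι) (UL ι)).toLinearMap x *
        smap LinearMap.id (inR (UL ι) (UL ι)).toLinearMap y =
      smap LinearMap.id (inR (UL ι) (UL ι)).toLinearMap y *
        smap LinearMap.id (inL (UL ι) (UL ι)).toLinearMap x := by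
  induction hx using Submodule.span_induction with
  | zero => simp
  | add x x' _ _ h h' => simp only [map_add, add_mul, mul_add, h, h']
  | smul c x _ h => simp only [map_smul, smul_mul_assoc, mul_smul_comm, h]
  | mem x hx =>
    obtain ⟨w, hw, u, hu, rfl⟩ := hx
    induction hy using Submodule.span_induction with
    | zero => simp
    | add x x' _ _ h h' => simp only [map_add, add_mul, mul_add, h, h']
    | smul c x _ h => simp only [map_smul, smul_mul_assoc, mul_smul_comm, h]
    | mem y hy =>
      obtain ⟨w', hw', u', hu', rfl⟩ := hy
      have hu1 := σ_of_mem_ulDeg hu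
      have hu2 := σ_of_mem_ulDeg hu'
      have h1 : SuperAlg.σ (tm u (1 : UL ι)) = (-1 : ℝ) ^ m • tm u (1 : UL ι) := by
        rw [σ_tm, hu1, map_one, smul_tm]
      have h2 : SuperAlg.σ (tm (1 : UL ι) u') = (-1 : ℝ) ^ n • tm (1 : UL ι) u' := by
        rw [σ_tm, hu2, map_one, tm_smul]
      have e1 : w * (sg _ ^ m) w' = w' * w := by
        rw [mul_comm_of_mem_weilDeg b hw, sg_pow_sg_pow]
      have e2 : tm u (1 : UL ι) * tm 1 u' = tm u u' := by
        rw [tm_mul_of_even _ _ _ (map_one _), mul_one, one_mul]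
      have e3 : tm (1 : UL ι) u' * tm u 1 = ((-1 : ℝ) ^ m) ^ n • tm u u' := by
        rw [tm_mul_tm _ _ _ hu2, mul_one, one_mul, sg_pow_apply hu1, smul_tm]
      have e4 : w' * (sg _ ^ n) w = ((-1 : ℝ) ^ m) ^ n • (w' * w) := by
        rw [sg_pow_apply (σ_of_mem_weilDeg b hw), mul_smul_comm]
      simp only [smap_tm, AlgHom.toLinearMap_apply, inL_apply, inR_apply, LinearMap.id_apply]
      rw [tm_mul_tm _ _ _ h1, tm_mul_tm _ _ _ h2, e1, e2, e3, e4, smul_tm, tm_smul, smul_smul,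
        ← mul_pow, ← mul_pow, neg_mul_neg, one_mul, one_pow, one_pow, one_smul]

theorem commute_hSeries_phi :
    hSeries b ((inL (UL ι) (UL ι)).toLinearMap ∘ₗ plusGen ι) *
        cmap (smap LinearMap.id (inR (UL ι) (UL ι)).toLinearMap) (phi b) =
      cmap (smap LinearMap.id (inR (UL ι) (UL ι)).toLinearMap) (phi b) *
        hSeries b ((inL (UL ι) (UL ι)).toLinearMap ∘ₗ plusGen ι) := by
  rw [← cmap_hSeries]
  ext n
  rw [PowerSeries.coeff_mul, PowerSeries.coeff_mul, ← Finset.Nat.sum_antidiagonal_swap]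
  refine Finset.sum_congr rfl fun p _ => ?_
  simp only [coeff_cmap, Prod.fst_swap, Prod.snd_swap]
  exact commute_of_mem_degZero b (coeff_hSeries_mem_degZero b _) (coeff_phi_mem_degZero b _)

/-- The generators are primitive, so the coproduct turns `h` into `h₁ + h₂`. With `Φ₁`, `Φ₂` the two
copies of `Φ`, `E(Φ₁Φ₂) = Φ₁h₁Φ₂ + Φ₁Φ₂h₂`, and `h₁` commutes past `Φ₂`. Both sides have
augmentation `1`, so uniqueness applies. -/
theorem comul_phi :
    cmap (smap LinearMap.id ulComul.toLinearMap) (phi b) =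
      cmap (smap LinearMap.id (inL (UL ι) (UL ι)).toLinearMap) (phi b) *
        cmap (smap LinearMap.id (inR (UL ι) (UL ι)).toLinearMap) (phi b) := by
  have hc : (ulComul (ι := ι)).toLinearMap ∘ₗ plusGen ι =
      (inL (UL ι) (UL ι)).toLinearMap ∘ₗ plusGen ι +
        (inR (UL ι) (UL ι)).toLinearMap ∘ₗ plusGen ι :=
    LinearMap.ext fun p => ulComul_ι (toPlus p)
  refine eul_unique b (coeff_zero_hSeries b ((ulComul (ι := ι)).toLinearMap ∘ₗ plusGen ι))
    (eul_push_phi b ulComul ulComul_σ) ?_ ?_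
  · rw [eul_mul, eul_push_phi b _ inL_σ, eul_push_phi b _ inR_σ, hc, hSeries_add, mul_assoc,
      commute_hSeries_phi, mul_add, mul_assoc, mul_assoc]
  · rw [cmap_mul _ aug_mul, aug_push_phi, aug_push_phi, aug_push_phi, mul_one]

theorem weilCounit_tm (w : Weil g ι) (u : UL ι) :
    weilCounit (tm w u) = TensorAlgebra.algebraMapInv u • w :=
  rfl

theorem algebraMapInv_of_mem_ulDeg {n : ℕ} (hn : n ≠ 0) {u : UL ι} (hu : u ∈ ulDeg ι n) :
    TensorAlgebra.algebraMapInv u = (0 : ℝ) := by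
  induction hu using Submodule.span_induction with
  | mem u hu =>
    obtain ⟨w, -, rfl, rfl⟩ := hu
    cases w with
    | nil => exact absurd rfl hn
    | cons p w => simp [TensorAlgebra.algebraMapInv]
  | zero => rw [map_zero]
  | add x y _ _ hx hy => rw [map_add, hx, hy, add_zero]
  | smul c x _ hx => rw [map_smul, hx, smul_zero]

theorem isGroupLike_phi : IsGroupLike (phi b) := by
  refine ⟨comul_phi b, ?_⟩
  ext n
  rw [coeff_cmap, PowerSeries.coeff_one]
  split_ifs with hn
  · subst hn
    rw [phi, coeff_zero_sol, ← tm_one_one, weilCounit_tm, map_one, one_smul]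
  -- For `n > 0` the second tensorand has nonzero degree, and the counit kills it.
  · have h := coeff_phi_mem_degZero b n
    generalize PowerSeries.coeff n (phi b) = x at h ⊢
    induction h using Submodule.span_induction with
    | mem x hx =>
      obtain ⟨w, -, u, hu, rfl⟩ := hx
      rw [weilCounit_tm, algebraMapInv_of_mem_ulDeg hn hu, zero_smul]
    | zero => rw [map_zero]
    | add x y _ _ hx hy => rw [map_add, hx, hy, add_zero]
    | smul c x _ hx => rw [map_smul, hx, smul_zero]

/-! ### `Φ` is invariant -/

/-- The diagonal action of `g` on `Wg ⊗ U(L(S⁺g))`. -/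
def diagLie (x : g) : STensor (Weil g ι) (UL ι) →ₗ[ℝ] STensor (Weil g ι) (UL ι) :=
  smap (weilLie b x) LinearMap.id + smap LinearMap.id (ulLie b x)

theorem diagLie_isDer (x : g) : IsDer LinearMap.id (diagLie b x) :=
  ((weilLie_isDer b x).smap_left_even (weilLie_σ b x)).add
    ((ulLie_isDer b x).smap_right_even (ulLie_σ b x))

theorem ulLie_plusGen (x : g) (p : MvPolynomial ι ℝ) :
    ulLie b x (plusGen ι p) = plusGen ι (adS b x p) := by
  have h : adPlus b x (toPlus p) = toPlus (adS b x p) := by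
    apply Subtype.ext
    rw [coe_adPlus, coe_toPlus, coe_toPlus, map_sub, MvPolynomial.derivation_C, adS_coeff_zero,
      map_zero]
  rw [plusGen, LinearMap.comp_apply, ulLie_ι, h]
  rfl

/-- The homotopy commutes with the action, so the invariance of the canonical element passes to `h`.
-/
theorem diagLie_hSeries (x : g) : cmap (diagLie b x) (hSeries b (plusGen ι)) = 0 := by
  have h : ∀ z : MvPolynomial ι ℝ ⊗[ℝ] MvPolynomial ι ℝ,
      diagLie b x (smap (weilK b) LinearMap.id (place g (plusGen ι) z)) =
        smap (weilK b) LinearMap.id (place g (plusGen ι) (coadAd b x z)) := fun z => by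
    induction z using TensorProduct.induction_on with
    | zero => simp only [map_zero]
    | add z z' h h' => simp only [map_add, h, h']
    | tmul s p =>
      rw [coadAd_tmul, map_add, map_add, place_tmul, place_tmul, place_tmul, smap_tm, smap_tm,
        smap_tm, diagLie, LinearMap.add_apply, smap_tm, smap_tm, weilLie_weilK, weilLie_wt_one]
      simp only [LinearMap.id_apply, ulLie_plusGen]
  ext n
  rw [coeff_cmap, coeff_hSeries]
  split_ifs
  · rw [map_neg, h, coadAd_canon_pow, map_zero, map_zero, neg_zero, map_zero]
  · rw [map_zero, map_zero]

theorem isInvariant_phi : IsInvariant b (phi b) := by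
  intro x
  change cmap (diagLie b x) (phi b) = 0
  have hE : eul b (UL ι) (cmap (diagLie b x) (phi b)) =
      cmap (diagLie b x) (eul b (UL ι) (phi b)) := by
    rw [eul, eul, cmap_cmap, cmap_cmap]
    congr 1
    refine stensor_ext fun w u => ?_
    simp only [LinearMap.comp_apply, diagLie, LinearMap.add_apply, smap_tm, map_add,
      LinearMap.id_apply, weilE_weilLie]
  refine eul_eq_zero b (coeff_zero_hSeries b (plusGen ι)) ?_ ?_
  · rw [hE, eul_phi, cmap_der (diagLie_isDer b x), diagLie_hSeries, mul_zero, add_zero]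
  -- After augmentation only the action on `U(L(S⁺g))` remains, and it kills the augmentation `1` of
  -- `Φ`.
  · have h : aug g ι (UL ι) ∘ₗ diagLie b x = smap LinearMap.id (ulLie b x) ∘ₗ aug g ι (UL ι) := by
      refine stensor_ext fun w u => ?_
      simp only [LinearMap.comp_apply, diagLie, LinearMap.add_apply, smap_tm, map_add,
        LinearMap.id_apply, AlgHom.toLinearMap_apply, weilP_weilLie, zero_tm, zero_add]
    rw [cmap_cmap, h, ← cmap_cmap, aug_phi]
    ext n
    rw [coeff_cmap, PowerSeries.coeff_one, map_zero]
    split_ifs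
    · rw [← tm_one_one, smap_tm, (ulLie_isDer b x).map_one rfl, tm_zero]
    · rw [map_zero]

/-! ### `Φ` generalizes the Kalkman element -/

variable (g) in
/-- The element `-I(θ)`. -/
def negITheta : STensor (Weil g ι) (ExteriorAlgebra ℝ g) :=
  -∑ a, tm (theta b a) (ExteriorAlgebra.ι ℝ (b a))

theorem coeff_kalkman (n : ℕ) : PowerSeries.coeff n (kalkman b) =
    (n.factorial : ℝ)⁻¹ • negITheta g b ^ n := PowerSeries.coeff_mk _ _

/-- Only `k = 1` survives the projection, and `K t^a = θ^a`; so the right hand side becomes `-I(θ)`,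
placed in degree one. -/
theorem hSeries_ulToExt : hSeries b ((ulToExt b).toLinearMap ∘ₗ plusGen ι) =
    PowerSeries.monomial 1 (negITheta g b) := by
  have h1 : (ulToExt b).toLinearMap ∘ₗ plusGen ι = ExteriorAlgebra.ι ℝ ∘ₗ linPart b := by
    refine LinearMap.ext fun p => ?_
    have h0 : linPart b (toPlus p : MvPolynomial ι ℝ) = linPart b p := by
      rw [coe_toPlus, map_sub,
        linPart_of_homogeneous b (MvPolynomial.isHomogeneous_C _ _) zero_ne_one, sub_zero]
    exact (ulToExt_ι b (toPlus p)).trans (congrArg _ h0)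
  ext n
  rw [coeff_hSeries, h1, place_comp, map_linPart_canon_pow, PowerSeries.coeff_monomial]
  by_cases hn : n = 1
  · subst hn
    rw [if_pos odd_one, if_pos rfl, if_pos rfl, map_sum, map_sum, negITheta, neg_inj]
    refine Finset.sum_congr rfl fun a _ => ?_
    rw [place_tmul, smap_tm, ← tgen, weilK_tgen]
    rfl
  · rw [if_neg hn]
    split_ifs with h2 h3
    · obtain ⟨k, rfl⟩ := h2
      omega
    · rw [map_zero, map_zero, neg_zero]
    · rfl

theorem smap_weilE_negITheta_pow (n : ℕ) :
    smap (weilE b) LinearMap.id (negITheta g b ^ n) = (n : ℝ) • negITheta g b ^ n := by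
  have hE := (weilE_isDer b).smap_left_even (B := ExteriorAlgebra ℝ g) (weilE_σ b)
  have h1 : smap (weilE b) LinearMap.id (negITheta g b) = negITheta g b := by
    simp only [negITheta, map_neg, map_sum, smap_tm, theta, weilE_thetaOf, LinearMap.id_apply]
  induction n with
  | zero => rw [pow_zero, hE.map_one rfl, Nat.cast_zero, zero_smul]
  | succ n ih =>
    rw [pow_succ, hE, ih, h1, LinearMap.id_apply, Nat.cast_add, Nat.cast_one, add_smul, one_smul,
      smul_mul_assoc]

/-- `E` multiplies the `n`-th power of `-I(θ)` by `n`, one for each `θ`. This turns `1/n!` into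
`1/(n-1)!`, as in the derivative of an exponential. -/
theorem eul_kalkman : eul b _ (kalkman b) =
    kalkman b * hSeries b ((ulToExt b).toLinearMap ∘ₗ plusGen ι) := by
  ext n
  rw [eul, coeff_cmap, coeff_kalkman, map_smul, smap_weilE_negITheta_pow]
  cases n with
  | zero =>
    rw [PowerSeries.coeff_mul, Finset.Nat.antidiagonal_zero, Finset.sum_singleton, coeff_zero_hSeries,
      mul_zero, Nat.cast_zero, zero_smul, smul_zero]
  | succ n =>
    rw [PowerSeries.coeff_mul, Finset.sum_eq_single (n, 1)]
    · rw [hSeries_ulToExt, PowerSeries.coeff_monomial, if_pos rfl, coeff_kalkman, smul_mul_assoc,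
        ← pow_succ, smul_smul]
      congr 1
      rw [Nat.factorial_succ, Nat.cast_mul]
      have h1 : ((n + 1 : ℕ) : ℝ) ≠ 0 := Nat.cast_ne_zero.mpr (Nat.succ_ne_zero n)
      have h2 : (n.factorial : ℝ) ≠ 0 := Nat.cast_ne_zero.mpr n.factorial_ne_zero
      field_simp
    · rintro ⟨i, j⟩ hp hne
      rw [Finset.HasAntidiagonal.mem_antidiagonal] at hp
      rw [hSeries_ulToExt, PowerSeries.coeff_monomial, if_neg, mul_zero]
      rintro rfl
      exact hne (by rw [Prod.mk.injEq]; exact ⟨by simpa using hp, rfl⟩)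
    · intro h
      exact absurd (Finset.HasAntidiagonal.mem_antidiagonal.mpr
        (rfl : ((n, 1) : ℕ × ℕ).1 + ((n, 1) : ℕ × ℕ).2 = n + 1)) h

theorem aug_kalkman : cmap (aug g ι _) (kalkman b) = 1 := by
  have h1 : aug g ι _ (negITheta g b) = 0 := by
    simp only [negITheta, map_neg, map_sum, smap_tm, theta, AlgHom.toLinearMap_apply,
      weilP_thetaOf, zero_tm, Finset.sum_const_zero, neg_zero]
  ext n
  rw [coeff_cmap, coeff_kalkman, map_smul, PowerSeries.coeff_one]
  cases n with
  | zero => rw [pow_zero, aug_one]; simp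
  | succ n => rw [pow_succ, aug_mul, h1, mul_zero, smul_zero, if_neg (Nat.succ_ne_zero n)]

theorem ulToExt_phi :
    cmap (smap LinearMap.id (ulToExt b).toLinearMap) (phi b) = kalkman b :=
  eul_unique b (coeff_zero_hSeries b _) (eul_push_phi b _ (ulToExt_σ b)) (eul_kalkman b)
    ((aug_push_phi b _).trans (aug_kalkman b).symm)

/-! ### The differential of `Φ` -/

/-- The connection `-i(t) + l(θ)`. -/
abbrev connection : PowerSeries (STensor (Weil g ι) (UD b)) := -iT b + lTheta b

/-- The total differential lowers the index in its `U(Dg)`-part and so drops the differential of the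
constant coefficient. The Leibniz rule for that part at index `n + 1` has two boundary terms which
`totalD` does not see; the hypotheses make them vanish. -/
theorem totalD_mul {φ ψ : PowerSeries (STensor (Weil g ι) (UD b))}
    (hφ : smap (sg _) (udD b) (PowerSeries.coeff 0 φ) = 0)
    (hψ : smap (sg _) (udD b) (PowerSeries.coeff 0 ψ) = 0) :
    totalD b (φ * ψ) = totalD b φ * ψ + cmap (sg _) φ * totalD b ψ := by
  have h1 := cmap_der ((weilD_isDer b).smap_left_odd (B := UD b) (weilD_σ b)) φ ψ
  have h2 := cmap_der ((udD_isDer b).smap_right_odd (A := Weil g ι) (udD_σ b)) φ ψ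
  ext n
  have h3 := congrArg (PowerSeries.coeff n) h1
  have h4 := congrArg (PowerSeries.coeff (n + 1)) h2
  rw [coeff_cmap, map_add, PowerSeries.coeff_mul _ (cmap _ φ), PowerSeries.coeff_mul _ (cmap _ φ)] at h3
  rw [coeff_cmap, map_add, PowerSeries.coeff_mul _ (cmap _ φ), PowerSeries.coeff_mul _ (cmap _ φ),
    Finset.Nat.sum_antidiagonal_succ, Finset.Nat.sum_antidiagonal_succ'] at h4
  simp only [coeff_cmap, hφ, hψ, zero_mul, mul_zero, zero_add] at h3 h4
  rw [coeff_totalD, h3, h4, map_add, PowerSeries.coeff_mul, PowerSeries.coeff_mul]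
  simp only [coeff_totalD, coeff_cmap, add_mul, mul_add, Finset.sum_add_distrib]
  abel

theorem smap_sg_udD_one : smap (sg (Weil g ι)) (udD b) 1 = 0 :=
  ((udD_isDer b).smap_right_odd (udD_σ b)).map_one sg_one

theorem coeff_zero_inclD_phi : PowerSeries.coeff 0 (inclD b (phi b)) = 1 := by
  rw [inclD, coeff_cmap, phi, coeff_zero_sol]
  exact smap_one _ _ rfl (map_one (ulToUd b))

theorem sg_inclD_phi : cmap (sg _) (inclD b (phi b)) = inclD b (phi b) := by
  ext n
  have h : ∀ z : STensor (Weil g ι) (UL ι), SuperAlg.σ (smap LinearMap.id (ulToUd b).toLinearMap z) =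
      smap LinearMap.id (ulToUd b).toLinearMap (SuperAlg.σ z) := fun z => by
    induction z using stensor_induction with
    | zero => simp
    | add x y hx hy => simp only [map_add, hx, hy]
    | tm w u =>
      simp only [smap_tm, σ_tm, AlgHom.toLinearMap_apply, ulToUd_σ, LinearMap.id_apply]
  rw [coeff_cmap, inclD, coeff_cmap, AlgHom.toLinearMap_apply, h,
    σ_of_mem_degZero b (coeff_phi_mem_degZero b n)]

/-- `E` acts on the Weil factor, where it commutes both with the Weil differential and with the
parity involution that accompanies the differential of `U(Dg)`. -/
theorem eul_totalD (φ : PowerSeries (STensor (Weil g ι) (UD b))) :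
    eul b (UD b) (totalD b φ) = totalD b (eul b (UD b) φ) := by
  ext n
  simp only [eul, coeff_cmap, coeff_totalD, map_add, smap_smap]
  exact congrArg₂ (· + ·)
    (LinearMap.congr_fun (congrArg₂ smap (LinearMap.ext fun w => weilE_weilD b w) rfl) _)
    (LinearMap.congr_fun (congrArg₂ smap (LinearMap.ext fun w => weilE_σ b w) rfl) _)

/-- The homotopy formula on the completion of `Wg ⊗ U(Dg)`. -/
theorem eul_eq_homotopy (φ : PowerSeries (STensor (Weil g ι) (UD b))) :
    eul b (UD b) φ = totalD b (cmap (smap (weilK b) LinearMap.id) φ) +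
      cmap (smap (weilK b) LinearMap.id) (totalD b φ) := by
  have h1 : ∀ z : STensor (Weil g ι) (UD b), smap (weilE b) LinearMap.id z =
      smap (weilD b) LinearMap.id (smap (weilK b) LinearMap.id z) +
        smap (weilK b) LinearMap.id (smap (weilD b) LinearMap.id z) := fun z => by
    rw [smap_smap, smap_smap, ← LinearMap.add_apply]
    congr 1
    exact smap_add_left _ _ _
  have h2 : ∀ z : STensor (Weil g ι) (UD b),
      smap (sg _) (udD b) (smap (weilK b) LinearMap.id z) +
        smap (weilK b) LinearMap.id (smap (sg _) (udD b) z) = 0 := fun z => by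
    induction z using stensor_induction with
    | zero => simp
    | add x y hx hy =>
      rw [← add_zero (0 : STensor (Weil g ι) (UD b))]
      nth_rw 1 [← hx]
      rw [← hy]
      simp only [map_add]
      abel
    | tm w u =>
      simp only [smap_tm, AlgHom.toLinearMap_apply, weilK_σ, neg_tm, LinearMap.id_apply,
        add_neg_cancel]
  ext n
  simp only [eul, map_add, coeff_cmap, coeff_totalD, h1]
  have h3 := h2 (PowerSeries.coeff (n + 1) φ)
  rw [add_add_add_comm, h3, add_zero]

theorem sg_connection : cmap (sg _) (connection b) = -connection b := by
  have h1 : ∀ z : MvPolynomial ι ℝ ⊗[ℝ] MvPolynomial ι ℝ,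
      SuperAlg.σ (place g (Igen b) z) = -place g (Igen b) z := fun z => by
    induction z using TensorProduct.induction_on with
    | zero => simp
    | add z z' h h' => simp only [map_add, h, h', neg_add]
    | tmul s p => rw [place_tmul, σ_tm, σ_wt_one, σ_Igen, tm_neg]
  have h2 : SuperAlg.σ (lThetaCoeff g b) = -lThetaCoeff g b := by
    simp only [lThetaCoeff, map_sum, σ_tm, theta, σ_thetaOf, σ_lgen, neg_tm,
      Finset.sum_neg_distrib]
  ext n
  rw [coeff_cmap, AlgHom.toLinearMap_apply, connection, iT_eq_placeSeries, lTheta_eq]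
  simp only [map_add, map_neg, coeff_placeSeries, PowerSeries.coeff_C]
  split_ifs <;> simp only [h1, h2, map_zero, neg_add, neg_zero]

/-- The homotopy kills `θ` and with it `l(θ)`. Hence `h` comes from `U(L(S⁺g))` although the
connection does not. -/
theorem weilK_connection :
    cmap (smap (weilK b) LinearMap.id) (connection b) = hSeries b (Igen b) := by
  have h : cmap (smap (weilK b) LinearMap.id) (lTheta b) = 0 := by
    ext n
    rw [coeff_cmap, lTheta_eq, PowerSeries.coeff_C, map_zero]
    split_ifs
    · simp only [lThetaCoeff, map_sum, smap_tm, theta, weilK_thetaOf, zero_tm,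
        Finset.sum_const_zero]
    · rw [map_zero]
  rw [connection, cmap_add, h, add_zero, cmap_neg, hSeries, iT_eq_placeSeries]

theorem aug_connection : cmap (aug g ι (UD b)) (connection b) = 0 := by
  ext n
  rw [coeff_cmap, connection, iT_eq_placeSeries, lTheta_eq]
  simp only [map_add, map_neg, coeff_placeSeries, PowerSeries.coeff_C, map_zero]
  have h1 : aug g ι _ (lThetaCoeff g b) = 0 := by
    simp only [lThetaCoeff, map_sum, smap_tm, theta, AlgHom.toLinearMap_apply, weilP_thetaOf,
      zero_tm, Finset.sum_const_zero]
  have h2 : Odd n → aug g ι _ (place g (Igen b) (canon ι ^ ((n + 1) / 2))) = 0 := by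
    rintro ⟨k, rfl⟩
    rw [show (2 * k + 1 + 1) / 2 = k + 1 by omega, canon_pow, map_sum, map_sum]
    refine Finset.sum_eq_zero fun f _ => ?_
    rw [place_tmul, smap_tm, AlgHom.toLinearMap_apply, weilP_wt, map_prod]
    simp only [MvPolynomial.aeval_X, Finset.prod_const, Finset.card_univ, Fintype.card_fin]
    rw [zero_pow (Nat.succ_ne_zero k), zero_mul, map_zero, zero_tm]
  split_ifs with h3 h4 h4
  · rw [h2 h3, h1, neg_zero, add_zero]
  · rw [h2 h3, map_zero, neg_zero, add_zero]
  · rw [h1, map_zero, neg_zero, add_zero]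
  · rw [map_zero, neg_zero, add_zero]

/-- The homotopy formula with `Kα = h` and flatness: since `K` and `α` are odd, `K(α²) = hα - αh`.
-/
theorem eul_connection : eul b (UD b) (connection b) = totalD b (hSeries b (Igen b)) -
    hSeries b (Igen b) * connection b + connection b * hSeries b (Igen b) := by
  rw [eul_eq_homotopy, totalD_maurerCartan, cmap_neg,
    cmap_der ((weilK_isDer b).smap_left_odd (weilK_σ b)), weilK_connection, sg_connection]
  noncomm_ring

/-- The defect `dΦ - Φα` solves `E X = X h`: in `E(dΦ) - E(Φα)` the terms `Φ dh` and `Φhα` cancel.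
No sign arises from `Φ`, which is even. The augmentation of the defect is the differential of `1`,
hence zero. -/
theorem totalD_inclD_phi :
    totalD b (inclD b (phi b)) = inclD b (phi b) * connection b := by
  have hE : eul b (UD b) (inclD b (phi b)) = inclD b (phi b) * hSeries b (Igen b) := by
    rw [← ulToUd_comp_plusGen]
    exact eul_push_phi b _ (ulToUd_σ b)
  have hP : cmap (aug g ι (UD b)) (inclD b (phi b)) = 1 := aug_push_phi b (ulToUd b)
  have hD : totalD b (inclD b (phi b) * hSeries b (Igen b)) =
      totalD b (inclD b (phi b)) * hSeries b (Igen b) +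
        inclD b (phi b) * totalD b (hSeries b (Igen b)) := by
    rw [totalD_mul, sg_inclD_phi]
    · rw [coeff_zero_inclD_phi, smap_sg_udD_one]
    · rw [coeff_zero_hSeries, map_zero]
  refine sub_eq_zero.mp (eul_eq_zero b (coeff_zero_hSeries b (Igen b)) ?_ ?_)
  · have hsub : ∀ φ ψ, eul b (UD b) (φ - ψ) = eul b (UD b) φ - eul b (UD b) ψ :=
      fun φ ψ => cmap_sub _ φ ψ
    rw [hsub, eul_totalD, hE, hD, eul_mul, hE, eul_connection]
    noncomm_ring
  · rw [cmap_sub, cmap_mul _ aug_mul, aug_connection, mul_zero, sub_zero]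
    ext n
    -- The Weil differential takes values in the augmentation ideal; the differential of `U(Dg)`
    -- commutes with the augmentation and so meets only the coefficients of `1`.
    have h1 : aug g ι (UD b) ∘ₗ smap (weilD b) LinearMap.id = 0 := stensor_ext fun w u => by
      rw [LinearMap.comp_apply, smap_tm, smap_tm, AlgHom.toLinearMap_apply, weilP_weilD, zero_tm]
      rfl
    have h2 : aug g ι (UD b) ∘ₗ smap (sg _) (udD b) = smap (sg _) (udD b) ∘ₗ aug g ι (UD b) :=
      stensor_ext fun w u => by
        simp only [LinearMap.comp_apply, smap_tm, AlgHom.toLinearMap_apply, weilP_σ,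
          LinearMap.id_apply]
    have e1 := LinearMap.congr_fun h1 (PowerSeries.coeff n (inclD b (phi b)))
    have e2 := LinearMap.congr_fun h2 (PowerSeries.coeff (n + 1) (inclD b (phi b)))
    have e3 := congrArg (PowerSeries.coeff (n + 1)) hP
    rw [coeff_cmap, PowerSeries.coeff_one, if_neg (Nat.succ_ne_zero n)] at e3
    rw [LinearMap.comp_apply, LinearMap.zero_apply] at e1
    rw [LinearMap.comp_apply, LinearMap.comp_apply, e3, map_zero] at e2
    rw [coeff_cmap, coeff_totalD, map_add, e1, e2, map_zero, add_zero]

end properties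

end
end DgTwist

theorem theorem3p10 {g : Type*} [LieRing g] [LieAlgebra ℝ g] {ι : Type*} [Fintype ι]
    (b : Module.Basis ι ℝ g) :
    ∃ Φ : (PowerSeries (DgTwist.STensor (DgTwist.Weil g ι) (DgTwist.UL ι)))ˣ,
      DgTwist.IsInvariant b Φ.val ∧
      DgTwist.IsGroupLike Φ.val ∧
      DgTwist.IsDegreeZero Φ.val ∧
      DgTwist.inclD b Φ⁻¹.val * DgTwist.totalD b (DgTwist.inclD b Φ.val) =
        -DgTwist.iT b + DgTwist.lTheta b ∧
      DgTwist.cmap (DgTwist.smap LinearMap.id (DgTwist.ulToExt b).toLinearMap) Φ.val =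
        DgTwist.kalkman b := by
  -- A power series with constant coefficient `1` is a unit, so `Φ⁻¹` already exists in the
  -- completion of `Wg ⊗ U(L(S⁺g))`.
  have h1 : PowerSeries.constantCoeff (DgTwist.phi b) =
      ((1 : (DgTwist.STensor (DgTwist.Weil g ι) (DgTwist.UL ι))ˣ) : _) := by
    rw [← PowerSeries.coeff_zero_eq_constantCoeff_apply, DgTwist.phi, DgTwist.coeff_zero_sol,
      Units.val_one]
  refine ⟨⟨DgTwist.phi b, PowerSeries.invOfUnit (DgTwist.phi b) 1,
    PowerSeries.mul_invOfUnit _ _ h1, PowerSeries.invOfUnit_mul _ _ h1⟩,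
    DgTwist.isInvariant_phi b, DgTwist.isGroupLike_phi b, DgTwist.isDegreeZero_phi b, ?_,
    DgTwist.ulToExt_phi b⟩
  have h2 : DgTwist.inclD b (PowerSeries.invOfUnit (DgTwist.phi b) 1) *
      DgTwist.inclD b (DgTwist.phi b) = 1 := by
    rw [DgTwist.inclD, DgTwist.inclD, ← DgTwist.push_mul _ (DgTwist.ulToUd_σ b),
      PowerSeries.invOfUnit_mul _ _ h1, DgTwist.push_one]
  change DgTwist.inclD b (PowerSeries.invOfUnit (DgTwist.phi b) 1) *
    DgTwist.totalD b (DgTwist.inclD b (DgTwist.phi b)) = _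
  rw [DgTwist.totalD_inclD_phi, ← mul_assoc, h2, one_mul]
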